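/- Let $\mathbb{S}^1\subset\mathbb{C}$ be the unit circle, and let $\mathrm{Homeo}^+(\mathbb{S}^1)$ be the group of its orientation preserving homeomorphisms with the uniform topology, i.e. the topology of the metric $$d(f,g)=\sup_{x\in\mathbb{S}^1}\max\{|f(x)-g(x)|,\ |f^{-1}(x)-g^{-1}(x)|\}.$$ Let $\mathrm{PSL}(2,\mathbb{R})\le\mathrm{Homeo}^+(\mathbb{S}^1)$ be the subgroup of Möbius transformations of the circle, i.e. of the maps which become $t\mapsto\frac{at+b}{ct+d}$ with $a,b,c,d\in\mathbb{R}$, $ad-bc=1$, on $\mathbb{R}\cup\{\infty\}$ when $\mathbb{S}^1$ is identified with $\mathbb{R}\cup\{\infty\}$ by the Cayley transform $z\mapsto i\,\frac{1+z}{1-z}$. **Theorem.** $\mathrm{PSL}(2,\mathbb{R})$ is a maximal closed subgroup of $\mathrm{Homeo}^+(\mathbb{S}^1)$: it is a closed subgroup of $\mathrm{Homeo}^+(\mathbb{S}^1)$, it is not the whole group, and every closed subgroup $G$ of $\mathrm{Homeo}^+(\mathbb{S}^1)$ with $\mathrm{PSL}(2,\mathbb{R})\le G$ is either $\mathrm{PSL}(2,\mathbb{R})$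 or $\mathrm{Homeo}^+(\mathbb{S}^1)$. -/

import Mathlib

open scoped MatrixGroups

noncomputable section

/-- The uniform metric on the homeomorphism group of the circle, induced by
`f ↦ (f, f⁻¹) ∈ C(S¹, S¹) × C(S¹, S¹)`; see `dist_homeo_eq` for the explicit formula. Here `Circle`
is the unit circle of `ℂ` with the Euclidean distance. -/
instance homeoCircleMetricSpace : MetricSpace (Circle ≃ₜ Circle) :=
  MetricSpace.induced
    (fun f => ((f : C(Circle, Circle)), (f.symm : C(Circle, Circle))))
    (fun f g h => by
      ext x
      have h1 : (f : C(Circle, Circle)) = (g : C(Circle, Circle)) := (Prod.mk.inj h).1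
      exact congrArg (Subtype.val) (DFunLike.congr_fun h1 x))
    inferInstance

/-- The distance is `sup_x max (d (f x) (g x)) (d (f⁻¹ x) (g⁻¹ x))`. -/
theorem dist_homeo_eq (f g : Circle ≃ₜ Circle) :
    dist f g = ⨆ x : Circle, max (dist (f x) (g x)) (dist (f⁻¹ x) (g⁻¹ x)) := by
  have hd : dist f g = max (dist (f : C(Circle, Circle)) (g : C(Circle, Circle)))
      (dist (f.symm : C(Circle, Circle)) (g.symm : C(Circle, Circle))) := rfl
  have key : ∀ x : Circle, max (dist (f x) (g x)) (dist (f⁻¹ x) (g⁻¹ x)) ≤ dist f g := by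
    intro x
    rw [hd]
    exact max_le_max
      (ContinuousMap.dist_apply_le_dist (f := (f : C(Circle, Circle)))
        (g := (g : C(Circle, Circle))) x)
      (ContinuousMap.dist_apply_le_dist (f := (f.symm : C(Circle, Circle)))
        (g := (g.symm : C(Circle, Circle))) x)
  have hb : BddAbove (Set.range fun x : Circle =>
      max (dist (f x) (g x)) (dist (f⁻¹ x) (g⁻¹ x))) :=
    ⟨dist f g, by rintro _ ⟨x, rfl⟩; exact key x⟩
  refine le_antisymm ?_ (ciSup_le key)
  have h0 : 0 ≤ ⨆ x : Circle, max (dist (f x) (g x)) (dist (f⁻¹ x) (g⁻¹ x)) :=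
    Real.iSup_nonneg fun x => le_max_of_le_left dist_nonneg
  rw [hd]
  refine max_le ((ContinuousMap.dist_le h0).2 fun x => ?_)
    ((ContinuousMap.dist_le h0).2 fun x => ?_)
  · exact (le_max_left _ _).trans (le_ciSup hb x)
  · exact (le_max_right _ _).trans (le_ciSup hb x)

/-- The subgroup of orientation preserving homeomorphisms of the circle: those which lift,
through the covering `t ↦ exp (i t)`, to an increasing homeomorphism of the line (an order
automorphism of `ℝ`). -/
def orientationPreserving : Subgroup (Circle ≃ₜ Circle) where
  carrier := {f | ∃ F : ℝ ≃o ℝ, ∀ t : ℝ, f (Circle.exp t) = Circle.exp (F t)}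
  one_mem' := ⟨OrderIso.refl ℝ, fun _ => rfl⟩
  mul_mem' := by
    rintro f g ⟨F, hF⟩ ⟨G, hG⟩
    refine ⟨G.trans F, fun t => ?_⟩
    change f (g (Circle.exp t)) = Circle.exp (F (G t))
    rw [hG, hF]
  inv_mem' := by
    rintro f ⟨F, hF⟩
    refine ⟨F.symm, fun t => ?_⟩
    change f.symm (Circle.exp t) = Circle.exp (F.symm t)
    rw [Homeomorph.symm_apply_eq, hF, OrderIso.apply_symm_apply]

/-- `Homeo⁺(S¹)`: the group of orientation preserving homeomorphisms of the circle, with the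
restriction of the uniform metric. -/
abbrev HomeoPlus : Type := orientationPreserving

/-- The number `i (1 + z) / (1 - z)` is real for `z ≠ 1` on the unit circle. -/
theorem ofReal_re_cayley {z : Circle} (hz : z ≠ 1) :
    (((Complex.I * (1 + z) / (1 - z)).re : ℝ) : ℂ) = Complex.I * (1 + z) / (1 - z) := by
  have h0 : (z : ℂ) ≠ 0 := z.coe_ne_zero
  have h1 : (1 : ℂ) - z ≠ 0 := fun h => hz (Circle.ext (by simpa using (sub_eq_zero.1 h).symm))
  rw [← Complex.conj_eq_iff_re]
  have h2 : (1 : ℂ) - (z : ℂ)⁻¹ ≠ 0 := by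
    intro h
    apply h1
    field_simp at h
    linear_combination -h
  simp only [map_div₀, map_mul, map_add, map_sub, map_one, Complex.conj_I,
    ← Circle.coe_inv_eq_conj, Circle.coe_inv]
  rw [div_eq_div_iff h2 h1]
  field_simp
  ring

theorem ofReal_add_I_ne_zero (t : ℝ) : (t : ℂ) + Complex.I ≠ 0 := fun h => by
  simpa using congrArg Complex.im h

/-- The Cayley coordinate `z ↦ i (1 + z) / (1 - z)` (a real number for `z ≠ 1`), `1 ↦ ∞`, a bijection
of the unit circle with the real projective line `ℝ ∪ {∞}`; its inverse is
`t ↦ (t - i) / (t + i)`, `∞ ↦ 1`. -/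
def cayley : Circle ≃ OnePoint ℝ where
  toFun z := open Classical in
    if z = 1 then OnePoint.infty
    else ((Complex.I * (1 + z) / (1 - z)).re : OnePoint ℝ)
  invFun w := w.elim 1 fun t : ℝ =>
    Circle.ofConjDivSelf ((t : ℂ) + Complex.I) (ofReal_add_I_ne_zero t)
  left_inv z := by
    by_cases hz : z = 1
    · simp [hz]
    have h1 : (1 : ℂ) - z ≠ 0 := fun h => hz (Circle.ext (by simpa using (sub_eq_zero.1 h).symm))
    have hr := ofReal_re_cayley hz
    simp only [if_neg hz, OnePoint.elim_some]
    apply Circle.ext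
    have hne := ofReal_add_I_ne_zero (Complex.I * (1 + z) / (1 - z)).re
    simp only [Circle.ofConjDivSelf_coe, map_add, Complex.conj_ofReal, Complex.conj_I]
    rw [div_eq_iff hne, hr]
    field_simp
    ring
  right_inv w := by
    induction w using OnePoint.rec with
    | infty => simp
    | coe t =>
      have hne := ofReal_add_I_ne_zero t
      have hz : Circle.ofConjDivSelf ((t : ℂ) + Complex.I) hne ≠ 1 := by
        intro h
        have h2 := congrArg (fun z : Circle => (z : ℂ)) h
        simp only [Circle.ofConjDivSelf_coe, map_add, Complex.conj_ofReal, Complex.conj_I,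
          Circle.coe_one] at h2
        rw [div_eq_one_iff_eq hne] at h2
        have h3 := congrArg Complex.im h2
        norm_num at h3
      simp only [OnePoint.elim_some]
      have h1 : (1 : ℂ) - (t - Complex.I) / (t + Complex.I) ≠ 0 := by
        intro h
        apply hz
        apply Circle.ext
        simp only [Circle.ofConjDivSelf_coe, map_add, Complex.conj_ofReal, Complex.conj_I,
          Circle.coe_one]
        linear_combination -h
      have key : Complex.I * (1 + (t - Complex.I) / (t + Complex.I)) /
          (1 - (t - Complex.I) / (t + Complex.I)) = (t : ℂ) := by
        rw [div_eq_iff h1]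
        field_simp
        ring
      simp only [Circle.ofConjDivSelf_coe, map_add, Complex.conj_ofReal, Complex.conj_I,
        ← sub_eq_add_neg, key, Complex.ofReal_re]
      exact if_neg hz

/-- `PSL(2, ℝ)` as a subgroup of `Homeo⁺(S¹)`: the group of Möbius transformations
`t ↦ (a t + b) / (c t + d)`, `a d - b c = 1`, of the real projective line `ℝ ∪ {∞}` (Mathlib's action
of `GL(2, ℝ)` on `OnePoint ℝ`), carried to the circle by the Cayley coordinate. -/
def PSL2R : Subgroup HomeoPlus where
  carrier := {f | ∃ A : SL(2, ℝ), ∀ z : Circle,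
    cayley ((f : Circle ≃ₜ Circle) z) = (A : GL (Fin 2) ℝ) • cayley z}
  one_mem' := ⟨1, fun z => by simp⟩
  mul_mem' := by
    rintro f g ⟨A, hA⟩ ⟨B, hB⟩
    refine ⟨A * B, fun z => ?_⟩
    change cayley ((f : Circle ≃ₜ Circle) ((g : Circle ≃ₜ Circle) z)) = _
    rw [hA, hB, map_mul, mul_smul]
  inv_mem' := by
    rintro f ⟨A, hA⟩
    refine ⟨A⁻¹, fun z => ?_⟩
    rw [map_inv, eq_inv_smul_iff, ← hA]
    exact congrArg cayley ((f : Circle ≃ₜ Circle).apply_symm_apply z)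

end

/-! Rotations are Möbius, so any homeomorphism can be rotated to fix `1`, the point at infinity of
the Cayley coordinate. A homeomorphism fixing `1` is an increasing homeomorphism of the line, and it
lies in `PSL2R` exactly when it is affine (`mem_PSL2R_iff_affine`). Being affine is a family of
closed conditions on values, which gives closedness; the cube map gives properness.

For maximality, let `G` properly contain `PSL2R`, and let `Γ = pathGroup G` be the path component of
the identity in the stabilizer of `1` in `G`. It contains the affine group, and also a nontrivial
element fixing `0` and `1` (`exists_nonaffine`). The heart of the proof is that `Γ` is transitive on
increasing tuples of every length (`exists_smul_eq_of_strictMono`). Elements of `G` then interpolate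
any homeomorphism fixing `1` on arbitrarily fine grids, so `G` is dense (`exists_dist_le`), and a
closed dense `G` is everything.

Transitivity is proved by induction on the length `m`, with two ingredients.

Dynamics (`exists_stabilizer_smul_ne`): the stabilizer of an `m`-tuple fixes no point to the right
of it. For `m ≥ 3` the action cannot be sharply transitive on `m`-tuples (`exists_fixing_of_card`).
Otherwise Hölder's theorem would turn the stabilizer of `m - 1` points, acting on a half line, into
translations; inside the stabilizer of `m - 2` points a convexity argument then leaves no room for
anything else. So some stabilizer moves some point, transitivity spreads this to a whole gap of
every `m`-tuple, and conjugation by `t ↦ -1/t` shifts the gap to the right until it is the last one.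

Topology (`exists_smul_eq_of_no_fixed_point`): without fixed points the stabilizer orbits to the
right are unbounded, but stabilizers might be totally disconnected, so connectedness cannot be
applied to them directly. The induction therefore also carries that the orbit map of a tuple is
essential along some continuous family in `Γ` (a substitute for nonzero degree, resting on the
no-retraction theorem), and that stabilizers are generated by elements joined to `1` in `Γ` inside
arbitrarily small neighbourhoods. `exists_essential_append` adds a coordinate to an essential tuple.
`stabilizer_le_closure_joinedIn` passes the generation property on, by a monodromy argument over the
simply connected line. -/

section

open MeasureTheory Metric Set Topology

/-! ### No retraction of a ball onto its boundary, by the volume polynomial -/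

section NoRetraction

variable {m : ℕ}

local notation "𝔼" => EuclideanSpace ℝ (Fin m)

/-- A polynomial identity of bounded degree extends from small parameters to `1`: the evaluation at
`1` is a fixed linear combination of evaluations at small positive nodes. -/
theorem exists_interpolation_weights (m : ℕ) {t₀ : ℝ} (ht₀ : 0 < t₀) :
    ∃ (v w : ℕ → ℝ), (∀ i, 0 < v i ∧ v i < t₀) ∧
      ∀ p : Polynomial ℝ, p.natDegree ≤ m →
        p.eval 1 = ∑ i ∈ Finset.range (m + 1), w i * p.eval (v i) := by
  classical
  let v : ℕ → ℝ := fun i => t₀ / (i + 2)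
  have hv : Function.Injective v := by
    intro i j hij
    have hi : (i : ℝ) + 2 ≠ 0 := by positivity
    have hj : (j : ℝ) + 2 ≠ 0 := by positivity
    have h : t₀ * (j + 2) = t₀ * (i + 2) := by
      have := hij
      simp only [v] at this
      rwa [div_eq_div_iff hi hj] at this
    have := mul_left_cancel₀ ht₀.ne' h
    have h2 : (j : ℝ) = i := by linarith
    exact_mod_cast h2.symm
  refine ⟨v, fun i => (Lagrange.basis (Finset.range (m + 1)) v i).eval 1, fun i => ⟨by positivity,
    ?_⟩, fun p hp => ?_⟩
  · have : (1 : ℝ) < i + 2 := by linarith [(Nat.cast_nonneg i : (0 : ℝ) ≤ i)]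
    exact div_lt_self ht₀ this
  · have hdeg : p.degree < (Finset.range (m + 1)).card := by
      rw [Finset.card_range]
      exact lt_of_le_of_lt Polynomial.degree_le_natDegree (by exact_mod_cast Nat.lt_succ_of_le hp)
    have h := Lagrange.eq_interpolate (s := Finset.range (m + 1)) (v := v) hv.injOn hdeg
    conv_lhs => rw [h]
    rw [Lagrange.interpolate_apply, Polynomial.eval_finsetSum]
    refine Finset.sum_congr rfl fun i _ => ?_
    rw [Polynomial.eval_mul, Polynomial.eval_C, mul_comm]

/-- `t ↦ det (1 + t A)` is a polynomial of degree at most the dimension. -/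
theorem exists_polynomial_det_one_add_smul (A : 𝔼 →L[ℝ] 𝔼) :
    ∃ p : Polynomial ℝ, p.natDegree ≤ m ∧
      ∀ t : ℝ, p.eval t = (ContinuousLinearMap.id ℝ 𝔼 + t • A).det := by
  classical
  let b := (EuclideanSpace.basisFun (Fin m) ℝ).toBasis
  let M := LinearMap.toMatrix b b (A : 𝔼 →ₗ[ℝ] 𝔼)
  refine ⟨_, (Polynomial.natDegree_det_X_add_C_le M 1).trans (by simp), fun t => ?_⟩
  rw [ContinuousLinearMap.det, ← LinearMap.det_toMatrix b]
  rw [← Polynomial.coe_evalRingHom, RingHom.map_det]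
  congr 1
  ext i j
  simp [M, LinearMap.toMatrix_apply, Matrix.one_apply, add_comm]
  by_cases h : i = j <;> simp [h, b, mul_comm]

/-- The determinant is `1` at parameter `0` and cannot vanish up to `t`, since a kernel vector would
satisfy `‖x‖ ≤ s‖A‖‖x‖` with `s‖A‖ < 1`. -/
theorem det_id_add_smul_pos {A : 𝔼 →L[ℝ] 𝔼} {t : ℝ} (ht : 0 ≤ t) (hA : t * ‖A‖ < 1) :
    0 < (ContinuousLinearMap.id ℝ 𝔼 + t • A).det := by
  obtain ⟨p, -, hp⟩ := exists_polynomial_det_one_add_smul A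
  rw [← hp]
  by_contra hneg
  push Not at hneg
  have h0 : p.eval 0 = 1 := by
    have : ContinuousLinearMap.id ℝ 𝔼 + (0 : ℝ) • A = ContinuousLinearMap.id ℝ 𝔼 := by
      ext1 x; simp
    rw [hp, this]
    exact LinearMap.det_id
  obtain ⟨s, hs, hs0⟩ := intermediate_value_Icc' ht (p.continuous.continuousOn (s := Icc 0 t))
    (show (0 : ℝ) ∈ Icc (p.eval t) (p.eval 0) from ⟨hneg, by rw [h0]; exact zero_le_one⟩)
  change p.eval s = 0 at hs0
  rw [hp] at hs0
  have hker := LinearMap.bot_lt_ker_of_det_eq_zero (f := ((ContinuousLinearMap.id ℝ 𝔼 + s • A :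
    𝔼 →L[ℝ] 𝔼) : 𝔼 →ₗ[ℝ] 𝔼)) hs0
  obtain ⟨x, hx, hx0⟩ := Submodule.exists_mem_ne_zero_of_ne_bot hker.ne'
  have hx1 : x + s • A x = 0 := by simpa using hx
  have h1 : ‖x‖ ≤ s * ‖A‖ * ‖x‖ := by
    have : x = -(s • A x) := eq_neg_of_add_eq_zero_left hx1
    calc ‖x‖ = ‖s • A x‖ := by rw [← norm_neg (s • A x), ← this]
      _ = s * ‖A x‖ := by rw [norm_smul, Real.norm_of_nonneg hs.1]
      _ ≤ s * (‖A‖ * ‖x‖) := by gcongr; exacts [hs.1, A.le_opNorm x]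
      _ = _ := by ring
  have h2 : s * ‖A‖ < 1 := lt_of_le_of_lt (by gcongr; exact hs.2) hA
  have h3 : 0 < ‖x‖ := norm_pos_iff.2 hx0
  nlinarith

/-- There is no smooth retraction of a ball onto its boundary sphere. -/
theorem no_smooth_retraction {R : ℝ} (hR : 0 < R) {r : 𝔼 → 𝔼} (hr : ContDiff ℝ 1 r)
    (hnorm : ∀ x, ‖r x‖ = R) (hid : ∀ x, ‖x‖ = R → r x = x) : False := by
  let η : 𝔼 → 𝔼 := fun x => r x - x
  have hη : ContDiff ℝ 1 η := hr.sub contDiff_id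
  have hdη : Differentiable ℝ η := hη.differentiable (by norm_num)
  have hcfd : Continuous (fderiv ℝ η) := hη.continuous_fderiv (by norm_num)
  obtain ⟨C, hC⟩ : ∃ C : ℝ, ∀ x ∈ closedBall (0 : 𝔼) R, ‖fderiv ℝ η x‖ ≤ C := by
    obtain ⟨C, hC⟩ := (isCompact_closedBall (0 : 𝔼) R).exists_bound_of_continuousOn
      hcfd.continuousOn
    exact ⟨C, hC⟩
  set K : ℝ := max C 1 with hK
  have hKpos : 0 < K := lt_max_of_lt_right one_pos
  have hKb : ∀ x ∈ closedBall (0 : 𝔼) R, ‖fderiv ℝ η x‖ ≤ K := fun x hx =>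
    (hC x hx).trans (le_max_left _ _)
  have hlip : ∀ x ∈ closedBall (0 : 𝔼) R, ∀ y ∈ closedBall (0 : 𝔼) R,
      ‖η x - η y‖ ≤ K * ‖x - y‖ := fun x hx y hy =>
    (convex_closedBall (0 : 𝔼) R).norm_image_sub_le_of_norm_fderiv_le
      (fun z _ => hdη z) hKb hy hx
  -- Below `t₀` the perturbation `t • η` is a contraction on the ball with constant under `1/2`, so
  -- `g t` is injective there.
  let t₀ : ℝ := 1 / (2 * K)
  have ht₀ : 0 < t₀ := by positivity
  let g : ℝ → 𝔼 → 𝔼 := fun t x => x + t • η x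
  let B : Set 𝔼 := ball 0 R
  have hBc : B ⊆ closedBall 0 R := ball_subset_closedBall
  have htK : ∀ t, 0 < t → t < t₀ → t * K < 1 / 2 := by
    intro t _ ht
    calc t * K < t₀ * K := by gcongr
      _ = 1 / 2 := by simp only [t₀]; field_simp
  have key : ∀ t, 0 < t → t < t₀ →
      ∫ x in B, (ContinuousLinearMap.id ℝ 𝔼 + t • fderiv ℝ η x).det = volume.real B := by
    intro t ht0 ht1
    have htK' := htK t ht0 ht1
    have ht12 : t < 1 := by
      have : t * 1 ≤ t * K := by gcongr; exact le_max_right _ _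
      linarith
    obtain ⟨c, hc⟩ : ∃ c : NNReal, (c : ℝ) = t * K := ⟨⟨t * K, by positivity⟩, rfl⟩
    have happ : ApproximatesLinearOn (g t) (ContinuousLinearEquiv.refl ℝ 𝔼 : 𝔼 →L[ℝ] 𝔼) B
        c := by
      intro x hx y hy
      have : g t x - g t y - (ContinuousLinearEquiv.refl ℝ 𝔼 : 𝔼 →L[ℝ] 𝔼) (x - y)
          = t • (η x - η y) := by
        simp only [g, ContinuousLinearEquiv.coe_coe, ContinuousLinearEquiv.refl_apply, smul_sub]
        abel
      rw [this, norm_smul, Real.norm_of_nonneg ht0.le]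
      calc t * ‖η x - η y‖ ≤ t * (K * ‖x - y‖) := by
            gcongr; exact hlip x (hBc hx) y (hBc hy)
        _ = _ := by rw [← mul_assoc, hc]
    have hinj : InjOn (g t) (closedBall 0 R) := by
      intro x hx y hy hxy
      have h1 : x - y = -(t • (η x - η y)) := by
        have : x + t • η x = y + t • η y := hxy
        rw [smul_sub, ← sub_eq_zero]
        rw [← sub_eq_zero] at this
        rw [← this]; abel
      have h2 : ‖x - y‖ ≤ t * (K * ‖x - y‖) := by
        conv_lhs => rw [h1]
        rw [norm_neg, norm_smul, Real.norm_of_nonneg ht0.le]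
        gcongr
        exact hlip x hx y hy
      have h3 : ‖x - y‖ = 0 := by
        have := norm_nonneg (x - y)
        nlinarith
      exact sub_eq_zero.1 (norm_eq_zero.1 h3)
    have hmaps : ∀ x ∈ B, g t x ∈ B := by
      intro x hx
      have hx' : ‖x‖ < R := by simpa [B] using hx
      have : g t x = (1 - t) • x + t • r x := by
        simp only [g, η, smul_sub, sub_smul, one_smul]; abel
      simp only [B, mem_ball_zero_iff, this]
      calc ‖(1 - t) • x + t • r x‖ ≤ (1 - t) * ‖x‖ + t * ‖r x‖ := by
            refine (norm_add_le _ _).trans (le_of_eq ?_)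
            rw [norm_smul, norm_smul, Real.norm_of_nonneg ht0.le,
              Real.norm_of_nonneg (by linarith)]
        _ < (1 - t) * R + t * R := by
            rw [hnorm]
            have : (1 - t) * ‖x‖ < (1 - t) * R := by
              apply mul_lt_mul_of_pos_left hx'; linarith
            linarith
        _ = R := by ring
    have hgc : Continuous (g t) := continuous_id.add (hη.continuous.const_smul t)
    -- The image is open, and boundary points are fixed by `g t`. Hence `B` is covered by the open
    -- image and the open complement of the compact image of the closed ball, and connectedness
    -- leaves only the image.
    have himage : g t '' B = B := by
      apply Subset.antisymm (by rintro _ ⟨x, hx, rfl⟩; exact hmaps x hx)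
      have hopen : IsOpen (g t '' B) := by
        rcases Nat.eq_zero_or_pos m with hm | hm
        · subst hm
          exact isOpen_discrete _
        · have : Nonempty (Fin m) := ⟨⟨0, hm⟩⟩
          refine happ.open_image (ContinuousLinearEquiv.refl ℝ 𝔼).toNonlinearRightInverse
            isOpen_ball (Or.inr ?_)
          have hnn : ((ContinuousLinearEquiv.refl ℝ 𝔼).toNonlinearRightInverse).nnnorm ≤ 1 := by
            change ‖((ContinuousLinearEquiv.refl ℝ 𝔼).symm : 𝔼 →L[ℝ] 𝔼)‖₊ ≤ 1
            exact ContinuousLinearMap.norm_id_le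
          have hpos : 0 < ((ContinuousLinearEquiv.refl ℝ 𝔼).toNonlinearRightInverse).nnnorm := by
            change 0 < ‖((ContinuousLinearEquiv.refl ℝ 𝔼).symm : 𝔼 →L[ℝ] 𝔼)‖₊
            have : ‖((ContinuousLinearEquiv.refl ℝ 𝔼).symm : 𝔼 →L[ℝ] 𝔼)‖₊ = 1 := by
              exact ContinuousLinearMap.nnnorm_id
            rw [this]; exact one_pos
          have h1 : c < 1 := by
            rw [← NNReal.coe_lt_coe, hc, NNReal.coe_one]
            linarith
          exact lt_of_lt_of_le h1 ((one_le_inv₀ hpos).2 hnn)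
      have hclosed : IsClosed (g t '' closedBall 0 R) :=
        ((isCompact_closedBall (0 : 𝔼) R).image hgc).isClosed
      have hpre : IsPreconnected B := (convex_ball (0 : 𝔼) R).isPreconnected
      have hne : (B ∩ g t '' B).Nonempty :=
        ⟨g t 0, hmaps 0 (mem_ball_self hR), 0, mem_ball_self hR, rfl⟩
      by_contra hnot
      obtain ⟨y, hyB, hy⟩ := not_subset.1 hnot
      have hsplit : B ⊆ g t '' B ∪ (g t '' closedBall 0 R)ᶜ := by
        intro z hz
        by_cases h : z ∈ g t '' closedBall 0 R
        · left
          obtain ⟨x, hx, rfl⟩ := h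
          rcases (mem_closedBall_zero_iff.1 hx).lt_or_eq with h | h
          · exact ⟨x, mem_ball_zero_iff.2 h, rfl⟩
          · have : g t x = x := by simp [g, η, hid x h]
            rw [this] at hz
            exact absurd (mem_ball_zero_iff.1 hz) (by rw [h]; exact lt_irrefl R)
        · right; exact h
      have hne2 : (B ∩ (g t '' closedBall 0 R)ᶜ).Nonempty := by
        refine ⟨y, hyB, fun h => ?_⟩
        rcases hsplit hyB with h' | h'
        · exact hy h'
        · exact h' h
      obtain ⟨z, -, hz1, hz2⟩ := hpre _ _ hopen hclosed.isOpen_compl hsplit hne hne2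
      exact hz2 (image_mono hBc hz1)
    have hder : ∀ x ∈ B, HasFDerivWithinAt (g t)
        (ContinuousLinearMap.id ℝ 𝔼 + t • fderiv ℝ η x) B x := fun x _ =>
      ((hasFDerivAt_id x).add ((hdη x).hasFDerivAt.const_smul t)).hasFDerivWithinAt
    have hcv := integral_image_eq_integral_abs_det_fderiv_smul volume (measurableSet_ball)
      hder (hinj.mono hBc) (fun _ => (1 : ℝ))
    change ∫ _ in g t '' B, (1 : ℝ) = _ at hcv
    rw [himage] at hcv
    have hl : ∫ _ in B, (1 : ℝ) = volume.real B := by simp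
    rw [← hl, hcv]
    refine setIntegral_congr_fun measurableSet_ball fun x hx => ?_
    have hpos := det_id_add_smul_pos (A := fderiv ℝ η x) ht0.le
      (lt_of_le_of_lt (mul_le_mul_of_nonneg_left (hKb x (hBc hx)) ht0.le)
        (by linarith))
    simp only [smul_eq_mul, mul_one]
    rw [abs_of_pos hpos]
  -- The integrand is a polynomial of degree at most `m` in `t`, so the volume identity for small
  -- `t` forces the one at `t = 1`, where `g 1 = r`.
  obtain ⟨v, w, hv, hw⟩ := exists_interpolation_weights m ht₀
  have hsum : ∑ i ∈ Finset.range (m + 1), w i = 1 := by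
    simpa using (hw 1 (by simp)).symm
  have hint : ∀ t : ℝ, IntegrableOn
      (fun x => (ContinuousLinearMap.id ℝ 𝔼 + t • fderiv ℝ η x).det) B := by
    intro t
    have hc : Continuous fun x => (ContinuousLinearMap.id ℝ 𝔼 + t • fderiv ℝ η x).det :=
      ContinuousLinearMap.continuous_det.comp (continuous_const.add (hcfd.const_smul t))
    exact (hc.continuousOn.integrableOn_compact (isCompact_closedBall 0 R)).mono_set hBc
  have h1 : ∫ x in B, (ContinuousLinearMap.id ℝ 𝔼 + (1 : ℝ) • fderiv ℝ η x).det
      = volume.real B := by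
    have : ∀ x, (ContinuousLinearMap.id ℝ 𝔼 + (1 : ℝ) • fderiv ℝ η x).det =
        ∑ i ∈ Finset.range (m + 1),
          w i * (ContinuousLinearMap.id ℝ 𝔼 + v i • fderiv ℝ η x).det := by
      intro x
      obtain ⟨p, hp, hpe⟩ := exists_polynomial_det_one_add_smul (fderiv ℝ η x)
      rw [← hpe, hw p hp]
      simp only [hpe]
    simp only [this]
    rw [integral_finsetSum _ fun i _ => (hint (v i)).const_mul (w i)]
    simp only [integral_const_mul]
    rw [Finset.sum_congr rfl fun i _ => by rw [key (v i) (hv i).1 (hv i).2], ← Finset.sum_mul,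
      hsum, one_mul]
  -- Since `‖r‖` is constant, the derivative of `r` has range orthogonal to `r x ≠ 0` and is not
  -- surjective.
  have h2 : ∀ x, (ContinuousLinearMap.id ℝ 𝔼 + (1 : ℝ) • fderiv ℝ η x).det = 0 := by
    intro x
    have hdr : HasFDerivAt r (ContinuousLinearMap.id ℝ 𝔼 + (1 : ℝ) • fderiv ℝ η x) x := by
      have := (hasFDerivAt_id x).add (hdη x).hasFDerivAt
      rw [one_smul]
      refine this.congr_of_eventuallyEq (Filter.Eventually.of_forall fun y => ?_)
      simp [η]
    by_contra hdet
    have hsurj : Function.Surjective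
        (ContinuousLinearMap.id ℝ 𝔼 + (1 : ℝ) • fderiv ℝ η x) := by
      have hu := LinearMap.isUnit_iff_isUnit_det
        ((ContinuousLinearMap.id ℝ 𝔼 + (1 : ℝ) • fderiv ℝ η x : 𝔼 →L[ℝ] 𝔼) : 𝔼 →ₗ[ℝ] 𝔼)
      have := hu.2 (isUnit_iff_ne_zero.2 hdet)
      exact ((Module.End.isUnit_iff _).1 this).2
    obtain ⟨y, hy⟩ := hsurj (r x)
    have hin := hdr.norm_sq
    have hconst : HasFDerivAt (fun z => ‖r z‖ ^ 2) (0 : 𝔼 →L[ℝ] ℝ) x := by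
      simp only [hnorm]
      exact hasFDerivAt_const _ _
    have := congrArg (fun L : 𝔼 →L[ℝ] ℝ => L y) (hin.unique hconst)
    rw [_root_.smul_apply, ContinuousLinearMap.comp_apply, hy, innerSL_apply_apply,
      real_inner_self_eq_norm_sq, hnorm, _root_.zero_apply] at this
    have hR2 : 0 < R ^ 2 := by positivity
    simp at this
    exact hR.ne' this
  simp only [h2, integral_zero] at h1
  have : 0 < volume.real B := by
    rw [Measure.real, ENNReal.toReal_pos_iff]
    exact ⟨measure_ball_pos _ _ hR, measure_ball_lt_top⟩
  linarith

/-- A continuous self-map of Euclidean space which is the identity far away has a zero. -/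
theorem exists_zero_of_eq_id_outside {f : 𝔼 → 𝔼} (hf : Continuous f) {R : ℝ} (hR : 0 < R)
    (hid : ∀ x, R ≤ ‖x‖ → f x = x) : ∃ x, f x = 0 := by
  by_contra hne
  push Not at hne
  have hS : IsClosed {x : 𝔼 | R + 1 ≤ ‖x‖} := isClosed_le continuous_const continuous_norm
  have hUo : IsOpen {x : 𝔼 | R < ‖x‖} := isOpen_lt continuous_const continuous_norm
  -- An error smaller than `‖f x‖` keeps `g` nonvanishing, and `g` is still the identity beyond
  -- radius `R + 1`; its radial projection is then a smooth retraction.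
  obtain ⟨g, hg, hgf, hgS, -⟩ := hf.exists_contDiff_approx_and_eqOn 1 (ε := fun x => ‖f x‖)
    hf.norm (fun x => norm_pos_iff.2 (hne x)) hS
    (U := {x : 𝔼 | R < ‖x‖}) (hUo.mem_nhdsSet.2 fun x (hx : R + 1 ≤ ‖x‖) => by
      change R < ‖x‖; linarith)
    (contDiff_id.contDiffOn.congr fun x (hx : R < ‖x‖) => hid x hx.le)
  have hg0 : ∀ x, g x ≠ 0 := by
    intro x hx
    have := hgf x
    rw [hx, dist_zero_left] at this
    exact lt_irrefl _ this
  refine no_smooth_retraction (R := R + 1) (by linarith)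
    (r := fun x => ((R + 1) * ‖g x‖⁻¹) • g x) ?_ ?_ ?_
  · exact (contDiff_const.mul ((hg.norm ℝ hg0).inv fun x => norm_ne_zero_iff.2 (hg0 x))).smul hg
  · intro x
    have : ‖g x‖ ≠ 0 := norm_ne_zero_iff.2 (hg0 x)
    rw [norm_smul, norm_mul, norm_inv, norm_norm, Real.norm_of_nonneg (by linarith)]
    field_simp
  · intro x hx
    have h1 : g x = x := by
      rw [hgS (show x ∈ {x : 𝔼 | R + 1 ≤ ‖x‖} from hx.ge)]
      exact hid x (by linarith)
    have : R + 1 ≠ 0 := by linarith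
    simp only [h1, hx]
    rw [mul_inv_cancel₀ this, one_smul]

end NoRetraction

/-- Version of `exists_zero_of_eq_id_outside` on the sup norm cube. -/
theorem exists_zero_of_eq_id_on_sphere {m : ℕ} {f : (Fin m → ℝ) → (Fin m → ℝ)}
    (hf : Continuous f) (hid : ∀ b, ‖b‖ = 1 → f b = b) : ∃ b, ‖b‖ ≤ 1 ∧ f b = 0 := by
  let f' : (Fin m → ℝ) → (Fin m → ℝ) := fun b => if ‖b‖ ≤ 1 then f b else b
  have hf' : Continuous f' := by
    refine Continuous.if_le hf continuous_id continuous_norm continuous_const fun b hb => ?_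
    exact hid b hb
  let e := EuclideanSpace.equiv (Fin m) ℝ
  obtain ⟨C, hC0, hC⟩ : ∃ C : ℝ, 0 < C ∧ ∀ x, ‖x‖ ≤ C * ‖e x‖ := by
    refine ⟨‖(e.symm : (Fin m → ℝ) →L[ℝ] EuclideanSpace ℝ (Fin m))‖ + 1, by positivity,
      fun x => ?_⟩
    have := (e.symm : (Fin m → ℝ) →L[ℝ] EuclideanSpace ℝ (Fin m)).le_opNorm (e x)
    simp only [ContinuousLinearEquiv.coe_coe, ContinuousLinearEquiv.symm_apply_apply] at this
    nlinarith [norm_nonneg (e x)]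
  obtain ⟨x, hx⟩ := exists_zero_of_eq_id_outside (m := m) (f := fun x => e.symm (f' (e x)))
    (e.symm.continuous.comp (hf'.comp e.continuous)) (R := C + 1) (by linarith) (fun x hx => by
      have h1 : ¬ ‖e x‖ ≤ 1 := by
        intro h
        have := hC x
        nlinarith
      simp [f', h1])
  have hx' : f' (e x) = 0 := by simpa using hx
  refine ⟨e x, ?_, ?_⟩
  · by_contra h
    simp only [f', if_neg h] at hx'
    rw [hx', norm_zero] at h
    exact h zero_le_one
  · by_cases h : ‖e x‖ ≤ 1
    · simpa [f', if_pos h] using hx'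
    · simp only [f', if_neg h] at hx'
      rw [hx', norm_zero] at h
      exact absurd zero_le_one h

end

/-! ### Essential maps of the cube -/

section

open Set Topology

/-- A self-map of `ℝᵐ` is essential when it is connected to the identity through homotopies which
do not vanish on the unit sphere (of the sup norm). -/
inductive IsEssential {m : ℕ} : ((Fin m → ℝ) → (Fin m → ℝ)) → Prop
  | id : IsEssential fun b => b
  | step {e e' : (Fin m → ℝ) → (Fin m → ℝ)} (H : ℝ → (Fin m → ℝ) → (Fin m → ℝ)) :
      IsEssential e → Continuous (fun p : ℝ × (Fin m → ℝ) => H p.1 p.2) →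
      (∀ b, H 0 b = e b) → (∀ b, H 1 b = e' b) →
      (∀ t ∈ Icc (0 : ℝ) 1, ∀ b, ‖b‖ = 1 → H t b ≠ 0) → IsEssential e'

namespace IsEssential

variable {m : ℕ} {e e' : (Fin m → ℝ) → (Fin m → ℝ)}

theorem continuous (h : IsEssential e) : Continuous e := by
  cases h with
  | id => exact continuous_id
  | step H _ hc _ h1 _ =>
    have := hc.comp (Continuous.prodMk_right (1 : ℝ))
    exact this.congr h1

theorem ne_zero (h : IsEssential e) {b : Fin m → ℝ} (hb : ‖b‖ = 1) : e b ≠ 0 := by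
  cases h with
  | id =>
    intro h0
    change b = 0 at h0
    rw [h0, norm_zero] at hb
    exact zero_ne_one hb
  | step H _ _ _ h1 hne =>
    rw [← h1]
    exact hne 1 (by simp) b hb

/-- The property that every extension of the boundary values has a zero starts with the identity and
survives each homotopy, by a cutoff argument. Quantifying over all extensions `f` makes the
induction work. -/
theorem exists_zero_of_eqOn (h : IsEssential e) :
    ∀ f : (Fin m → ℝ) → (Fin m → ℝ), Continuous f → (∀ b, ‖b‖ = 1 → f b = e b) →
      ∃ b, ‖b‖ ≤ 1 ∧ f b = 0 := by
  induction h with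
  | id => exact fun f hf hid => exists_zero_of_eq_id_on_sphere hf hid
  | @step e e' H _ hc h0 h1 hne ih =>
    intro f hf hfe
    have hce' : Continuous e' := (hc.comp (Continuous.prodMk_right (1 : ℝ))).congr h1
    let K : ℝ × (Fin m → ℝ) → (Fin m → ℝ) := fun p => H p.1 p.2 + p.1 • (f p.2 - e' p.2)
    have hK : Continuous K := hc.add (continuous_fst.smul
      ((hf.comp continuous_snd).sub (hce'.comp continuous_snd)))
    let Z : Set (ℝ × (Fin m → ℝ)) :=
      (Icc (0 : ℝ) 1 ×ˢ Metric.closedBall 0 1) ∩ K ⁻¹' {0}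
    have hZ : IsCompact Z :=
      (isCompact_Icc.prod (isCompact_closedBall _ _)).inter_right (isClosed_singleton.preimage hK)
    have hB : IsClosed (Prod.snd '' Z) := (hZ.image continuous_snd).isClosed
    have hdisj : Disjoint (Metric.sphere (0 : Fin m → ℝ) 1) (Prod.snd '' Z) := by
      rw [disjoint_left]
      rintro _ hs ⟨⟨t, b⟩, ⟨⟨ht, -⟩, hz⟩, rfl⟩
      have hb : ‖b‖ = 1 := by simpa using hs
      apply hne t ht b hb
      have hz' : H t b + t • (f b - e' b) = 0 := hz
      rwa [hfe b hb, sub_self, smul_zero, add_zero] at hz'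
    -- With time `χ b`, the map `K` agrees with `e` on the sphere, while all its zeros in the ball
    -- occur at time `1`, where `K` is `f`.
    obtain ⟨χ, hχ0, hχ1, hχ⟩ :=
      exists_continuous_zero_one_of_isClosed Metric.isClosed_sphere hB hdisj
    obtain ⟨b, hb, hb0⟩ := ih (fun b => K (χ b, b)) (hK.comp (χ.continuous.prodMk continuous_id))
      (fun b hb => by
        have : χ b = 0 := hχ0 (by simpa using hb)
        simp [K, this, h0])
    have hbZ : b ∈ Prod.snd '' Z := ⟨(χ b, b), ⟨⟨hχ b, by simpa using hb⟩, hb0⟩, rfl⟩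
    have h1b : χ b = 1 := hχ1 hbZ
    refine ⟨b, hb, ?_⟩
    have : H 1 b + (1 : ℝ) • (f b - e' b) = 0 := by rw [← h1b]; exact hb0
    rwa [h1, one_smul, add_sub_cancel] at this

theorem exists_zero (h : IsEssential e) : ∃ b, ‖b‖ ≤ 1 ∧ e b = 0 :=
  h.exists_zero_of_eqOn e h.continuous fun _ _ => rfl

theorem sub_const (h : IsEssential e) {u : Fin m → ℝ} (hu : ∀ b, ‖b‖ = 1 → ‖u‖ < ‖e b‖) :
    IsEssential fun b => e b - u := by
  refine h.step (fun t b => e b - t • u) ?_ (by simp) (by simp) ?_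
  · exact (h.continuous.comp continuous_snd).sub (continuous_fst.smul continuous_const)
  · intro t ht b hb h0
    have h1 : e b = t • u := sub_eq_zero.1 h0
    have h2 := hu b hb
    rw [h1, norm_smul, Real.norm_of_nonneg ht.1] at h2
    have : t * ‖u‖ ≤ 1 * ‖u‖ := by gcongr; exact ht.2
    linarith

/-- An essential map covers a neighbourhood of the origin. -/
theorem exists_covers (h : IsEssential e) :
    ∃ ρ > 0, (∀ b, ‖b‖ = 1 → ρ ≤ ‖e b‖) ∧ ∀ u, ‖u‖ < ρ → ∃ b, ‖b‖ ≤ 1 ∧ e b = u := by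
  obtain ⟨ρ, hρ, hb⟩ : ∃ ρ > 0, ∀ b, ‖b‖ = 1 → ρ ≤ ‖e b‖ := by
    rcases (Metric.sphere (0 : Fin m → ℝ) 1).eq_empty_or_nonempty with h0 | hne
    · refine ⟨1, one_pos, fun b hb => ?_⟩
      have : b ∈ Metric.sphere (0 : Fin m → ℝ) 1 := by simpa using hb
      rw [h0] at this
      exact this.elim
    · obtain ⟨b, hb, hmin⟩ := (isCompact_sphere (0 : Fin m → ℝ) 1).exists_isMinOn hne
        h.continuous.norm.continuousOn
      exact ⟨‖e b‖, norm_pos_iff.2 (h.ne_zero (by simpa using hb)), fun c hc =>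
        hmin (by simpa using hc)⟩
  refine ⟨ρ, hρ, hb, fun u hu => ?_⟩
  obtain ⟨b, hb1, hb0⟩ := (h.sub_const fun b hb' => hu.trans_le (hb b hb')).exists_zero
  exact ⟨b, hb1, sub_eq_zero.1 hb0⟩

theorem of_segment (h : IsEssential e) (hc : Continuous e')
    (hne : ∀ t ∈ Icc (0 : ℝ) 1, ∀ b, ‖b‖ = 1 → (1 - t) • e b + t • e' b ≠ 0) :
    IsEssential e' := by
  refine h.step (fun t b => (1 - t) • e b + t • e' b) ?_ (by simp) (by simp) hne
  exact ((continuous_const.sub continuous_fst).smul (h.continuous.comp continuous_snd)).add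
    (continuous_fst.smul (hc.comp continuous_snd))

end IsEssential

/-- Two real numbers have the same sign. -/
def SameSign (x y : ℝ) : Prop := (0 < x ∧ 0 < y) ∨ (x < 0 ∧ y < 0) ∨ (x = 0 ∧ y = 0)

theorem SameSign.left_eq_zero {x y t : ℝ} (h : SameSign x y) (ht : t ∈ Icc (0 : ℝ) 1)
    (h0 : (1 - t) * x + t * y = 0) : x = 0 := by
  rcases h with ⟨h1, h2⟩ | ⟨h1, h2⟩ | ⟨h1, -⟩
  · exfalso
    rcases ht.1.eq_or_lt with h | h
    · subst h; simp at h0; linarith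
    · nlinarith [mul_pos h h2, mul_nonneg (sub_nonneg.2 ht.2) h1.le]
  · exfalso
    rcases ht.1.eq_or_lt with h | h
    · subst h; simp at h0; linarith
    · nlinarith [mul_pos h (neg_pos.2 h2), mul_nonneg (sub_nonneg.2 ht.2) (neg_pos.2 h1).le]
  · exact h1

theorem StrictMono.sameSign {f : ℝ → ℝ} (hf : StrictMono f) (x y : ℝ) :
    SameSign (x - y) (f x - f y) := by
  rcases lt_trichotomy x y with h | h | h
  · exact Or.inr (Or.inl ⟨sub_neg.2 h, sub_neg.2 (hf h)⟩)
  · exact Or.inr (Or.inr ⟨sub_eq_zero.2 h, by rw [h, sub_self]⟩)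
  · exact Or.inl ⟨sub_pos.2 h, sub_pos.2 (hf h)⟩

namespace IsEssential

variable {m : ℕ} {e e' : (Fin m → ℝ) → (Fin m → ℝ)}

/-- The straight homotopy can vanish only where every coordinate of `e` does. Increasing
homeomorphisms preserve signs of differences, so this lets a group element be applied to both sides
of `Φ b • w - v`. -/
theorem of_sameSign (h : IsEssential e) (hc : Continuous e')
    (hs : ∀ b, ‖b‖ = 1 → ∀ i, SameSign (e b i) (e' b i)) : IsEssential e' := by
  refine h.of_segment hc fun t ht b hb h0 => h.ne_zero hb (funext fun i => ?_)
  exact (hs b hb i).left_eq_zero ht (by simpa using congrFun h0 i)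

/-- Append a coordinate to a vector. -/
abbrev _root_.append (x : Fin m → ℝ) (y : ℝ) : Fin (m + 1) → ℝ :=
  Fin.snoc (α := fun _ => ℝ) x y

theorem _root_.append_eq_zero {x : Fin m → ℝ} {y : ℝ} : append x y = 0 ↔ x = 0 ∧ y = 0 := by
  constructor
  · intro h
    refine ⟨funext fun i => ?_, ?_⟩
    · simpa using congrFun h i.castSucc
    · simpa using congrFun h (Fin.last m)
  · rintro ⟨rfl, rfl⟩
    funext i
    refine Fin.lastCases ?_ (fun j => ?_) i <;> simp

theorem _root_.Continuous.append {X : Type*} [TopologicalSpace X] {f : X → Fin m → ℝ} {g : X → ℝ}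
    (hf : Continuous f) (hg : Continuous g) : Continuous fun x => append (f x) (g x) := by
  refine continuous_pi fun i => ?_
  refine Fin.lastCases ?_ (fun j => ?_) i
  · simpa using hg
  · simpa [Function.comp_def] using (continuous_apply j).comp hf

theorem _root_.continuous_init : Continuous fun b : Fin (m + 1) → ℝ => (Fin.init b : Fin m → ℝ) :=
  continuous_pi fun i => continuous_apply i.castSucc

theorem _root_.norm_init_le (b : Fin (m + 1) → ℝ) : ‖(Fin.init b : Fin m → ℝ)‖ ≤ ‖b‖ :=
  (pi_norm_le_iff_of_nonneg (norm_nonneg _)).2 fun i => norm_le_pi_norm b i.castSucc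

theorem _root_.norm_init_or_last {b : Fin (m + 1) → ℝ} (hb : ‖b‖ = 1) :
    ‖(Fin.init b : Fin m → ℝ)‖ = 1 ∨ b (Fin.last m) = 1 ∨ b (Fin.last m) = -1 := by
  by_contra! h
  have h1 : ‖(Fin.init b : Fin m → ℝ)‖ < 1 :=
    lt_of_le_of_ne (hb ▸ norm_init_le b) h.1
  have h2 : ‖b (Fin.last m)‖ < 1 := by
    refine lt_of_le_of_ne (hb ▸ norm_le_pi_norm b _) fun h3 => ?_
    rcases abs_eq (zero_le_one' ℝ) |>.1 h3 with h4 | h4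
    · exact h.2.1 h4
    · exact h.2.2 h4
  have : ‖b‖ < 1 := by
    refine (pi_norm_lt_iff one_pos).2 fun i => ?_
    refine Fin.lastCases h2 (fun j => ?_) i
    exact (norm_le_pi_norm (Fin.init b : Fin m → ℝ) j).trans_lt h1
  exact this.ne hb

theorem suspend (h : IsEssential e) :
    IsEssential fun b : Fin (m + 1) → ℝ => append (e (Fin.init b)) (b (Fin.last m)) := by
  induction h with
  | id =>
    have : (fun b : Fin (m + 1) → ℝ => append (Fin.init b) (b (Fin.last m))) = fun b => b := by
      funext b
      exact Fin.snoc_init_self b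
    rw [this]
    exact .id
  | step H _ hc h0 h1 hne ih =>
    refine ih.step (fun t b => _root_.append (H t (Fin.init b)) (b (Fin.last m))) ?_ ?_ ?_ ?_
    · exact (hc.comp (continuous_fst.prodMk (continuous_init.comp continuous_snd))).append
        ((continuous_apply (Fin.last m)).comp continuous_snd)
    · intro b; rw [h0]
    · intro b; rw [h1]
    · intro t ht b hb hz
      obtain ⟨hz1, hz2⟩ := append_eq_zero.1 hz
      rcases norm_init_or_last hb with h | h | h
      · exact hne t ht _ h hz1
      · rw [h] at hz2; exact one_ne_zero hz2
      · rw [h] at hz2; norm_num at hz2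

/-- If a family `E s` of maps, nonvanishing on the unit sphere, starts from an essential map, and
if `l` is negative at the zeros of the first and positive at the zeros of the last map, then
`(E, l)` is essential; `a` has the same signs as `E`. -/
theorem of_crossing (h : IsEssential e) {E a : ℝ → (Fin m → ℝ) → (Fin m → ℝ)}
    {l : ℝ → (Fin m → ℝ) → ℝ}
    (hE : Continuous fun p : ℝ × (Fin m → ℝ) => E p.1 p.2)
    (ha : Continuous fun p : ℝ × (Fin m → ℝ) => a p.1 p.2)
    (hl : Continuous fun p : ℝ × (Fin m → ℝ) => l p.1 p.2)
    (hE0 : ∀ b, E (-1) b = e b)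
    (hne : ∀ s ∈ Icc (-1 : ℝ) 1, ∀ b, ‖b‖ = 1 → E s b ≠ 0)
    (hs : ∀ s b i, SameSign (E s b i) (a s b i))
    (hneg : ∀ b, ‖b‖ ≤ 1 → E (-1) b = 0 → l (-1) b < 0)
    (hpos : ∀ b, ‖b‖ ≤ 1 → E 1 b = 0 → 0 < l 1 b) :
    IsEssential fun b : Fin (m + 1) → ℝ =>
      append (a (b (Fin.last m)) (Fin.init b)) (l (b (Fin.last m)) (Fin.init b)) := by
  have hlast : ∀ b : Fin (m + 1) → ℝ, ‖b‖ = 1 → b (Fin.last m) ∈ Icc (-1 : ℝ) 1 := fun b hb => by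
    have := norm_le_pi_norm b (Fin.last m)
    rw [hb, Real.norm_eq_abs, abs_le] at this
    exact this
  have hpair : Continuous fun b : Fin (m + 1) → ℝ => (b (Fin.last m), (Fin.init b : Fin m → ℝ)) :=
    (continuous_apply _).prodMk continuous_init
  -- Slide the parameter of `E` from `-1` to the last coordinate. On the side faces `E` does not
  -- vanish; on the other two the last coordinate is `±1`.
  have h1 : IsEssential fun b : Fin (m + 1) → ℝ =>
      append (E (b (Fin.last m)) (Fin.init b)) (b (Fin.last m)) := by
    refine h.suspend.step (fun t b => _root_.append (E (-1 + t * (b (Fin.last m) + 1)) (Fin.init b))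
      (b (Fin.last m))) ?_ ?_ ?_ ?_
    · refine Continuous.append (hE.comp (Continuous.prodMk ?_ ?_)) ?_
      · exact continuous_const.add (continuous_fst.mul
          (((continuous_apply (Fin.last m)).comp continuous_snd).add continuous_const))
      · exact continuous_init.comp continuous_snd
      · exact (continuous_apply (Fin.last m)).comp continuous_snd
    · intro b; simp [hE0]
    · intro b; simp
    · intro t ht b hb hz
      obtain ⟨hz1, hz2⟩ := append_eq_zero.1 hz
      rcases norm_init_or_last hb with h | h | h
      · refine hne _ ?_ _ h hz1
        obtain ⟨h2, h3⟩ := hlast b hb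
        constructor
        · nlinarith [mul_nonneg ht.1 (by linarith : 0 ≤ b (Fin.last m) + 1)]
        · nlinarith [ht.1, ht.2]
      · rw [h] at hz2; exact one_ne_zero hz2
      · rw [h] at hz2; norm_num at hz2
  -- Now replace the last coordinate by `l`. Only zeros of `E` on the top and bottom matter, and
  -- there `l` has the sign of the last coordinate.
  have h2 : IsEssential fun b : Fin (m + 1) → ℝ =>
      append (E (b (Fin.last m)) (Fin.init b)) (l (b (Fin.last m)) (Fin.init b)) := by
    refine h1.of_segment ((hE.comp hpair).append (hl.comp hpair)) ?_
    intro t ht b hb hz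
    have hz1 : ∀ i, (1 - t) * E (b (Fin.last m)) (Fin.init b) i +
        t * E (b (Fin.last m)) (Fin.init b) i = 0 := fun i => by
      simpa using congrFun hz i.castSucc
    have hz2 : (1 - t) * b (Fin.last m) + t * l (b (Fin.last m)) (Fin.init b) = 0 := by
      simpa using congrFun hz (Fin.last m)
    have hz3 : E (b (Fin.last m)) (Fin.init b) = 0 := funext fun i => by
      have := hz1 i
      rw [← add_mul, sub_add_cancel, one_mul] at this
      exact this
    have hi : ‖(Fin.init b : Fin m → ℝ)‖ ≤ 1 := hb ▸ norm_init_le b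
    rcases norm_init_or_last hb with h | h | h
    · exact hne _ (hlast b hb) _ h hz3
    · rw [h] at hz3 hz2
      have := hpos _ hi hz3
      exact one_ne_zero (SameSign.left_eq_zero (Or.inl ⟨one_pos, this⟩) ht hz2)
    · rw [h] at hz3 hz2
      have := hneg _ hi hz3
      have := SameSign.left_eq_zero (Or.inr (Or.inl ⟨by norm_num, this⟩)) ht hz2
      norm_num at this
  refine h2.of_sameSign ((ha.comp hpair).append (hl.comp hpair)) fun b _ i => ?_
  refine Fin.lastCases ?_ (fun j => ?_) i
  · simp only [Fin.snoc_last]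
    rcases lt_trichotomy (l (b (Fin.last m)) (Fin.init b)) 0 with h | h | h
    · exact Or.inr (Or.inl ⟨h, h⟩)
    · exact Or.inr (Or.inr ⟨h, h⟩)
    · exact Or.inl ⟨h, h⟩
  · simpa only [Fin.snoc_castSucc] using hs _ _ j

end IsEssential

end

/-! ### Essential orbit maps and transitivity of stabilizers -/

section

open Set Topology MulAction

section SmallGeneration

variable {Γ : Type*} [Group Γ] [TopologicalSpace Γ] [IsTopologicalGroup Γ]

/-- A path-connected topological group is generated by the elements joined to `1` inside any given
neighbourhood of `1`. -/
theorem mem_closure_joinedIn [PathConnectedSpace Γ] {O : Set Γ} (hO : O ∈ 𝓝 (1 : Γ)) (g : Γ) :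
    g ∈ Subgroup.closure {κ : Γ | JoinedIn O 1 κ} := by
  obtain ⟨γ⟩ : Joined (1 : Γ) g := PathConnectedSpace.joined 1 g
  have hγ : Continuous γ.extend := γ.continuous_extend
  have key : ∀ s : ℝ, ∃ ε > 0, ∀ t, |t - s| < ε → JoinedIn O 1 ((γ.extend s)⁻¹ * γ.extend t) := by
    intro s
    have hc : ContinuousAt (fun t => (γ.extend s)⁻¹ * γ.extend t) s :=
      (continuous_const.mul hγ).continuousAt
    have : (fun t => (γ.extend s)⁻¹ * γ.extend t) ⁻¹' O ∈ 𝓝 s :=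
      hc.preimage_mem_nhds (by simpa using hO)
    obtain ⟨ε, hε, hb⟩ := Metric.mem_nhds_iff.1 this
    refine ⟨ε, hε, fun t ht => ?_⟩
    have hst : JoinedIn (Metric.ball s ε) s t :=
      ((convex_ball s ε).isPathConnected ⟨s, Metric.mem_ball_self hε⟩).joinedIn s
        (Metric.mem_ball_self hε) t ht
    have := hst.map (f := fun t => (γ.extend s)⁻¹ * γ.extend t) (continuous_const.mul hγ)
    rw [inv_mul_cancel] at this
    exact this.mono (image_subset_iff.2 hb)
  have := isPreconnected_univ.induction₂ (s := (univ : Set ℝ))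
    (fun s t => γ.extend s ∈ Subgroup.closure {κ : Γ | JoinedIn O 1 κ} ↔
      γ.extend t ∈ Subgroup.closure {κ : Γ | JoinedIn O 1 κ}) (fun s _ => ?_)
    (fun _ _ _ _ _ _ h h' => h.trans h') (fun _ _ _ _ h => h.symm) (mem_univ 0) (mem_univ 1)
  · simp only [γ.extend_zero, γ.extend_one] at this
    exact this.1 (one_mem _)
  · obtain ⟨ε, hε, h⟩ := key s
    rw [nhdsWithin_univ]
    filter_upwards [Metric.ball_mem_nhds s hε] with t ht
    have h1 : (γ.extend s)⁻¹ * γ.extend t ∈ Subgroup.closure {κ : Γ | JoinedIn O 1 κ} :=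
      Subgroup.subset_closure (h t ht)
    constructor
    · intro hs
      simpa using mul_mem hs h1
    · intro hs
      simpa using mul_mem hs (inv_mem h1)

/-- Paths to the generators are concatenated after right translation by elements of `D`, which keeps
them in `P`; the paths themselves may leave `D`. -/
theorem joinedIn_of_mem_closure {D : Subgroup Γ} {O P : Set Γ} (hO1 : (1 : Γ) ∈ P) (hOP : O ⊆ P)
    (hP : ∀ g ∈ P, ∀ d ∈ D, g * d ∈ P) {d : Γ}
    (hd : d ∈ Subgroup.closure {κ | κ ∈ D ∧ JoinedIn O 1 κ}) : JoinedIn P 1 d := by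
  have hD : Subgroup.closure {κ | κ ∈ D ∧ JoinedIn O 1 κ} ≤ D :=
    (Subgroup.closure_le _).2 fun κ h => h.1
  have hmul : ∀ {x y d : Γ}, d ∈ D → JoinedIn P x y → JoinedIn P (x * d) (y * d) := by
    intro x y d hd h
    refine (h.map (f := fun g => g * d) (by fun_prop)).mono ?_
    rintro _ ⟨g, hg, rfl⟩
    exact hP g hg d hd
  induction hd using Subgroup.closure_induction with
  | mem x hx => exact hx.2.mono hOP
  | one => exact JoinedIn.refl hO1
  | mul x y hx hy ihx ihy =>
    have := hmul (hD hy) ihx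
    rw [one_mul] at this
    exact ihy.trans this
  | inv x hx ih =>
    have := hmul (inv_mem (hD hx)) ih
    rw [one_mul, mul_inv_cancel] at this
    exact this.symm

end SmallGeneration

section Stabilizers

variable {Γ : Type*} [Group Γ] [MulAction Γ ℝ] {m : ℕ}

theorem append_smul (g : Γ) (w : Fin m → ℝ) (z : ℝ) :
    g • append w z = append (g • w) (g • z) := by
  funext i
  refine Fin.lastCases ?_ (fun j => ?_) i <;> simp

theorem append_injective {w w' : Fin m → ℝ} {z z' : ℝ} (h : append w z = append w' z') :
    w = w' ∧ z = z' := by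
  refine ⟨funext fun i => ?_, ?_⟩
  · simpa using congrFun h i.castSucc
  · simpa using congrFun h (Fin.last m)

theorem mem_stabilizer_append {g : Γ} {w : Fin m → ℝ} {z : ℝ} :
    g ∈ stabilizer Γ (append w z) ↔ g ∈ stabilizer Γ w ∧ g • z = z := by
  rw [mem_stabilizer_iff, append_smul, mem_stabilizer_iff]
  exact ⟨append_injective, fun h => by rw [h.1, h.2]⟩

theorem strictMono_append {w : Fin m → ℝ} {z : ℝ} :
    StrictMono (append w z) ↔ StrictMono w ∧ ∀ i, w i < z := by
  constructor
  · intro h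
    refine ⟨fun i j hij => ?_, fun i => ?_⟩
    · simpa using h (Fin.castSucc_lt_castSucc_iff.2 hij)
    · simpa using h (Fin.castSucc_lt_last i)
  · rintro ⟨h1, h2⟩ i j
    refine Fin.lastCases ?_ (fun j => ?_) j <;> refine Fin.lastCases ?_ (fun i => ?_) i
    · intro h; exact absurd h (lt_irrefl _)
    · intro _; simpa using h2 i
    · intro h; exact absurd h (not_lt.2 (Fin.le_last _))
    · intro h; simpa using h1 (Fin.castSucc_lt_castSucc_iff.1 h)

theorem lt_of_mem_stabilizer (hmono : ∀ g : Γ, StrictMono fun t : ℝ => g • t) {w : Fin m → ℝ}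
    {d : Γ} (hd : d ∈ stabilizer Γ w) {z : ℝ} (hz : ∀ i, w i < z) (i : Fin m) : w i < d • z := by
  have h1 : d • w i = w i := congrFun hd i
  rw [← h1]
  exact hmono d (hz i)

/-- If a stabilizer has no fixed point to the right of the tuple, its orbits there are unbounded. -/
theorem exists_stabilizer_smul_gt (hmono : ∀ g : Γ, StrictMono fun t : ℝ => g • t)
    {w : Fin m → ℝ} (hN : ∀ z, (∀ i, w i < z) → ∃ d ∈ stabilizer Γ w, d • z ≠ z)
    {z : ℝ} (hz : ∀ i, w i < z) (c : ℝ) : ∃ d ∈ stabilizer Γ w, c < d • z := by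
  by_contra! hc
  -- The supremum of a bounded orbit is a fixed point of the stabilizer.
  let S : Set ℝ := {x | ∃ d ∈ stabilizer Γ w, d • z = x}
  have hS : BddAbove S := ⟨c, by rintro _ ⟨d, hd, rfl⟩; exact hc d hd⟩
  have hzS : z ∈ S := ⟨1, one_mem _, one_smul _ _⟩
  have hlt : ∀ d ∈ stabilizer Γ w, sSup S ≤ d • sSup S := by
    intro d hd
    refine csSup_le ⟨z, hzS⟩ ?_
    rintro _ ⟨d', hd', rfl⟩
    have h1 : (d⁻¹ * d') • z ≤ sSup S := le_csSup hS ⟨_, mul_mem (inv_mem hd) hd', rfl⟩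
    have := (hmono d).monotone h1
    simpa [mul_smul] using this
  obtain ⟨d, hd, hne⟩ := hN (sSup S) fun i => (hz i).trans_le (le_csSup hS hzS)
  apply hne
  refine le_antisymm ?_ (hlt d hd)
  have := (hmono d).monotone (hlt d⁻¹ (inv_mem hd))
  simpa using this

end Stabilizers

section Tuples

variable {Γ : Type*} [Group Γ] [TopologicalSpace Γ] [IsTopologicalGroup Γ]
  [MulAction Γ ℝ] [ContinuousSMul Γ ℝ] {m : ℕ}

theorem exists_nonempty_interior_of_finset {X ι : Type*} [TopologicalSpace X] (s : Finset ι)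
    {f : ι → Set X} (hc : ∀ i ∈ s, IsClosed (f i)) (hne : (interior (⋃ i ∈ s, f i)).Nonempty) :
    ∃ i ∈ s, (interior (f i)).Nonempty := by
  classical
  induction s using Finset.induction_on with
  | empty => simp at hne
  | insert a s ha ih =>
    by_cases h : (interior (f a)).Nonempty
    · exact ⟨a, by simp, h⟩
    rw [Finset.set_biUnion_insert, union_comm, interior_union_isClosed_of_interior_empty _
      (not_nonempty_iff_eq_empty.1 h)] at hne
    · obtain ⟨i, hi, h'⟩ := ih (fun i hi => hc i (by simp [hi])) hne
      exact ⟨i, by simp [hi], h'⟩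
    · exact s.finite_toSet.isClosed_biUnion fun i hi => hc i (by simp [Finset.mem_coe.1 hi])

/-- If the orbit map of `w` is essential along a family of group elements, then points near `w` are
reached from `w` by elements joined to `1` in a small neighbourhood. -/
theorem exists_nhds_joinedIn {w : Fin m → ℝ} {Φ : (Fin m → ℝ) → Γ} (hΦ : Continuous Φ)
    (he : IsEssential fun b => Φ b • w - w) {O : Set Γ} (hO : O ∈ 𝓝 (1 : Γ)) :
    ∀ᶠ v in 𝓝 w, ∃ κ : Γ, JoinedIn O 1 κ ∧ κ • w = v := by
  obtain ⟨ρ, hρ, -, hcov⟩ := he.exists_covers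
  -- On small parameter balls the quotients of values of `Φ` stay in `O`. Finitely many such balls
  -- cover, so the orbit image of one of them has interior, a finite form of the Baire argument;
  -- that image is then translated back to `w`.
  have hr : ∀ b : Fin m → ℝ, ∃ r > 0, ∀ b₁ ∈ Metric.closedBall b r, ∀ b₂ ∈ Metric.closedBall b r,
      (Φ b₁)⁻¹ * Φ b₂ ∈ O := by
    intro b
    have hc : Continuous fun p : (Fin m → ℝ) × (Fin m → ℝ) => (Φ p.1)⁻¹ * Φ p.2 := by fun_prop
    have : (fun p : (Fin m → ℝ) × (Fin m → ℝ) => (Φ p.1)⁻¹ * Φ p.2) ⁻¹' O ∈ 𝓝 (b, b) :=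
      hc.continuousAt.preimage_mem_nhds (by simpa using hO)
    obtain ⟨r, hr, hb⟩ := Metric.nhds_basis_closedBall.mem_iff.1 this
    refine ⟨r, hr, fun b₁ h₁ b₂ h₂ => hb (a := (b₁, b₂)) ?_⟩
    rw [← closedBall_prod_same]
    exact ⟨h₁, h₂⟩
  choose r hr0 hr using hr
  obtain ⟨t, -, ht⟩ := (isCompact_closedBall (0 : Fin m → ℝ) 1).elim_nhds_subcover
    (fun b => Metric.closedBall b (r b)) fun b _ => Metric.closedBall_mem_nhds b (hr0 b)
  have hΦw : Continuous fun b => Φ b • w := hΦ.smul continuous_const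
  obtain ⟨b, -, v, hv⟩ := exists_nonempty_interior_of_finset t
    (f := fun b => (fun b => Φ b • w) '' Metric.closedBall b (r b))
    (fun b _ => ((isCompact_closedBall b (r b)).image hΦw).isClosed) ⟨w, by
      rw [mem_interior_iff_mem_nhds]
      filter_upwards [Metric.ball_mem_nhds w hρ] with v hv
      obtain ⟨b, hb, hbv⟩ := hcov (v - w) (by simpa [dist_eq_norm] using hv)
      have hb' := ht (show b ∈ Metric.closedBall 0 1 by simpa using hb)
      simp only [mem_iUnion] at hb' ⊢
      obtain ⟨i, hi, hbi⟩ := hb'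
      exact ⟨i, hi, b, hbi, sub_left_injective hbv⟩⟩
  obtain ⟨b', hb', rfl⟩ := interior_subset hv
  have hnh := mem_interior_iff_mem_nhds.1 hv
  have h1 : (fun v => Φ b' • v) ⁻¹' ((fun b => Φ b • w) '' Metric.closedBall b (r b)) ∈ 𝓝 w :=
    (continuous_const_smul (Φ b')).continuousAt.preimage_mem_nhds hnh
  filter_upwards [h1] with v hv
  obtain ⟨b₂, hb₂, hv⟩ := hv
  refine ⟨(Φ b')⁻¹ * Φ b₂, ?_, ?_⟩
  · have hj : JoinedIn (Metric.closedBall b (r b)) b' b₂ :=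
      ((convex_closedBall b (r b)).isPathConnected ⟨b', hb'⟩).joinedIn b' hb' b₂ hb₂
    have := hj.map (f := fun c => (Φ b')⁻¹ * Φ c) (by fun_prop)
    rw [inv_mul_cancel] at this
    exact this.mono (image_subset_iff.2 fun c hc => hr b b' hb' c hc)
  · rw [mul_smul, inv_smul_eq_iff]
    exact hv

/-- Raising the length of an essential tuple: the crossing construction. -/
theorem exists_essential_append (hmono : ∀ g : Γ, StrictMono fun t : ℝ => g • t)
    {w : Fin m → ℝ} {Φ : (Fin m → ℝ) → Γ} (hΦ : Continuous Φ)
    (he : IsEssential fun b => Φ b • w - w)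
    (hC : ∀ O ∈ 𝓝 (1 : Γ),
      stabilizer Γ w ≤ Subgroup.closure {κ | κ ∈ stabilizer Γ w ∧ JoinedIn O 1 κ})
    (hN : ∀ z, (∀ i, w i < z) → ∃ d ∈ stabilizer Γ w, d • z ≠ z)
    {z : ℝ} (hz : ∀ i, w i < z) :
    ∃ (ζ : ℝ) (Ψ : (Fin (m + 1) → ℝ) → Γ), (∀ i, w i < ζ) ∧ Continuous Ψ ∧
      IsEssential fun b => Ψ b • append w z - append w ζ := by
  obtain ⟨ρ, hρ, hsph, -⟩ := he.exists_covers
  have hΦw : Continuous fun b => Φ b • w := hΦ.smul continuous_const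
  have hΦz : Continuous fun b => Φ b • z := hΦ.smul continuous_const
  -- At the zeros of the given essential map, `Φ b` stabilizes `w`. The target `ζ` will be one above
  -- the largest value of `Φ b • z` there.
  let Δ : Set (Fin m → ℝ) := Metric.closedBall 0 1 ∩ {b | Φ b • w = w}
  have hΔ : IsCompact Δ :=
    (isCompact_closedBall _ _).inter_right (isClosed_eq hΦw continuous_const)
  have hne : Δ.Nonempty := by
    obtain ⟨b, hb, h0⟩ := he.exists_zero
    exact ⟨b, by simpa using hb, sub_eq_zero.1 h0⟩
  obtain ⟨b₀, hb₀, hmin⟩ := hΔ.exists_isMinOn hne hΦz.continuousOn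
  obtain ⟨b₁, hb₁, hmax⟩ := hΔ.exists_isMaxOn hne hΦz.continuousOn
  have hmem : ∀ b ∈ Δ, Φ b ∈ stabilizer Γ w := fun b hb => hb.2
  -- A stabilizer element carrying even the smallest value of `Φ b • z` on `Δ` past `ζ`: this makes
  -- the last coordinate change sign.
  obtain ⟨d, hd, hdμ⟩ := exists_stabilizer_smul_gt hmono hN
    (lt_of_mem_stabilizer hmono (hmem b₀ hb₀) hz) (Φ b₁ • z + 1)
  -- The path to `d⁻¹` leaves the stabilizer but moves `w` by less than `ρ`, the minimum of `‖Φ b •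
  -- w - w‖` on the sphere, so no zero appears on the boundary.
  have hP : JoinedIn {g : Γ | g • w ∈ Metric.ball w ρ} 1 d⁻¹ := by
    have hPn : {g : Γ | g • w ∈ Metric.ball w ρ} ∈ 𝓝 (1 : Γ) := by
      have hc : Continuous fun g : Γ => g • w := continuous_id.smul continuous_const
      exact hc.continuousAt.preimage_mem_nhds (by
        simpa using Metric.ball_mem_nhds w hρ)
    refine joinedIn_of_mem_closure (D := stabilizer Γ w) (mem_of_mem_nhds hPn) subset_rfl ?_
      (hC _ hPn (inv_mem hd))
    intro g hg k hk
    have hk' : k • w = w := hk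
    rw [mem_ofPred_eq, mul_smul, hk']
    exact hg
  obtain ⟨γ, hγ⟩ := hP
  let δ : ℝ → Γ := fun s => γ.extend ((s + 1) / 2)
  have hδ : Continuous δ := γ.continuous_extend.comp (by fun_prop)
  have hδ0 : δ (-1) = 1 := by simp [δ]
  have hδ1 : δ 1 = d⁻¹ := by simp [δ]
  have hδV : ∀ s, ‖δ s • w - w‖ < ρ := by
    intro s
    have : δ s ∈ range γ := by
      rw [← γ.extend_range]
      exact mem_range_self _
    obtain ⟨u, hu⟩ := this
    have := hγ u
    rw [hu] at this
    simpa [dist_eq_norm] using this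
  refine ⟨Φ b₁ • z + 1, fun b => (δ (b (Fin.last m)))⁻¹ * Φ (Fin.init b), ?_, ?_, ?_⟩
  · intro i
    have := lt_of_mem_stabilizer hmono (hmem b₁ hb₁) hz i
    linarith
  · have : Continuous fun b : Fin (m + 1) → ℝ => Φ (Fin.init b) := hΦ.comp continuous_init
    have h2 : Continuous fun b : Fin (m + 1) → ℝ => δ (b (Fin.last m)) :=
      hδ.comp (continuous_apply _)
    exact h2.inv.mul this
  have h1 : Continuous fun p : ℝ × (Fin m → ℝ) => Φ p.2 := hΦ.comp continuous_snd
  have h2 : Continuous fun p : ℝ × (Fin m → ℝ) => δ p.1 := hδ.comp continuous_fst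
  have := he.of_crossing (E := fun s b => Φ b • w - δ s • w)
    (a := fun s b => (δ s)⁻¹ • Φ b • w - w) (l := fun s b => (δ s)⁻¹ • Φ b • z - (Φ b₁ • z + 1))
    ((h1.smul continuous_const).sub (h2.smul continuous_const))
    ((h2.inv.smul (h1.smul continuous_const)).sub continuous_const)
    ((h2.inv.smul (h1.smul continuous_const)).sub continuous_const)
    (fun b => by simp [hδ0]) ?_ ?_ ?_ ?_
  · convert this using 2 with b
    rw [append_smul]
    funext i
    refine Fin.lastCases ?_ (fun j => ?_) i <;> simp [mul_smul]
  · intro s _ b hb h0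
    have h3 : Φ b • w = δ s • w := sub_eq_zero.1 h0
    have h4 := hsph b hb
    rw [h3] at h4
    exact (hδV s).not_ge h4
  · intro s b i
    have := (hmono (δ s)⁻¹).sameSign (Φ b • w i) (δ s • w i)
    simpa using this
  · intro b hb h0
    have hb' : b ∈ Δ := ⟨by simpa using hb, by simpa [hδ0, sub_eq_zero] using h0⟩
    have : Φ b • z ≤ Φ b₁ • z := hmax hb'
    simp only [hδ0, inv_one, one_smul]
    linarith
  · intro b hb h0
    have hdw : d⁻¹ • w = w := inv_mem hd
    have hb' : b ∈ Δ := ⟨by simpa using hb, by simpa [hδ1, sub_eq_zero, hdw] using h0⟩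
    have h5 : Φ b₀ • z ≤ Φ b • z := hmin hb'
    have h6 := (hmono d).monotone h5
    simp only [hδ1, inv_inv] at h6 ⊢
    linarith

/-- The stabilizer of a tuple is transitive to its right. -/
theorem exists_stabilizer_smul_eq (hmono : ∀ g : Γ, StrictMono fun t : ℝ => g • t)
    {w : Fin m → ℝ} {Φ : (Fin m → ℝ) → Γ} (hΦ : Continuous Φ)
    (he : IsEssential fun b => Φ b • w - w)
    (hC : ∀ O ∈ 𝓝 (1 : Γ),
      stabilizer Γ w ≤ Subgroup.closure {κ | κ ∈ stabilizer Γ w ∧ JoinedIn O 1 κ})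
    (hN : ∀ z, (∀ i, w i < z) → ∃ d ∈ stabilizer Γ w, d • z ≠ z)
    {z z' : ℝ} (hz : ∀ i, w i < z) (hz' : ∀ i, w i < z') : ∃ d ∈ stabilizer Γ w, d • z = z' := by
  have hopen : ∀ z, (∀ i, w i < z) → ∀ᶠ x in 𝓝 z, ∃ d ∈ stabilizer Γ w, d • z = x := by
    intro z hz
    obtain ⟨ζ, Ψ, hζ, hΨ, hess⟩ := exists_essential_append hmono hΦ he hC hN hz
    obtain ⟨ρ, hρ, -, hcov⟩ := hess.exists_covers
    have hnear : ∀ x, |x - ζ| < ρ → ∃ d ∈ stabilizer Γ w, d • z = x := by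
      intro x hx
      -- Covering a vector whose first `m` coordinates vanish produces an element that fixes `w` and
      -- sends `z` to `x`.
      obtain ⟨b, -, hb⟩ := hcov (append 0 (x - ζ)) (by
        refine (pi_norm_lt_iff hρ).2 fun i => ?_
        refine Fin.lastCases ?_ (fun j => ?_) i
        · simpa using hx
        · simpa using hρ)
      have h1 : Ψ b • append w z = append w x := by
        rw [sub_eq_iff_eq_add] at hb
        rw [hb]
        funext i
        refine Fin.lastCases ?_ (fun j => ?_) i <;> simp
      rw [append_smul] at h1
      exact ⟨Ψ b, append_injective h1⟩
    obtain ⟨k, hk, hkz⟩ := hnear ζ (by simpa using hρ)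
    have hc : ContinuousAt (fun x => k • x) z := (continuous_const_smul k).continuousAt
    have : (fun x => k • x) ⁻¹' Metric.ball ζ ρ ∈ 𝓝 z :=
      hc.preimage_mem_nhds (by rw [hkz]; exact Metric.ball_mem_nhds ζ hρ)
    filter_upwards [this] with x hx
    obtain ⟨d, hd, hdx⟩ := hnear _ hx
    exact ⟨k⁻¹ * d, mul_mem (inv_mem hk) hd, by rw [mul_smul, hdx, inv_smul_smul]⟩
  have hconn : IsPreconnected {x : ℝ | ∀ i, w i < x} :=
    OrdConnected.isPreconnected ⟨fun x hx y _ u hu i => (hx i).trans_le hu.1⟩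
  refine hconn.induction₂ (fun x y => ∃ d ∈ stabilizer Γ w, d • x = y) (fun x hx => ?_) ?_ ?_ hz hz'
  · exact nhdsWithin_le_nhds (hopen x hx)
  · rintro x y u - - - ⟨d, hd, rfl⟩ ⟨d', hd', rfl⟩
    exact ⟨d' * d, mul_mem hd' hd, mul_smul _ _ _⟩
  · rintro x y - - ⟨d, hd, rfl⟩
    exact ⟨d⁻¹, inv_mem hd, inv_smul_smul _ _⟩

end Tuples

end

/-! ### Monodromy, small generation of stabilizers, and the induction on length -/

section

open Set Topology MulAction

section Sections

variable {Γ : Type*} [Group Γ] [TopologicalSpace Γ] [MulAction Γ ℝ]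

/-- A section over `K` of the orbit map `gD₀ ↦ g • z` which is locally given by small elements of the
subgroup `D`. -/
def IsGoodSection (D D₀ : Subgroup Γ) (z : ℝ) (K : Set ℝ) (s : ℝ → Γ ⧸ D₀) : Prop :=
  ∀ x ∈ K, ∃ b ∈ D, b • z = x ∧ ∃ O ∈ 𝓝 (1 : Γ), ∀ η ∈ D, JoinedIn O 1 η →
    (b * η) • z ∈ K → s ((b * η) • z) = (b * η : Γ)

namespace IsGoodSection

variable {D D₀ : Subgroup Γ} {z : ℝ} {K K' : Set ℝ} {s s' : ℝ → Γ ⧸ D₀}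

theorem congr (h : IsGoodSection D D₀ z K s) (hs : EqOn s s' K) : IsGoodSection D D₀ z K s' := by
  intro x hx
  obtain ⟨b, hb, hbx, O, hO, h⟩ := h x hx
  exact ⟨b, hb, hbx, O, hO, fun η hη hj hK => (hs hK).symm.trans (h η hη hj hK)⟩

variable [IsTopologicalGroup Γ] [ContinuousSMul Γ ℝ]

/-- On an open domain the neighbourhood `O` can be shrunk until the requirement that the moved point
stay in the domain is automatic. -/
theorem union (hK : IsOpen K) (hK' : IsOpen K') (h : IsGoodSection D D₀ z K s)
    (h' : IsGoodSection D D₀ z K' s) : IsGoodSection D D₀ z (K ∪ K') s := by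
  have key : ∀ {A : Set ℝ}, IsOpen A → IsGoodSection D D₀ z A s → ∀ x ∈ A,
      ∃ b ∈ D, b • z = x ∧ ∃ O ∈ 𝓝 (1 : Γ), ∀ η ∈ D, JoinedIn O 1 η →
        s ((b * η) • z) = (b * η : Γ) := by
    intro A hA h x hx
    obtain ⟨b, hb, hbx, O, hO, h⟩ := h x hx
    have hc : Continuous fun η : Γ => (b * η) • z :=
      (continuous_const.mul continuous_id).smul continuous_const
    have hn : (fun η : Γ => (b * η) • z) ⁻¹' A ∈ 𝓝 (1 : Γ) :=
      hc.continuousAt.preimage_mem_nhds (by simpa [hbx] using hA.mem_nhds hx)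
    exact ⟨b, hb, hbx, O ∩ _, Filter.inter_mem hO hn, fun η hη hj =>
      h η hη (hj.mono inter_subset_left) hj.target_mem.2⟩
  rintro x (hx | hx)
  · obtain ⟨b, hb, hbx, O, hO, h⟩ := key hK h x hx
    exact ⟨b, hb, hbx, O, hO, fun η hη hj _ => h η hη hj⟩
  · obtain ⟨b, hb, hbx, O, hO, h⟩ := key hK' h' x hx
    exact ⟨b, hb, hbx, O, hO, fun η hη hj _ => h η hη hj⟩

/-- Two good sections which agree at one point agree on the connected intersection of their
domains. -/
theorem eqOn (hloc : ∀ O ∈ 𝓝 (1 : Γ), ∀ᶠ x in 𝓝 z, ∃ κ ∈ D, JoinedIn O 1 κ ∧ κ • z = x)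
    (h : IsGoodSection D D₀ z K s) (h' : IsGoodSection D D₀ z K' s')
    (hKK : IsPreconnected (K ∩ K')) {x₀ : ℝ} (hx₀ : x₀ ∈ K ∩ K') (h0 : s x₀ = s' x₀) :
    EqOn s s' (K ∩ K') := by
  have key : ∀ x ∈ K ∩ K', ∀ᶠ y in 𝓝[K ∩ K'] x, (s x = s' x ↔ s y = s' y) := by
    rintro x ⟨hxK, hxK'⟩
    obtain ⟨b, hb, hbx, O, hO, h⟩ := h x hxK
    obtain ⟨b', hb', hbx', O', hO', h'⟩ := h' x hxK'
    -- The two base lifts differ by `n = b⁻¹ * b'`, which fixes `z`. At all nearby points the two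
    -- sections agree exactly when `n ∈ D₀`, so agreement is locally constant.
    have hnz : (b⁻¹ * b') • z = z := by rw [mul_smul, hbx', ← hbx, inv_smul_smul]
    have hc : Continuous fun η : Γ => (b⁻¹ * b')⁻¹ * η * (b⁻¹ * b') := by fun_prop
    have hn : (fun η : Γ => (b⁻¹ * b')⁻¹ * η * (b⁻¹ * b')) ⁻¹' O' ∈ 𝓝 (1 : Γ) :=
      hc.continuousAt.preimage_mem_nhds (by simpa using hO')
    have main : ∀ η ∈ D, JoinedIn (O ∩ (fun η : Γ => (b⁻¹ * b')⁻¹ * η * (b⁻¹ * b')) ⁻¹' O') 1 η →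
        (b * η) • z ∈ K ∩ K' → (s ((b * η) • z) = s' ((b * η) • z) ↔ b⁻¹ * b' ∈ D₀) := by
      intro η hη hj hK
      have e1 := h η hη (hj.mono inter_subset_left) hK.1
      have hj' := (hj.map (f := fun η : Γ => (b⁻¹ * b')⁻¹ * η * (b⁻¹ * b')) hc).mono (by
        rintro _ ⟨u, hu, rfl⟩
        exact hu.2 : _ ⊆ O')
      rw [mul_one, inv_mul_cancel] at hj'
      have e3 : b' * ((b⁻¹ * b')⁻¹ * η * (b⁻¹ * b')) = b * η * (b⁻¹ * b') := by group
      have e4 : (b * η * (b⁻¹ * b')) • z = (b * η) • z := by rw [mul_smul, hnz]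
      have hnD : b⁻¹ * b' ∈ D := mul_mem (inv_mem hb) hb'
      have e2 := h' _ (mul_mem (mul_mem (inv_mem hnD) hη) hnD) hj' (by
        rw [e3, e4]; exact hK.2)
      rw [e3, e4] at e2
      rw [e1, e2, QuotientGroup.eq, inv_mul_cancel_left]
    have hx : s x = s' x ↔ b⁻¹ * b' ∈ D₀ := by
      have := main 1 (one_mem D) (JoinedIn.refl ⟨mem_of_mem_nhds hO, mem_of_mem_nhds hn⟩)
        (by rw [mul_one, hbx]; exact ⟨hxK, hxK'⟩)
      rwa [mul_one, hbx] at this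
    have hb1 : ContinuousAt (fun y : ℝ => b⁻¹ • y) x := (continuous_const_smul b⁻¹).continuousAt
    have hbz : b⁻¹ • x = z := by rw [← hbx, inv_smul_smul]
    have hb2 : Filter.Tendsto (fun y : ℝ => b⁻¹ • y) (𝓝 x) (𝓝 z) := by rw [← hbz]; exact hb1
    have hev := hb2.eventually (hloc _ (Filter.inter_mem hO hn))
    filter_upwards [nhdsWithin_le_nhds hev, self_mem_nhdsWithin] with y hy hyK
    obtain ⟨η, hη, hj, hy⟩ := hy
    have hy' : (b * η) • z = y := by rw [mul_smul, hy, smul_inv_smul]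
    have := main η hη hj (by rwa [hy'])
    rw [hy'] at this
    exact hx.trans this.symm
  intro y hy
  exact (hKK.induction₂ (fun x y => s x = s' x ↔ s y = s' y) key
    (fun _ _ _ _ _ _ h1 h2 => h1.trans h2) (fun _ _ _ _ h1 => h1.symm) hx₀ hy).1 h0

end IsGoodSection

variable [IsTopologicalGroup Γ] [ContinuousSMul Γ ℝ]

/-- A stabilizer in a group generated by small elements is generated by small elements, provided
that small elements move `z` to all nearby points of the line. -/
theorem stabilizer_le_closure_joinedIn (hmono : ∀ g : Γ, StrictMono fun t : ℝ => g • t)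
    {D : Subgroup Γ} {z : ℝ}
    (hC : ∀ O ∈ 𝓝 (1 : Γ), D ≤ Subgroup.closure {κ | κ ∈ D ∧ JoinedIn O 1 κ})
    (hloc : ∀ O ∈ 𝓝 (1 : Γ), ∀ᶠ x in 𝓝 z, ∃ κ ∈ D, JoinedIn O 1 κ ∧ κ • z = x)
    {O : Set Γ} (hO : O ∈ 𝓝 (1 : Γ)) {d : Γ} (hd : d ∈ D) (hdz : d • z = z) :
    d ∈ Subgroup.closure {κ | (κ ∈ D ∧ κ • z = z) ∧ JoinedIn O 1 κ} := by
  obtain ⟨V, hV, hVO⟩ := exists_nhds_one_split4 hO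
  set P : Set Γ := V ∩ V⁻¹ with hPdef
  have hP : P ∈ 𝓝 (1 : Γ) := Filter.inter_mem hV (inv_mem_nhds_one Γ hV)
  have hPinv : P⁻¹ = P := by rw [hPdef, inter_inv, inv_inv, inter_comm]
  have hV1 : (1 : Γ) ∈ V := mem_of_mem_nhds hV
  have hjinv : ∀ {κ : Γ}, JoinedIn P 1 κ → JoinedIn P 1 κ⁻¹ := fun h => by
    have := h.inv
    rwa [hPinv, inv_one] at this
  have hPPP : ∀ {a b c : Γ}, JoinedIn P 1 a → JoinedIn P 1 b → JoinedIn P 1 c →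
      JoinedIn O 1 (a * b * c) := fun ha hb hc => by
    have := (ha.mul hb).mul hc
    simp only [one_mul] at this
    refine this.mono ?_
    rintro _ ⟨_, ⟨x, hx, y, hy, rfl⟩, u, hu, rfl⟩
    have := hVO hx.1 hy.1 hu.1 hV1
    rwa [mul_one] at this
  -- Small lifts of a point near `z` differ by a small element fixing `z`, so they define the same
  -- coset of `D₀`.
  set D₀ := Subgroup.closure {κ | (κ ∈ D ∧ κ • z = z) ∧ JoinedIn O 1 κ} with hD₀
  obtain ⟨ε, hε, hJ⟩ := Metric.eventually_nhds_iff_ball.1 (hloc P hP)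
  set J : Set ℝ := Metric.ball z ε with hJdef
  have hzJ : z ∈ J := Metric.mem_ball_self hε
  choose! κ hκD hκj hκz using hJ
  have hbase : ∀ η ∈ D, JoinedIn P 1 η → η • z ∈ J → (κ (η • z) : Γ ⧸ D₀) = η := by
    intro η hη hj hz
    rw [QuotientGroup.eq]
    refine Subgroup.subset_closure ⟨⟨mul_mem (inv_mem (hκD _ hz)) hη, ?_⟩, ?_⟩
    · rw [mul_smul, inv_smul_eq_iff, hκz _ hz]
    · have := hPPP (hjinv (hκj _ hz)) hj (JoinedIn.refl (mem_of_mem_nhds hP))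
      rwa [mul_one] at this
  have htrans : ∀ g ∈ D, IsGoodSection D D₀ z ((fun x => g⁻¹ • x) ⁻¹' J)
      (fun x => ((g * κ (g⁻¹ • x) : Γ) : Γ ⧸ D₀)) := by
    intro g hg x hx
    have hx' : g⁻¹ • x ∈ J := hx
    refine ⟨g * κ (g⁻¹ • x), mul_mem hg (hκD _ hx'), by rw [mul_smul, hκz _ hx', smul_inv_smul],
      P, hP, fun η hη hj hK => ?_⟩
    have hK' : g⁻¹ • (g * κ (g⁻¹ • x) * η) • z ∈ J := hK
    have e : g⁻¹ • (g * κ (g⁻¹ • x) * η) • z = (κ (g⁻¹ • x) * η) • z := by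
      rw [← mul_smul]; group
    rw [QuotientGroup.eq, mul_inv_rev, e]
    rw [e] at hK'
    refine Subgroup.subset_closure ⟨⟨?_, ?_⟩, ?_⟩
    · exact mul_mem (mul_mem (inv_mem (hκD _ hK')) (inv_mem hg))
        (mul_mem (mul_mem hg (hκD _ hx')) hη)
    · have e2 : (κ ((κ (g⁻¹ • x) * η) • z))⁻¹ * g⁻¹ * (g * κ (g⁻¹ • x) * η) =
          (κ ((κ (g⁻¹ • x) * η) • z))⁻¹ * (κ (g⁻¹ • x) * η) := by group
      rw [e2, mul_smul, inv_smul_eq_iff, hκz _ hK']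
    · have e2 : (κ ((κ (g⁻¹ • x) * η) • z))⁻¹ * g⁻¹ * (g * κ (g⁻¹ • x) * η) =
          (κ ((κ (g⁻¹ • x) * η) • z))⁻¹ * κ (g⁻¹ • x) * η := by group
      rw [e2]
      exact hPPP (hjinv (hκj _ hK')) (hκj _ hx') hj
  have hPJ : P ∩ {g : Γ | g • z ∈ J} ∈ 𝓝 (1 : Γ) := by
    refine Filter.inter_mem hP ?_
    have hc : Continuous fun g : Γ => g • z := continuous_id.smul continuous_const
    exact hc.continuousAt.preimage_mem_nhds (by simpa using Metric.ball_mem_nhds z hε)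
  have hQ : ∀ᶠ g in 𝓝 (1 : Γ), (g ∈ P ∧ g • z ∈ J) ∧ g⁻¹ ∈ P ∧ g⁻¹ • z ∈ J := by
    refine Filter.Eventually.and hPJ ?_
    have : Filter.Tendsto (fun g : Γ => g⁻¹) (𝓝 1) (𝓝 1) := by
      simpa using (continuous_inv (G := Γ)).tendsto 1
    exact this.eventually hPJ
  have hmem := hC _ hQ hd
  -- Continuation along a word in small generators: one section over an interval through `z` and `g
  -- • z` takes the cosets of `1` and `g` there.
  let S : Γ → Prop := fun g => g ∈ D ∧ ∃ (K : Set ℝ) (s : ℝ → Γ ⧸ D₀), IsOpen K ∧ OrdConnected K ∧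
    z ∈ K ∧ g • z ∈ K ∧ IsGoodSection D D₀ z K s ∧ s z = (1 : Γ) ∧ s (g • z) = g
  have hstep : ∀ g κ' : Γ, S g → κ' ∈ D → JoinedIn P 1 κ' → κ' • z ∈ J → S (g * κ') := by
    rintro g κ' ⟨hg, K, s, hKo, hKc, hzK, hgK, hs, hs1, hsg⟩ hκ' hj hκJ
    set K' : Set ℝ := (fun x => g⁻¹ • x) ⁻¹' J with hK'def
    set s' : ℝ → Γ ⧸ D₀ := fun x => ((g * κ (g⁻¹ • x) : Γ) : Γ ⧸ D₀) with hs'def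
    have hgood : IsGoodSection D D₀ z K' s' := htrans g hg
    have hK'o : IsOpen K' := Metric.isOpen_ball.preimage (continuous_const_smul g⁻¹)
    have hK'c : OrdConnected K' :=
      (by rw [hJdef, Real.ball_eq_Ioo]; exact ordConnected_Ioo : OrdConnected J).preimage_mono
        (hmono g⁻¹).monotone
    have hgK' : g • z ∈ K' := by
      change g⁻¹ • g • z ∈ J
      rwa [inv_smul_smul]
    have hmk : ∀ η : Γ, η ∈ D → JoinedIn P 1 η → η • z ∈ J → s' ((g * η) • z) = (g * η : Γ) := by
      intro η hη hj hz
      have := hbase η hη hj hz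
      rw [QuotientGroup.eq] at this
      simp only [hs'def]
      rw [mul_smul, inv_smul_smul, QuotientGroup.eq, mul_inv_rev, mul_assoc, inv_mul_cancel_left]
      exact this
    have hs'g : s' (g • z) = g := by
      simpa using hmk 1 (one_mem D) (JoinedIn.refl (mem_of_mem_nhds hP)) (by simpa using hzJ)
    -- Here the topology of the line enters: two intervals meet in a connected set, so the two
    -- sections glue.
    have heq : EqOn s s' (K ∩ K') := hs.eqOn hloc hgood (hKc.inter hK'c).isPreconnected
      ⟨hgK, hgK'⟩ (hsg.trans hs'g.symm)
    classical
    have hK1 : EqOn s (K.piecewise s s') K := fun x hx => (piecewise_eq_of_mem K s s' hx).symm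
    have hK2 : EqOn s' (K.piecewise s s') K' := by
      intro x hx
      by_cases hxK : x ∈ K
      · rw [piecewise_eq_of_mem K s s' hxK, heq ⟨hxK, hx⟩]
      · rw [piecewise_eq_of_notMem K s s' hxK]
    have hgκ : (g * κ') • z ∈ K' := by
      change g⁻¹ • (g * κ') • z ∈ J
      rwa [mul_smul, inv_smul_smul]
    refine ⟨mul_mem hg hκ', K ∪ K', K.piecewise s s', hKo.union hK'o, ?_, Or.inl hzK, Or.inr hgκ,
      (hs.congr hK1).union hKo hK'o (hgood.congr hK2), ?_, ?_⟩
    · exact (hKc.isPreconnected.union (g • z) hgK hgK' hK'c.isPreconnected).ordConnected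
    · rw [← hK1 hzK, hs1]
    · rw [← hK2 hgκ, hmk κ' hκ' hj hκJ]
  have hS : S d := by
    clear hd hdz
    induction hmem using Subgroup.closure_induction_right with
    | one =>
      refine ⟨one_mem D, _, _, Metric.isOpen_ball.preimage (continuous_const_smul (1 : Γ)⁻¹), ?_,
        ?_, ?_, htrans 1 (one_mem D), ?_, ?_⟩
      · exact (by rw [hJdef, Real.ball_eq_Ioo]; exact ordConnected_Ioo : OrdConnected J).preimage_mono
          (hmono 1⁻¹).monotone
      · simpa using hε
      · simpa using hε
      · simpa using hbase 1 (one_mem D) (JoinedIn.refl (mem_of_mem_nhds hP)) (by simpa using hzJ)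
      · simpa using hbase 1 (one_mem D) (JoinedIn.refl (mem_of_mem_nhds hP)) (by simpa using hzJ)
    | mul_right g _ κ' hκ' ih =>
      exact hstep g κ' ih hκ'.1 (hκ'.2.mono fun g hg => hg.1.1) hκ'.2.target_mem.1.2
    | mul_inv_cancel g _ κ' hκ' ih =>
      exact hstep g κ'⁻¹ ih (inv_mem hκ'.1) (hjinv (hκ'.2.mono fun g hg => hg.1.1))
        hκ'.2.target_mem.2.2
  obtain ⟨-, K, s, -, -, -, -, -, hs1, hsd⟩ := hS
  -- Since `d • z = z` and the section is single valued, `d` lies in the coset of `1`.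
  rw [hdz, hs1, QuotientGroup.eq, inv_one, one_mul] at hsd
  exact hsd

end Sections

section Induction

variable {Γ : Type*} [Group Γ] [TopologicalSpace Γ] [IsTopologicalGroup Γ] [PathConnectedSpace Γ]
  [MulAction Γ ℝ] [ContinuousSMul Γ ℝ]

/-- A path-connected group acting on the line by increasing homeomorphisms, in which the stabilizer
of a tuple has no fixed point to the right of the tuple as long as the group is transitive on
increasing tuples of that length, is transitive on increasing tuples of every length. -/
theorem exists_smul_eq_of_no_fixed_point (hmono : ∀ g : Γ, StrictMono fun t : ℝ => g • t)
    (hN : ∀ m, (∀ x y : Fin m → ℝ, StrictMono x → StrictMono y → ∃ g : Γ, g • x = y) →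
      ∀ w : Fin m → ℝ, StrictMono w → ∀ z, (∀ i, w i < z) → ∃ d ∈ stabilizer Γ w, d • z ≠ z)
    (m : ℕ) {x y : Fin m → ℝ} (hx : StrictMono x) (hy : StrictMono y) : ∃ g : Γ, g • x = y := by
  -- Transitivity does not reproduce itself; the essential family and the small generation of
  -- stabilizers must be carried along.
  suffices h : (∀ x y : Fin m → ℝ, StrictMono x → StrictMono y → ∃ g : Γ, g • x = y) ∧
      ∀ w : Fin m → ℝ, StrictMono w →
        (∃ Φ : (Fin m → ℝ) → Γ, Continuous Φ ∧ IsEssential fun b => Φ b • w - w) ∧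
        ∀ O ∈ 𝓝 (1 : Γ),
          stabilizer Γ w ≤ Subgroup.closure {κ | κ ∈ stabilizer Γ w ∧ JoinedIn O 1 κ} from
    h.1 x y hx hy
  clear hx hy x y
  induction m with
  | zero =>
    refine ⟨fun x y _ _ => ⟨1, Subsingleton.elim _ _⟩, fun w _ => ⟨⟨fun _ => 1, continuous_const,
      ?_⟩, fun O hO d hd => ?_⟩⟩
    · convert IsEssential.id
    · have : {κ | κ ∈ stabilizer Γ w ∧ JoinedIn O 1 κ} = {κ | JoinedIn O 1 κ} :=
        Set.ext fun κ => and_iff_right (Subsingleton.elim _ _)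
      rw [this]
      exact mem_closure_joinedIn hO d
  | succ m ih =>
    obtain ⟨hT, hEC⟩ := ih
    have hN' := hN m hT
    have htr : ∀ w : Fin m → ℝ, StrictMono w → ∀ z z', (∀ i, w i < z) → (∀ i, w i < z') →
        ∃ d ∈ stabilizer Γ w, d • z = z' := by
      intro w hw z z' hz hz'
      obtain ⟨⟨Φ, hΦ, he⟩, hC⟩ := hEC w hw
      exact exists_stabilizer_smul_eq hmono hΦ he hC (hN' w hw) hz hz'
    refine ⟨fun x y hx hy => ?_, fun w' hw' => ?_⟩
    · rw [← Fin.snoc_init_self (α := fun _ => ℝ) x, strictMono_append] at hx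
      rw [← Fin.snoc_init_self (α := fun _ => ℝ) y, strictMono_append] at hy
      obtain ⟨g, hg⟩ := hT _ _ hx.1 hy.1
      obtain ⟨d, hd, hdy⟩ := htr _ hy.1 (g • x (Fin.last m)) (y (Fin.last m)) (fun i => by
        have := hmono g (hx.2 i)
        rw [← hg]
        exact this) hy.2
      refine ⟨d * g, ?_⟩
      rw [← Fin.snoc_init_self (α := fun _ => ℝ) x, ← Fin.snoc_init_self (α := fun _ => ℝ) y]
      rw [mul_smul, append_smul, append_smul, hg, hdy, mem_stabilizer_iff.1 hd]
    · obtain ⟨w, z, rfl⟩ : ∃ w z, w' = append w z :=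
        ⟨_, _, (Fin.snoc_init_self (α := fun _ => ℝ) w').symm⟩
      obtain ⟨hw, hz⟩ := strictMono_append.1 hw'
      obtain ⟨⟨Φ, hΦ, he⟩, hC⟩ := hEC w hw
      obtain ⟨ζ, Ψ, hζ, hΨ, hess⟩ := exists_essential_append hmono hΦ he hC (hN' w hw) hz
      -- The crossing ends at `ζ` rather than `z`. An element of the stabilizer brings it back,
      -- without changing signs of coordinates.
      obtain ⟨k, hk, hkz⟩ := htr w hw ζ z hζ hz
      have hE : IsEssential fun b => (k * Ψ b) • append w z - append w z := by
        refine hess.of_sameSign (((continuous_const.mul hΨ).smul continuous_const).sub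
          continuous_const) fun b _ i => ?_
        have hkw : k • append w ζ = append w z := by
          rw [append_smul, hkz, mem_stabilizer_iff.1 hk]
        have := (hmono k).sameSign ((Ψ b • append w z) i) (append w ζ i)
        change SameSign _ ((k • Ψ b • append w z) i - (k • append w ζ) i) at this
        rwa [hkw, ← mul_smul] at this
      refine ⟨⟨fun b => k * Ψ b, continuous_const.mul hΨ, hE⟩, fun O hO d hd => ?_⟩
      rw [mem_stabilizer_append] at hd
      have hset : {κ | κ ∈ stabilizer Γ (append w z) ∧ JoinedIn O 1 κ} =
          {κ | (κ ∈ stabilizer Γ w ∧ κ • z = z) ∧ JoinedIn O 1 κ} := by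
        ext κ
        exact and_congr_left' mem_stabilizer_append
      rw [hset]
      refine stabilizer_le_closure_joinedIn hmono hC (fun O hO => ?_) hO hd.1 hd.2
      have hnh := exists_nhds_joinedIn (continuous_const.mul hΨ) hE hO
      have hap : Continuous fun x : ℝ => append w x := continuous_const.append continuous_id
      filter_upwards [hap.continuousAt.eventually hnh] with x hx
      obtain ⟨κ, hj, hκ⟩ := hx
      rw [append_smul] at hκ
      obtain ⟨h1, h2⟩ := append_injective hκ
      exact ⟨κ, h1, hj, h2⟩

end Induction

end

/-! ### Hölder's theorem for simply transitive groups on the line -/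

section

open Set Topology

theorem OrderIso.lt_of_lt_of_ne {a b : ℝ ≃o ℝ} (hne : ∀ z, a z ≠ b z) {x : ℝ} (h : a x < b x)
    (y : ℝ) : a y < b y := by
  by_contra! hy
  obtain ⟨z, -, hz⟩ := isPreconnected_univ.intermediate_value₂ (mem_univ x) (mem_univ y)
    a.continuous.continuousOn b.continuous.continuousOn h.le hy
  exact hne z hz

/-- A group of increasing homeomorphisms of the line which is simply transitive. -/
structure IsRegularOnLine (A : Subgroup (ℝ ≃o ℝ)) : Prop where
  exists_eq : ∀ x y : ℝ, ∃ a ∈ A, a x = y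
  eq_one : ∀ a ∈ A, ∀ x, a x = x → a = 1

namespace IsRegularOnLine

variable {A : Subgroup (ℝ ≃o ℝ)}

theorem eq_of_apply_eq (hA : IsRegularOnLine A) {a b : ℝ ≃o ℝ} (ha : a ∈ A) (hb : b ∈ A) {x : ℝ}
    (h : a x = b x) : a = b := by
  have := hA.eq_one (b⁻¹ * a) (mul_mem (inv_mem hb) ha) x (by
    rw [RelIso.mul_apply, h, RelIso.inv_apply_self])
  rwa [inv_mul_eq_one, eq_comm] at this

/-- Graphs of distinct elements never meet, so `A` is totally ordered by comparison at any one
point. -/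
theorem lt_of_lt (hA : IsRegularOnLine A) {a b : ℝ ≃o ℝ} (ha : a ∈ A) (hb : b ∈ A) {x : ℝ}
    (h : a x < b x) (y : ℝ) : a y < b y := by
  refine OrderIso.lt_of_lt_of_ne (fun z hz => ?_) h y
  rw [hA.eq_of_apply_eq ha hb hz] at h
  exact lt_irrefl _ h

theorem le_of_le (hA : IsRegularOnLine A) {a b : ℝ ≃o ℝ} (ha : a ∈ A) (hb : b ∈ A) {x : ℝ}
    (h : a x ≤ b x) (y : ℝ) : a y ≤ b y :=
  not_lt.1 fun h' => h.not_gt (hA.lt_of_lt hb ha h' x)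

/-- The Archimedean property: the supremum of a bounded forward orbit would be fixed by `c`. -/
theorem exists_pow_gt (hA : IsRegularOnLine A) {c : ℝ ≃o ℝ} (hc : c ∈ A) {x : ℝ} (hx : x < c x)
    (y z : ℝ) : ∃ n : ℕ, z < (c ^ n) y := by
  by_contra! h
  have hb : BddAbove (range fun n : ℕ => (c ^ n) y) := ⟨z, by rintro _ ⟨n, rfl⟩; exact h n⟩
  have h1 := hA.lt_of_lt (one_mem A) hc (x := x) hx (c⁻¹ (⨆ n : ℕ, (c ^ n) y))
  rw [RelIso.apply_inv_self] at h1
  obtain ⟨n, hn⟩ := exists_lt_of_lt_ciSup h1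
  have h2 : (c ^ (n + 1)) y ≤ ⨆ n : ℕ, (c ^ n) y := le_ciSup hb (n + 1)
  have h3 := c.strictMono hn
  rw [RelIso.one_apply, RelIso.apply_inv_self, ← RelIso.mul_apply, ← pow_succ'] at h3
  exact h3.not_ge h2

theorem exists_zpow_le_lt (hA : IsRegularOnLine A) {c g : ℝ ≃o ℝ} (hc : c ∈ A) (hg : g ∈ A) {x : ℝ}
    (hx : x < c x) : ∃ n : ℤ, (∀ y, (c ^ n) y ≤ g y) ∧ ∀ y, g y < (c ^ (n + 1)) y := by
  obtain ⟨N, hN⟩ := hA.exists_pow_gt hc hx 0 (g 0)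
  obtain ⟨M, hM⟩ := hA.exists_pow_gt hc hx (g 0) 0
  have hmono : ∀ {k l : ℤ}, k ≤ l → (c ^ k) 0 ≤ (c ^ l) 0 := by
    intro k l hkl
    obtain ⟨n, rfl⟩ := Int.le.dest hkl
    induction n with
    | zero => simp
    | succ n ih =>
      refine (ih (by simp)).trans ?_
      have := hA.lt_of_lt (one_mem A) hc (x := x) hx ((c ^ (k + (n : ℤ))) 0)
      rw [RelIso.one_apply, ← RelIso.mul_apply, ← zpow_one_add] at this
      push_cast
      rw [← add_assoc, add_comm (k + (n : ℤ))]
      exact this.le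
  have hM' : (c ^ (-(M : ℤ))) 0 ≤ g 0 := by
    have := (c ^ (-(M : ℤ))).monotone hM.le
    have e : c ^ (-(M : ℤ)) = (c ^ M)⁻¹ := by rw [zpow_neg, zpow_natCast]
    rw [e] at this ⊢
    rwa [RelIso.inv_apply_self] at this
  obtain ⟨n, hn, hmax⟩ := Int.exists_greatest_of_bdd (P := fun k : ℤ => (c ^ k) 0 ≤ g 0)
    ⟨N, fun k hk => by
      by_contra! h
      have := (hmono h.le).trans hk
      rw [zpow_natCast] at this
      exact hN.not_ge this⟩ ⟨_, hM'⟩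
  refine ⟨n, hA.le_of_le (zpow_mem hc n) hg hn, hA.lt_of_lt (x := 0) hg (zpow_mem hc _) ?_⟩
  by_contra! h
  have := hmax _ h
  omega

/-- If the commutator `c` is positive, take a positive `d` with `d² ≤ c` and squeeze `a` and `b`
between consecutive powers of `d`. Then `ab < d^(m+n+2) ≤ bac = ab`. -/
theorem mul_comm (hA : IsRegularOnLine A) {a b : ℝ ≃o ℝ} (ha : a ∈ A) (hb : b ∈ A) :
    a * b = b * a := by
  by_contra hne
  wlog hlt : (b * a) 0 < (a * b) 0 generalizing a b
  · refine this hb ha (fun h => hne h.symm) (lt_of_le_of_ne (not_lt.1 hlt) fun h => hne ?_)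
    exact hA.eq_of_apply_eq (mul_mem ha hb) (mul_mem hb ha) h
  set c := (b * a)⁻¹ * (a * b) with hcdef
  have hcA : c ∈ A := mul_mem (inv_mem (mul_mem hb ha)) (mul_mem ha hb)
  have hc0 : 0 < c 0 := by
    have := ((b * a)⁻¹).strictMono hlt
    rwa [RelIso.inv_apply_self, ← RelIso.mul_apply] at this
  -- Factor `c` into two positive elements and take the smaller one.
  obtain ⟨d, hdA, hd0, hdc⟩ : ∃ d ∈ A, 0 < d 0 ∧ ∀ x, d (d x) ≤ c x := by
    obtain ⟨d, hd, hd0⟩ := hA.exists_eq 0 (c 0 / 2)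
    have h1 : 0 < d 0 := by linarith
    have h2 : 0 < (d⁻¹ * c) 0 := by
      have : d 0 < c 0 := by linarith
      have := d⁻¹.strictMono this
      rwa [RelIso.inv_apply_self, ← RelIso.mul_apply] at this
    have hdc : d * (d⁻¹ * c) = c := mul_inv_cancel_left d c
    have hdA := mul_mem (inv_mem hd) hcA
    rcases le_total (d 0) ((d⁻¹ * c) 0) with h | h
    · refine ⟨d, hd, h1, fun x => ?_⟩
      have := d.monotone (hA.le_of_le hd hdA h x)
      rwa [← RelIso.mul_apply d (d⁻¹ * c), hdc] at this
    · refine ⟨d⁻¹ * c, hdA, h2, fun x => ?_⟩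
      have := hA.le_of_le hdA hd h ((d⁻¹ * c) x)
      rwa [← RelIso.mul_apply d (d⁻¹ * c), hdc] at this
  obtain ⟨m, hm1, hm2⟩ := hA.exists_zpow_le_lt hdA ha hd0
  obtain ⟨n, hn1, hn2⟩ := hA.exists_zpow_le_lt hdA hb hd0
  have h1 : a (b 0) < (d ^ (m + 1)) ((d ^ (n + 1)) 0) :=
    (hm2 _).trans ((d ^ (m + 1)).strictMono (hn2 0))
  have h2 : (d ^ (m + 1)) ((d ^ (n + 1)) 0) = (d ^ n) ((d ^ m) (d (d 0))) := by
    simp only [← RelIso.mul_apply]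
    congr 1
    group
  have h3 : (d ^ n) ((d ^ m) (d (d 0))) ≤ b (a (c 0)) := by
    refine (((d ^ n).monotone ((d ^ m).monotone (hdc 0))).trans
      ((d ^ n).monotone (hm1 _))).trans (hn1 _)
  have h4 : b (a (c 0)) = a (b 0) := by
    simp only [← RelIso.mul_apply]
    rw [hcdef]
    congr 1
    group
  rw [h2] at h1
  exact (h1.trans_le h3).ne h4.symm

/-- Hölder's theorem: a simply transitive group of increasing homeomorphisms of the line is
conjugate to the group of translations. -/
theorem exists_coordinate (hA : IsRegularOnLine A) :
    ∃ φ : ℝ ≃o ℝ, ∀ s, ∃ a ∈ A, ∀ x, a (φ x) = φ (x + s) := by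
  let _ : CommGroup A :=
    { (inferInstance : Group A) with
      mul_comm := fun a b => Subtype.ext (hA.mul_comm a.2 b.2) }
  let _ : LinearOrder A := LinearOrder.lift' (fun a : A => (a : ℝ ≃o ℝ) 0) fun a b h =>
    Subtype.ext (hA.eq_of_apply_eq a.2 b.2 h)
  have hle : ∀ a b : A, a ≤ b ↔ (a : ℝ ≃o ℝ) 0 ≤ (b : ℝ ≃o ℝ) 0 := fun _ _ => Iff.rfl
  have hlt : ∀ a b : A, a < b ↔ (a : ℝ ≃o ℝ) 0 < (b : ℝ ≃o ℝ) 0 := fun _ _ => Iff.rfl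
  have : IsOrderedMonoid A := ⟨fun a b h c => by
    rw [_root_.mul_comm a c, _root_.mul_comm b c]
    exact (c : ℝ ≃o ℝ).monotone h, fun a b h c => (c : ℝ ≃o ℝ).monotone h⟩
  have : MulArchimedean A := ⟨fun x y hy => by
    obtain ⟨n, hn⟩ := hA.exists_pow_gt y.2 (x := 0) hy 0 ((x : ℝ ≃o ℝ) 0)
    exact ⟨n, by rw [hle]; simpa using hn.le⟩⟩
  obtain ⟨f, hf⟩ := Archimedean.exists_orderAddMonoidHom_real_injective (Additive A)
  have hfm : StrictMono f := f.monotone'.strictMono_of_injective hf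
  choose a haA ha using hA.exists_eq 0
  let u : ℝ → ℝ := fun x => f (Additive.ofMul ⟨a x, haA x⟩)
  have hu : StrictMono u := fun x y hxy => hfm (by
    change (⟨a x, haA x⟩ : A) < ⟨a y, haA y⟩
    rw [hlt]
    simpa [ha] using hxy)
  have hadd : ∀ b : A, ∀ x, u ((b : ℝ ≃o ℝ) x) = f (Additive.ofMul b) + u x := by
    intro b x
    have : a ((b : ℝ ≃o ℝ) x) = b * a x :=
      hA.eq_of_apply_eq (x := 0) (haA _) (mul_mem b.2 (haA x)) (by rw [RelIso.mul_apply, ha, ha])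
    have h2 : (⟨a ((b : ℝ ≃o ℝ) x), haA _⟩ : A) = b * ⟨a x, haA x⟩ := Subtype.ext this
    simp only [u]
    rw [h2, ofMul_mul, map_add]
  have hrange : ∀ r ∈ (f : Additive A →+ ℝ).range, ∃ x, u x = r := by
    rintro _ ⟨b, rfl⟩
    refine ⟨(b.toMul : ℝ ≃o ℝ) 0, ?_⟩
    have h0 : u 0 = 0 := by
      have : a 0 = 1 := hA.eq_one _ (haA 0) 0 (ha 0)
      have h2 : (⟨a 0, haA 0⟩ : A) = 1 := Subtype.ext this
      simp only [u]
      rw [h2, ofMul_one, map_zero]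
    rw [hadd, h0, add_zero]
    rfl
  have hmem : ∀ x, u x ∈ (f : Additive A →+ ℝ).range := fun x => ⟨_, rfl⟩
  have hsurj : Function.Surjective u := by
    -- A dense range makes the increasing `u` continuous, hence onto; a cyclic range would make the
    -- line countable.
    rcases AddSubgroup.dense_or_cyclic (f : Additive A →+ ℝ).range with h | ⟨g, hg⟩
    · have hd : DenseRange u := h.mono fun r hr => hrange r hr
      have hc : Continuous u := hu.monotone.continuous_of_denseRange hd
      intro r
      obtain ⟨_, ⟨x, rfl⟩, h1⟩ := hd.exists_lt r
      obtain ⟨_, ⟨y, rfl⟩, h2⟩ := hd.exists_gt r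
      exact mem_range_of_exists_le_of_exists_ge hc ⟨x, h1.le⟩ ⟨y, h2.le⟩
    · exfalso
      have hcount : (range u).Countable := by
        refine (countable_range fun n : ℤ => n • g).mono ?_
        rintro _ ⟨x, rfl⟩
        have := hmem x
        rw [hg, AddSubgroup.mem_closure_singleton] at this
        exact this
      have h := hcount.preimage_of_injOn (f := u) hu.injective.injOn
      rw [preimage_range, countable_univ_iff] at h
      exact not_countable (α := ℝ) h
  let U : ℝ ≃o ℝ := hu.orderIsoOfSurjective u hsurj
  refine ⟨U.symm, fun s => ⟨a (U.symm s), haA _, fun x => ?_⟩⟩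
  rw [OrderIso.eq_symm_apply]
  have h1 := hadd ⟨a (U.symm s), haA _⟩ (U.symm x)
  have h2 : ∀ y, u (U.symm y) = y := fun y => U.apply_symm_apply y
  have h3 : f (Additive.ofMul ⟨a (U.symm s), haA _⟩) = s := h2 s
  rw [h3, h2, add_comm] at h1
  exact h1

end IsRegularOnLine

end

/-! ### Sharply two-transitive groups on the line, by convexity of increments -/

section

open Set Topology

/-- All increments of `k` over intervals of a fixed length are strictly increasing. -/
def IncreasingIncrements (k : ℝ → ℝ) : Prop := ∀ t > 0, StrictMono fun z => k (z + t) - k z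

/-- All increments of `k` over intervals of a fixed length are strictly decreasing. -/
def DecreasingIncrements (k : ℝ → ℝ) : Prop := ∀ t > 0, StrictAnti fun z => k (z + t) - k z

theorem IncreasingIncrements.symm {k : ℝ ≃o ℝ} (h : IncreasingIncrements k) :
    DecreasingIncrements k.symm := by
  intro t ht y y' hy
  have hp : 0 < k.symm (y + t) - k.symm y := sub_pos.2 (k.symm.strictMono (by linarith))
  have h1 := h _ hp (k.symm.strictMono hy)
  simp only [add_sub_cancel, OrderIso.apply_symm_apply, add_sub_cancel_left] at h1
  have h2 : y' + t < k (k.symm y' + (k.symm (y + t) - k.symm y)) := by linarith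
  have h3 := k.symm.strictMono h2
  rw [OrderIso.symm_apply_apply] at h3
  change k.symm (y' + t) - k.symm y' < k.symm (y + t) - k.symm y
  linarith

theorem DecreasingIncrements.symm {k : ℝ ≃o ℝ} (h : DecreasingIncrements k) :
    IncreasingIncrements k.symm := by
  intro t ht y y' hy
  have hp : 0 < k.symm (y + t) - k.symm y := sub_pos.2 (k.symm.strictMono (by linarith))
  have h1 := h _ hp (k.symm.strictMono hy)
  simp only [add_sub_cancel, OrderIso.apply_symm_apply, add_sub_cancel_left] at h1
  have h2 : k (k.symm y' + (k.symm (y + t) - k.symm y)) < y' + t := by linarith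
  have h3 := k.symm.strictMono h2
  rw [OrderIso.symm_apply_apply] at h3
  change k.symm (y + t) - k.symm y < k.symm (y' + t) - k.symm y'
  linarith

/-- The positive displacement `f x - x` would be a strictly concave function on the whole line; it
falls at least linearly in one direction. -/
theorem not_decreasingIncrements_of_gt_id {f : ℝ → ℝ} (hf : ∀ x, x < f x) :
    ¬ DecreasingIncrements f := by
  intro h
  have h1 := h 1 one_pos
  have hanti : ∀ {x y : ℝ}, x ≤ y → f (y + 1) - f y ≤ f (x + 1) - f x := fun hxy => h1.antitone hxy
  have h01 : f (1 + 1) - f 1 < f (0 + 1) - f 0 := h1 zero_lt_one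
  rcases le_or_gt (f (0 + 1) - f 0 - 1) 0 with hδ | hδ
  · have key : ∀ n : ℕ, f (1 + n) - (1 + n) ≤ f 1 - 1 + n * (f (1 + 1) - f 1 - 1) := by
      intro n
      induction n with
      | zero => simp
      | succ n ih =>
        have := hanti (x := 1) (y := 1 + n) (by simp)
        push_cast
        rw [← add_assoc]
        linarith
    obtain ⟨n, hn⟩ := exists_nat_gt ((f 1 - 1) / -(f (1 + 1) - f 1 - 1))
    rw [div_lt_iff₀ (by linarith)] at hn
    linarith [key n, hf (1 + n)]
  · have key : ∀ n : ℕ, f (-n) - -n ≤ f 0 - n * (f (0 + 1) - f 0 - 1) := by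
      intro n
      induction n with
      | zero => simp
      | succ n ih =>
        have := hanti (x := -(n + 1 : ℝ)) (y := 0) (by linarith [n.cast_nonneg (α := ℝ)])
        rw [neg_add, neg_add_cancel_right] at this
        push_cast
        rw [neg_add]
        linarith
    obtain ⟨n, hn⟩ := exists_nat_gt (f 0 / (f (0 + 1) - f 0 - 1))
    rw [div_lt_iff₀ hδ] at hn
    linarith [key n, hf (-n)]

/-- A group of increasing homeomorphisms of the line which contains the translations as a proper
subgroup, acts transitively on increasing pairs, and in which only the identity has two fixed
points; moreover a conjugate of a nontrivial translation by an element which is not a translation is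
not a translation. -/
structure IsSharplyTwoTransitive (Λ : Subgroup (ℝ ≃o ℝ)) : Prop where
  translation_mem : ∀ s : ℝ, OrderIso.addRight s ∈ Λ
  exists_pair : ∀ {x y u v : ℝ}, x < y → u < v → ∃ k ∈ Λ, k x = u ∧ k y = v
  apply_eq : ∀ k ∈ Λ, ∀ {x y : ℝ}, x ≠ y → k x = x → k y = y → ∀ z, k z = z
  malnormal : ∀ k ∈ Λ, ∀ t ≠ 0, ∀ s, (∀ z, k (z + t) = k z + s) → ∀ z, k z = z + k 0

namespace IsSharplyTwoTransitive

variable {Λ : Subgroup (ℝ ≃o ℝ)}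

theorem eq_of_apply_eq (hΛ : IsSharplyTwoTransitive Λ) {k k' : ℝ ≃o ℝ} (hk : k ∈ Λ) (hk' : k' ∈ Λ)
    {x y : ℝ} (hxy : x ≠ y) (hx : k x = k' x) (hy : k y = k' y) (z : ℝ) : k z = k' z := by
  have := hΛ.apply_eq (k'⁻¹ * k) (mul_mem (inv_mem hk') hk) hxy
    (by rw [RelIso.mul_apply, hx, RelIso.inv_apply_self])
    (by rw [RelIso.mul_apply, hy, RelIso.inv_apply_self]) z
  rw [RelIso.mul_apply] at this
  rw [← RelIso.apply_inv_self k' (k z), this]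

/-- Equal increments at two places make `k` after a translation agree with a translation after `k`
at two points, hence everywhere; malnormality then makes `k` a translation. -/
theorem injective_increment (hΛ : IsSharplyTwoTransitive Λ) {k : ℝ ≃o ℝ} (hk : k ∈ Λ)
    (hkt : ¬ ∀ z, k z = z + k 0) {t : ℝ} (ht : t ≠ 0) :
    Function.Injective fun z => k (z + t) - k z := by
  intro z z' h
  by_contra hne
  have h' : k (z + t) - k z = k (z' + t) - k z' := h
  refine hkt (hΛ.malnormal k hk t ht (k (z + t) - k z) fun x => ?_)
  have := hΛ.eq_of_apply_eq (mul_mem hk (hΛ.translation_mem t))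
    (mul_mem (hΛ.translation_mem (k (z + t) - k z)) hk) hne
    (by simp) (by rw [h']; simp) x
  simpa using this

/-- A continuous injective increment function is strictly monotone. The direction cannot depend on
the length `t`, by the intermediate value theorem in `t`. -/
theorem increasing_or_decreasingIncrements (hΛ : IsSharplyTwoTransitive Λ) {k : ℝ ≃o ℝ} (hk : k ∈ Λ)
    (hkt : ¬ ∀ z, k z = z + k 0) : IncreasingIncrements k ∨ DecreasingIncrements k := by
  have hc : Continuous k := k.continuous
  have hmono : ∀ t > 0, StrictMono (fun z => k (z + t) - k z) ∨
      StrictAnti fun z => k (z + t) - k z := fun t ht =>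
    Continuous.strictMono_of_inj (by fun_prop) (hΛ.injective_increment hk hkt ht.ne')
  by_contra! h
  simp only [IncreasingIncrements, DecreasingIncrements, not_forall] at h
  obtain ⟨⟨t, ht, h1⟩, ⟨s, hs, h2⟩⟩ := h
  have h1' := (hmono t ht).resolve_left h1 zero_lt_one
  have h2' := (hmono s hs).resolve_right h2 zero_lt_one
  obtain ⟨u, hu, h0⟩ := (isPreconnected_Ioi (a := (0 : ℝ))).intermediate_value₂
    (f := fun t => k (1 + t) - k 1) (g := fun t => k (0 + t) - k 0) ht hs
    (by fun_prop) (by fun_prop) h1'.le h2'.le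
  exact one_ne_zero (hΛ.injective_increment hk hkt (ne_of_gt hu) h0)

/-- A conjugate of the unit translation lies above the identity, which rules out the decreasing kind
whatever the kind of `k`. -/
theorem exists_conj (hΛ : IsSharplyTwoTransitive Λ) {k : ℝ ≃o ℝ} (hk : k ∈ Λ)
    (hkt : ¬ ∀ z, k z = z + k 0) :
    ∃ f ∈ Λ, (∀ x, f x = k.symm (k x + 1)) ∧ IncreasingIncrements f := by
  have hf : ∀ x, (k⁻¹ * OrderIso.addRight (1 : ℝ) * k) x = k.symm (k x + 1) := fun x => rfl
  have hmem : k⁻¹ * OrderIso.addRight (1 : ℝ) * k ∈ Λ :=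
    mul_mem (mul_mem (inv_mem hk) (hΛ.translation_mem 1)) hk
  have hgt : ∀ x, x < (k⁻¹ * OrderIso.addRight (1 : ℝ) * k) x := fun x => by
    rw [hf, OrderIso.lt_symm_apply]
    linarith
  refine ⟨_, hmem, hf, (hΛ.increasing_or_decreasingIncrements hmem fun h => hkt ?_).resolve_right
    (not_decreasingIncrements_of_gt_id hgt)⟩
  refine hΛ.malnormal k hk ((k⁻¹ * OrderIso.addRight (1 : ℝ) * k) 0) (hgt 0).ne' 1 fun z => ?_
  rw [← h, hf, OrderIso.apply_symm_apply]

theorem sub_const_mem (hΛ : IsSharplyTwoTransitive Λ) {f : ℝ ≃o ℝ} (hf : f ∈ Λ)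
    (hfc : IncreasingIncrements f) :
    ∃ p ∈ Λ, p 0 = 0 ∧ p 1 = f 1 - f 0 ∧ IncreasingIncrements p := by
  refine ⟨OrderIso.addRight (-f 0) * f, mul_mem (hΛ.translation_mem _) hf, ?_, ?_, ?_⟩
  · simp
  · simp [sub_eq_add_neg]
  · intro t ht
    simpa using hfc t ht

/-- The increments of the elements fixing `0` and expanding `[0, 1]` are all of the same kind. -/
theorem not_increasing_and_decreasing (hΛ : IsSharplyTwoTransitive Λ) {p q : ℝ ≃o ℝ} (hp : p ∈ Λ)
    (hq : q ∈ Λ) (hp0 : p 0 = 0) (hq0 : q 0 = 0) (hp1 : 1 < p 1) (hq1 : 1 < q 1)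
    (hpi : IncreasingIncrements p) (hqd : DecreasingIncrements q) : False := by
  have hex : ∀ l : ℝ, ∃ k ∈ Λ, 0 < l → k 0 = 0 ∧ k 1 = l := by
    intro l
    by_cases hl : 0 < l
    · obtain ⟨k, hk, h⟩ := hΛ.exists_pair zero_lt_one hl
      exact ⟨k, hk, fun _ => h⟩
    · exact ⟨1, one_mem _, fun h => absurd h hl⟩
  choose κ hκ hκ01 using hex
  have huniq : ∀ {k : ℝ ≃o ℝ}, k ∈ Λ → k 0 = 0 → κ (k 1) 2 = k 2 := by
    intro k hk hk0
    have hpos : 0 < k 1 := by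
      have := k.strictMono zero_lt_one
      rwa [hk0] at this
    obtain ⟨h0, h1⟩ := hκ01 _ hpos
    exact hΛ.eq_of_apply_eq (hκ _) hk zero_ne_one (by rw [h0, hk0]) h1 2
  -- `F l` is the image of `2` under the element fixing `0` and sending `1` to `l`. The identity for
  -- `l ≤ 0` makes `F` an increasing bijection of the line, hence continuous.
  let F : ℝ → ℝ := fun l => if 0 < l then κ l 2 else l
  have hFpos : ∀ l, 0 < l → F l = κ l 2 := fun l hl => if_pos hl
  have hFneg : ∀ l, l ≤ 0 → F l = l := fun l hl => if_neg (not_lt.2 hl)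
  have hpos : ∀ l, 0 < l → 0 < κ l 2 := by
    intro l hl
    have := (κ l).strictMono zero_lt_two
    rwa [(hκ01 l hl).1] at this
  have hmono : StrictMono F := by
    intro l l' hll
    rcases le_or_gt l' 0 with h' | h'
    · rw [hFneg _ h', hFneg _ (hll.le.trans h')]
      exact hll
    rcases le_or_gt l 0 with h | h
    · rw [hFpos _ h', hFneg _ h]
      exact h.trans_lt (hpos _ h')
    rw [hFpos _ h', hFpos _ h]
    by_contra! hge
    have h1 : κ l 1 ≤ κ l' 1 := by rw [(hκ01 l h).2, (hκ01 l' h').2]; exact hll.le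
    obtain ⟨c, hc, hcz⟩ := (isPreconnected_Icc (a := (1 : ℝ)) (b := 2)).intermediate_value₂
      (left_mem_Icc.2 one_le_two) (right_mem_Icc.2 one_le_two) (κ l).continuous.continuousOn
      (κ l').continuous.continuousOn h1 hge
    have := hΛ.eq_of_apply_eq (hκ l) (hκ l') (zero_lt_one.trans_le hc.1).ne
      ((hκ01 l h).1.trans (hκ01 l' h').1.symm) hcz 1
    rw [(hκ01 l h).2, (hκ01 l' h').2] at this
    exact hll.ne this
  have hsurj : Function.Surjective F := by
    intro y
    rcases le_or_gt y 0 with h | h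
    · exact ⟨y, hFneg y h⟩
    obtain ⟨k, hk, hk0, hk2⟩ := hΛ.exists_pair zero_lt_two h
    refine ⟨k 1, ?_⟩
    rw [hFpos, huniq hk hk0, hk2]
    have := k.strictMono zero_lt_one
    rwa [hk0] at this
  have hF : Continuous F := (hmono.orderIsoOfSurjective F hsurj).continuous
  have e1 : 2 * p 1 ≤ F (p 1) := by
    rw [hFpos _ (by linarith), huniq hp hp0]
    have := hpi 1 one_pos zero_lt_one
    norm_num at this
    linarith
  have e2 : F (q 1) ≤ 2 * q 1 := by
    rw [hFpos _ (by linarith), huniq hq hq0]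
    have := hqd 1 one_pos zero_lt_one
    norm_num at this
    linarith
  -- Increasing increments put `F` above `2 l`, decreasing ones below; at a crossing with `l > 1`
  -- the increments over `[0, 1]` and `[1, 2]` coincide.
  obtain ⟨l, hl, hl0⟩ := (isPreconnected_Ioi (a := (1 : ℝ))).intermediate_value₂
    (f := fun l => 2 * l) (g := F) hp1 hq1 (by fun_prop) hF.continuousOn e1 e2
  have hl1 : 1 < l := hl
  obtain ⟨h0, h1⟩ := hκ01 l (by linarith)
  have hnt : ¬ ∀ z, κ l z = z + κ l 0 := by
    intro h
    have := h 1
    rw [h0, h1] at this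
    linarith
  have h2 : 2 * l = κ l 2 := by rw [← hFpos l (by linarith)]; exact hl0
  refine zero_ne_one (hΛ.injective_increment (hκ l) hnt one_ne_zero (?_ : _ = _))
  norm_num [h0, h1, ← h2]
  ring

/-- The translations are the only elements. -/
theorem eq_translation (hΛ : IsSharplyTwoTransitive Λ) {k : ℝ ≃o ℝ} (hk : k ∈ Λ) (z : ℝ) :
    k z = z + k 0 := by
  by_contra hz
  have hkt : ¬ ∀ z, k z = z + k 0 := fun h => hz (h z)
  obtain ⟨k₁, k₂, hk₁, hk₂, hkt₁, hkt₂, hi, hd⟩ : ∃ k₁ k₂ : ℝ ≃o ℝ, k₁ ∈ Λ ∧ k₂ ∈ Λ ∧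
      (¬ ∀ z, k₁ z = z + k₁ 0) ∧ (¬ ∀ z, k₂ z = z + k₂ 0) ∧ IncreasingIncrements k₁ ∧
      DecreasingIncrements k₂ := by
    have hinv : ¬ ∀ z, k.symm z = z + k.symm 0 := by
      intro h
      apply hkt
      have h' : ∀ x, k x = x - k.symm 0 := fun x => by
        have := h (k x)
        rw [OrderIso.symm_apply_apply] at this
        linarith
      intro z
      rw [h' z, h' 0]
      ring
    rcases hΛ.increasing_or_decreasingIncrements hk hkt with h | h
    · exact ⟨k, k.symm, hk, inv_mem hk, hkt, hinv, h, h.symm⟩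
    · exact ⟨k.symm, k, inv_mem hk, hk, hinv, hkt, h.symm, h⟩
  obtain ⟨f₁, hf₁, hf₁', hfi₁⟩ := hΛ.exists_conj hk₁ hkt₁
  obtain ⟨f₂, hf₂, hf₂', hfi₂⟩ := hΛ.exists_conj hk₂ hkt₂
  obtain ⟨p₁, hp₁, hp₁0, hp₁1, hpi₁⟩ := hΛ.sub_const_mem hf₁ hfi₁
  obtain ⟨p₂, hp₂, hp₂0, hp₂1, hpi₂⟩ := hΛ.sub_const_mem hf₂ hfi₂
  -- The displacement of `f₁` at `x` is the unit increment of `k₁.symm` at `k₁ x`, so it decreases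
  -- in `x`; that of `f₂` increases. Thus `p₁.symm` and `p₂` both expand `[0, 1]` with increments of
  -- opposite kinds.
  have h1 : p₁ 1 < 1 := by
    have := hi.symm 1 one_pos (k₁.strictMono zero_lt_one)
    simp only [← hf₁', OrderIso.symm_apply_apply] at this
    linarith
  have h2 : 1 < p₂ 1 := by
    have := hd.symm 1 one_pos (k₂.strictMono zero_lt_one)
    simp only [← hf₂', OrderIso.symm_apply_apply] at this
    linarith
  refine hΛ.not_increasing_and_decreasing hp₂ (inv_mem hp₁) hp₂0 ?_ h2 ?_ hpi₂ hpi₁.symm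
  · change p₁.symm 0 = 0
    rw [OrderIso.symm_apply_eq, hp₁0]
  · change 1 < p₁.symm 1
    rwa [OrderIso.lt_symm_apply]

end IsSharplyTwoTransitive

end

/-! ### No sharply transitive action on tuples of length at least three -/

section

open Set Topology

section LineAction

variable {Γ : Type*} [Group Γ] [MulAction Γ ℝ]

/-- The increasing homeomorphisms of the line induced by a group acting on an interval with a given
coordinate. -/
def lineGroup (c : ℝ → ℝ) (H : Subgroup Γ) : Subgroup (ℝ ≃o ℝ) where
  carrier := {f | ∃ g ∈ H, ∀ x, g • c x = c (f x)}
  one_mem' := ⟨1, one_mem H, fun x => one_smul _ _⟩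
  mul_mem' := by
    rintro f f' ⟨g, hg, h⟩ ⟨g', hg', h'⟩
    exact ⟨g * g', mul_mem hg hg', fun x => by rw [mul_smul, h', h, RelIso.mul_apply]⟩
  inv_mem' := by
    rintro f ⟨g, hg, h⟩
    exact ⟨g⁻¹, inv_mem hg, fun x => by rw [inv_smul_eq_iff, h, RelIso.apply_inv_self]⟩

/-- A coordinate on the half line `(0, ∞)`. -/
structure IsPosCoordinate (c : ℝ → ℝ) : Prop where
  strictMono : StrictMono c
  pos : ∀ x, 0 < c x
  exists_eq : ∀ y, 0 < y → ∃ x, c x = y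

variable {c : ℝ → ℝ}

theorem exists_mem_lineGroup (hmono : ∀ g : Γ, StrictMono fun t : ℝ => g • t)
    (hc : IsPosCoordinate c) {H : Subgroup Γ} {g : Γ} (hg : g ∈ H) (h0 : g • (0 : ℝ) = 0) :
    ∃ f ∈ lineGroup c H, ∀ x, g • c x = c (f x) := by
  have hpos : ∀ g : Γ, g • (0 : ℝ) = 0 → ∀ y : ℝ, 0 < y → 0 < g • y := fun g h0 y hy => by
    have := hmono g hy
    simpa only [h0] using this
  have h0' : g⁻¹ • (0 : ℝ) = 0 := by rw [inv_smul_eq_iff, h0]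
  choose f hf using fun x => hc.exists_eq _ (hpos g h0 _ (hc.pos x))
  choose f' hf' using fun x => hc.exists_eq _ (hpos g⁻¹ h0' _ (hc.pos x))
  have hmf : StrictMono f := fun x y hxy => by
    rw [← hc.strictMono.lt_iff_lt, hf, hf]
    exact hmono g (hc.strictMono hxy)
  have hsurj : Function.Surjective f := fun y =>
    ⟨f' y, hc.strictMono.injective (by rw [hf, hf', smul_inv_smul])⟩
  exact ⟨hmf.orderIsoOfSurjective f hsurj, ⟨g, hg, fun x => (hf x).symm⟩, fun x => (hf x).symm⟩

/-- The set `{0, -1, …, -(n - 1)}`. -/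
noncomputable def negNats (n : ℕ) : Finset ℝ := (Finset.range n).image fun i : ℕ => -(i : ℝ)

theorem mem_negNats {n : ℕ} {x : ℝ} : x ∈ negNats n ↔ ∃ i < n, -(i : ℝ) = x := by
  simp [negNats]

theorem card_negNats (n : ℕ) : (negNats n).card = n := by
  rw [negNats, Finset.card_image_of_injective _ fun i j h => by simpa using h, Finset.card_range]

theorem nonpos_of_mem_negNats {n : ℕ} {x : ℝ} (h : x ∈ negNats n) : x ≤ 0 := by
  obtain ⟨i, -, rfl⟩ := mem_negNats.1 h
  simp

theorem negNats_succ (n : ℕ) : negNats (n + 1) = insert (-(n : ℝ)) (negNats n) := by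
  rw [negNats, negNats, Finset.range_add_one, Finset.image_insert]

theorem card_insert_negNats (n : ℕ) {x : ℝ} (hx : 0 < x) : (insert x (negNats n)).card = n + 1 := by
  rw [Finset.card_insert_of_notMem fun h => (nonpos_of_mem_negNats h).not_gt hx, card_negNats]

theorem card_insert_insert_negNats (n : ℕ) {x y : ℝ} (hx : 0 < x) (hxy : x < y) :
    (insert y (insert x (negNats n))).card = n + 2 := by
  rw [Finset.card_insert_of_notMem, card_insert_negNats n hx]
  rw [Finset.mem_insert, not_or]
  exact ⟨hxy.ne', fun h => (nonpos_of_mem_negNats h).not_gt (hx.trans hxy)⟩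

/-- No group of increasing homeomorphisms of the line is sharply transitive on increasing
`(n + 2)`-tuples with `n ≥ 1`. -/
theorem exists_fixing_of_card (hmono : ∀ g : Γ, StrictMono fun t : ℝ => g • t) {n : ℕ} (hn : 1 ≤ n)
    (hT : ∀ S : Finset ℝ, S.card = n + 2 → ∀ f : ℝ → ℝ, StrictMonoOn f S →
      ∃ g : Γ, ∀ s ∈ S, g • s = f s) :
    ∃ S : Finset ℝ, S.card = n + 2 ∧ ∃ g : Γ, (∀ s ∈ S, g • s = s) ∧ ∃ p : ℝ, g • p ≠ p := by
  by_contra! hs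
  have hinj : ∀ (g : Γ) {x y : ℝ}, g • x = g • y → x = y := fun g x y h => (hmono g).injective h
  have h0n : (0 : ℝ) ∈ negNats n := mem_negNats.2 ⟨0, hn, by simp⟩
  -- two elements agreeing on `n + 2` points are equal
  have hs2 : ∀ S : Finset ℝ, S.card = n + 2 → ∀ g h : Γ, (∀ s ∈ S, g • s = h • s) →
      ∀ p : ℝ, g • p = h • p := by
    intro S hS g h hgh p
    have := hs S hS (h⁻¹ * g) (fun s hs => by rw [mul_smul, hgh s hs, inv_smul_smul]) p
    rwa [mul_smul, inv_smul_eq_iff] at this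
  -- As `n ≥ 1`, elements of `D` fix `0` and act on the positive half line. There `D` is sharply
  -- transitive on increasing pairs, and its subgroup `B`, which also fixes `-n`, is simply
  -- transitive.
  let D : Subgroup Γ := fixingSubgroup Γ (negNats n : Set ℝ)
  have hD : ∀ {g : Γ}, g ∈ D ↔ ∀ s ∈ negNats n, g • s = s := fun {g} => mem_fixingSubgroup_iff Γ
  have hD0 : ∀ {g : Γ}, g ∈ D → g • (0 : ℝ) = 0 := fun hg => hD.1 hg 0 h0n
  let B : Subgroup Γ := fixingSubgroup Γ (negNats (n + 1) : Set ℝ)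
  have hB : ∀ {g : Γ}, g ∈ B ↔ g • (-(n : ℝ)) = -(n : ℝ) ∧ g ∈ D := fun {g} => by
    rw [hD, mem_fixingSubgroup_iff]
    simp [negNats_succ]
  have hBD : ∀ {g : Γ}, g ∈ B → g ∈ D := fun h => (hB.1 h).2
  -- elements of `B` agreeing at a positive point are equal
  have hB2 : ∀ {g h : Γ}, g ∈ B → h ∈ B → ∀ {x : ℝ}, 0 < x → g • x = h • x →
      ∀ p : ℝ, g • p = h • p := by
    intro g h hg hh x hx hgh
    refine hs2 _ (card_insert_negNats (n + 1) hx) g h fun s hs => ?_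
    rcases Finset.mem_insert.1 hs with rfl | hs
    · exact hgh
    · rw [(mem_fixingSubgroup_iff Γ).1 hg s hs, (mem_fixingSubgroup_iff Γ).1 hh s hs]
  have hexp : IsPosCoordinate Real.exp :=
    ⟨Real.exp_strictMono, Real.exp_pos, fun y hy => ⟨Real.log y, Real.exp_log hy⟩⟩
  have hreg : IsRegularOnLine (lineGroup Real.exp B) := by
    constructor
    · intro x y
      obtain ⟨g, hg⟩ := hT _ (card_insert_negNats (n + 1) (Real.exp_pos x))
        (fun t => if t ≤ 0 then t else Real.exp y) (by
          intro s hs t ht hst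
          have hs' := Finset.mem_insert.1 hs
          have ht' := Finset.mem_insert.1 ht
          rcases hs' with rfl | hs'
          · rcases ht' with rfl | ht'
            · exact absurd hst (lt_irrefl _)
            · exact absurd (hst.trans_le (nonpos_of_mem_negNats ht')) (Real.exp_pos x).not_gt
          · have := nonpos_of_mem_negNats hs'
            rcases ht' with rfl | ht'
            · simp only [if_pos this, if_neg (Real.exp_pos x).not_ge]
              exact this.trans_lt (Real.exp_pos y)
            · simp only [if_pos this, if_pos (nonpos_of_mem_negNats ht')]
              exact hst)
      have hgB : g ∈ B := (mem_fixingSubgroup_iff Γ).2 fun s hs => by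
        have := hg s (Finset.mem_insert_of_mem hs)
        rwa [if_pos (nonpos_of_mem_negNats hs)] at this
      obtain ⟨f, hf, hfg⟩ := exists_mem_lineGroup hmono hexp hgB (hD0 (hBD hgB))
      refine ⟨f, hf, Real.exp_injective ?_⟩
      rw [← hfg, hg _ (Finset.mem_insert_self _ _), if_neg (Real.exp_pos x).not_ge]
    · rintro f ⟨g, hg, hgf⟩ x hx
      ext y
      refine Real.exp_injective ?_
      rw [← hgf, hB2 hg (one_mem B) (Real.exp_pos x) (by rw [hgf, hx, one_smul]), one_smul,
        RelIso.one_apply]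
  obtain ⟨φ, hφ⟩ := hreg.exists_coordinate
  have hc : IsPosCoordinate fun x => Real.exp (φ x) :=
    ⟨Real.exp_strictMono.comp φ.strictMono, fun x => Real.exp_pos _, fun y hy =>
      ⟨φ.symm (Real.log y), by simp [Real.exp_log hy]⟩⟩
  set c : ℝ → ℝ := fun x => Real.exp (φ x) with hcdef
  have hB3 : ∀ s, ∃ h ∈ B, ∀ x, h • c x = c (x + s) := by
    intro s
    obtain ⟨a, ⟨g, hg, hga⟩, ha⟩ := hφ s
    exact ⟨g, hg, fun x => by rw [hcdef]; simp only [hga, ha]⟩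
  -- In the Hölder coordinate `c` the elements of `B` are the translations.
  have hΛ : IsSharplyTwoTransitive (lineGroup c D) := by
    constructor
    · intro s
      obtain ⟨h, hh, hhc⟩ := hB3 s
      exact ⟨h, hBD hh, hhc⟩
    · intro x y u v hxy huv
      have hcxy := hc.strictMono hxy
      obtain ⟨g, hg⟩ := hT _ (card_insert_insert_negNats n (hc.pos x) hcxy)
        (fun t => if t ≤ 0 then t else if t ≤ c x then c u else c v) (by
          have h1 : ∀ s ∈ insert (c y) (insert (c x) (negNats n)), s = c y ∨ s = c x ∨ s ≤ 0 := by
            intro s hs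
            rcases Finset.mem_insert.1 hs with rfl | hs
            · exact Or.inl rfl
            rcases Finset.mem_insert.1 hs with rfl | hs
            · exact Or.inr (Or.inl rfl)
            · exact Or.inr (Or.inr (nonpos_of_mem_negNats hs))
          intro s hs t ht hst
          have hx0 := hc.pos x
          have hy0 := hc.pos y
          have hu0 := hc.pos u
          have hv0 := hc.pos v
          have huv' := hc.strictMono huv
          simp only
          rcases h1 s hs with h | h | h <;> rcases h1 t ht with h' | h' | h' <;> split_ifs <;>
            linarith)
      have hgD : g ∈ D := hD.2 fun s hs => by
        have := hg s (Finset.mem_insert_of_mem (Finset.mem_insert_of_mem hs))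
        rwa [if_pos (nonpos_of_mem_negNats hs)] at this
      obtain ⟨f, hf, hfg⟩ := exists_mem_lineGroup hmono hc hgD (hD0 hgD)
      refine ⟨f, hf, hc.strictMono.injective ?_, hc.strictMono.injective ?_⟩
      · rw [← hfg, hg _ (by simp), if_neg (hc.pos x).not_ge, if_pos le_rfl]
      · rw [← hfg, hg _ (by simp), if_neg (hc.pos y).not_ge, if_neg hcxy.not_ge]
    · rintro k ⟨g, hg, hgk⟩ x y hxy hx hy z
      wlog hlt : x < y generalizing x y
      · exact this hxy.symm hy hx (lt_of_le_of_ne (not_lt.1 hlt) hxy.symm)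
      refine hc.strictMono.injective ?_
      rw [← hgk]
      refine hs _ (card_insert_insert_negNats n (hc.pos x) (hc.strictMono hlt)) g (fun s hs => ?_) _
      rcases Finset.mem_insert.1 hs with rfl | hs
      · rw [hgk, hy]
      rcases Finset.mem_insert.1 hs with rfl | hs
      · rw [hgk, hx]
      · exact hD.1 hg s hs
    · rintro k ⟨g, hg, hgk⟩ t ht s hts
      obtain ⟨h, hh, hht⟩ := hB3 t
      obtain ⟨h', hh', hhs⟩ := hB3 s
      have hcomm : ∀ p : ℝ, (g * h) • p = (h' * g) • p := by
        refine hs2 _ (card_insert_insert_negNats n (hc.pos 0) (hc.strictMono one_pos)) _ _ ?_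
        have hc' : ∀ x, (g * h) • c x = (h' * g) • c x := fun x => by
          rw [mul_smul, mul_smul, hht, hgk, hgk, hhs, hts]
        intro p hp
        rcases Finset.mem_insert.1 hp with rfl | hp
        · exact hc' 1
        rcases Finset.mem_insert.1 hp with rfl | hp
        · exact hc' 0
        · rw [mul_smul, mul_smul, hD.1 hg p hp, hD.1 (hBD hh) p hp, hD.1 (hBD hh') p hp,
            hD.1 hg p hp]
      -- Malnormality: `h' = g h g⁻¹` fixes `g • (-n)` besides the points fixed by `B`. If that were
      -- a new point, `h'` would fix `n + 2` points and be trivial. So `g` fixes `-n` and lies in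
      -- `B`.
      have hga : g • (-(n : ℝ)) = -(n : ℝ) := by
        by_contra hne
        have hfix : h' • g • (-(n : ℝ)) = g • (-(n : ℝ)) := by
          rw [← mul_smul, ← hcomm, mul_smul, (hB.1 hh).1]
        have hnot : g • (-(n : ℝ)) ∉ negNats (n + 1) := by
          intro hmem
          rw [negNats_succ] at hmem
          refine (Finset.mem_insert.1 hmem).elim hne fun hmem => ?_
          have := hinj g (hD.1 hg _ hmem)
          rw [this] at hmem
          obtain ⟨i, hi, hin⟩ := mem_negNats.1 hmem
          have : (i : ℝ) = n := neg_injective hin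
          exact hi.ne (Nat.cast_injective this)
        have h1 := hs (insert (g • (-(n : ℝ))) (negNats (n + 1)))
          (by rw [Finset.card_insert_of_notMem hnot, card_negNats]) h' (fun p hp => by
            rcases Finset.mem_insert.1 hp with rfl | hp
            · exact hfix
            · exact (mem_fixingSubgroup_iff Γ).1 hh' p hp) (c (k 0))
        rw [hhs, ← hts] at h1
        have := k.injective (hc.strictMono.injective h1)
        exact ht (by simpa using this)
      have hgB : g ∈ B := hB.2 ⟨hga, hg⟩
      intro z
      obtain ⟨h₀, hh₀, hhr⟩ := hB3 (k 0)
      refine hc.strictMono.injective ?_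
      rw [← hgk, hB2 hgB hh₀ (hc.pos 0) (by rw [hgk, hhr, zero_add]), hhr]
  obtain ⟨k, hk, hk0, hk1⟩ := hΛ.exists_pair (zero_lt_one' ℝ) (zero_lt_two' ℝ)
  have := hΛ.eq_translation hk 1
  rw [hk0, hk1] at this
  norm_num at this

end LineAction

end

/-! ### Gaps of finite sets and absence of fixed points on the right -/

section

open Set Topology MulAction

section FixedPoints

variable {Γ : Type*} [Group Γ] [MulAction Γ ℝ]

/-- The pointwise stabilizer of every set of `m` points moves all points with exactly `j` points of
the set to their left. -/
def MovesGap (Γ : Type*) [Group Γ] [MulAction Γ ℝ] (m j : ℕ) : Prop :=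
  ∀ T : Finset ℝ, T.card = m → ∀ p ∉ T, (T.filter (· < p)).card = j →
    ∃ d : Γ, (∀ t ∈ T, d • t = t) ∧ d • p ≠ p

theorem exists_finset_bounds {F : Set ℝ} (hF : IsClosed F) (p : ℝ) :
    ∃ L : Finset ℝ, (L : Set ℝ) ⊆ F ∧ L.card ≤ 1 ∧ ∀ f ∈ F, f < p → ∃ l ∈ L, f ≤ l ∧ l ≤ p := by
  by_cases hne : (F ∩ Iic p).Nonempty
  · have hb : BddAbove (F ∩ Iic p) := ⟨p, fun x hx => hx.2⟩
    have hmem : sSup (F ∩ Iic p) ∈ F ∩ Iic p := (hF.inter isClosed_Iic).csSup_mem hne hb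
    refine ⟨{sSup (F ∩ Iic p)}, ?_, ?_, fun f hf hfp => ⟨_, Finset.mem_singleton_self _, ?_, hmem.2⟩⟩
    · simpa using hmem.1
    · simp
    · exact le_csSup hb ⟨hf, hfp.le⟩
  · exact ⟨∅, by simp, by simp, fun f hf hfp => (hne ⟨f, hf, hfp.le⟩).elim⟩

theorem exists_finset_bounds' {F : Set ℝ} (hF : IsClosed F) (p : ℝ) :
    ∃ L : Finset ℝ, (L : Set ℝ) ⊆ F ∧ L.card ≤ 1 ∧ ∀ f ∈ F, p < f → ∃ l ∈ L, p ≤ l ∧ l ≤ f := by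
  obtain ⟨L, hL, hc, h⟩ := exists_finset_bounds (F := Neg.neg ⁻¹' F) (hF.preimage continuous_neg) (-p)
  refine ⟨L.image Neg.neg, ?_, Finset.card_image_le.trans hc, fun f hf hpf => ?_⟩
  · rw [Finset.coe_image]
    rintro _ ⟨l, hl, rfl⟩
    exact hL hl
  · obtain ⟨l, hl, h1, h2⟩ := h (-f) (by simpa using hf) (neg_lt_neg hpf)
    exact ⟨-l, Finset.mem_image_of_mem _ hl, by linarith, by linarith⟩

/-- A set of `m ≥ 2` points whose stabilizer moves some point `p₀` may be chosen so that the
stabilizer moves the whole gap around `p₀`. -/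
theorem exists_finset_moves_gap [ContinuousConstSMul Γ ℝ] {T : Finset ℝ} (hT : 2 ≤ T.card) {g : Γ}
    (hg : ∀ t ∈ T, g • t = t) {p₀ : ℝ} (hp₀ : g • p₀ ≠ p₀) :
    ∃ T' : Finset ℝ, T'.card = T.card ∧ ∀ p ∉ T',
      (T'.filter (· < p)).card = (T'.filter (· < p₀)).card →
      ∃ d : Γ, (∀ t ∈ T', d • t = t) ∧ d • p ≠ p := by
  -- `T'` is chosen inside the common fixed set `F` of the stabilizer of `T` and contains the at
  -- most two ends of the gap of `F` around `p₀`. The condition `2 ≤ T.card` leaves room for them.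
  let F : Set ℝ := {x | ∀ d : Γ, (∀ t ∈ T, d • t = t) → d • x = x}
  have hF : IsClosed F := by
    have : F = ⋂ d : Γ, ⋂ _ : ∀ t ∈ T, d • t = t, {x | d • x = x} := by ext; simp [F]
    rw [this]
    exact isClosed_iInter fun d => isClosed_iInter fun _ =>
      isClosed_eq (continuous_const_smul d) continuous_id
  have hTF : (T : Set ℝ) ⊆ F := fun t ht d hd => hd t ht
  have hp₀F : p₀ ∉ F := fun h => hp₀ (h g hg)
  obtain ⟨L, hL, hLc, hL'⟩ := exists_finset_bounds hF p₀
  obtain ⟨R, hR, hRc, hR'⟩ := exists_finset_bounds' hF p₀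
  obtain ⟨T', hLT, hTT, hcard⟩ := Finset.exists_subsuperset_card_eq
    (s := L ∪ R) (t := L ∪ R ∪ T) (n := T.card) Finset.subset_union_left
    ((Finset.card_union_le _ _).trans (by omega)) (Finset.card_le_card Finset.subset_union_right)
  have hT'F : ∀ t ∈ T', t ∈ F := fun t ht => by
    rcases Finset.mem_union.1 (hTT ht) with h | h
    · rcases Finset.mem_union.1 h with h | h
      · exact hL h
      · exact hR h
    · exact hTF h
  refine ⟨T', hcard, fun p hp hidx => ?_⟩
  have hpF : p ∉ F := by
    intro hpF
    have hne : p ≠ p₀ := fun h => hp₀F (h ▸ hpF)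
    rcases lt_or_gt_of_ne hne with h | h
    · obtain ⟨l, hl, h1, h2⟩ := hL' p hpF h
      have hlT : l ∈ T' := hLT (Finset.mem_union_left _ hl)
      have hlp : l < p₀ := lt_of_le_of_ne h2 fun h => hp₀F (h ▸ hL hl)
      have hpl : p < l := lt_of_le_of_ne h1 fun h => hp (h ▸ hlT)
      refine absurd hidx (Finset.card_lt_card ?_).ne
      refine (Finset.ssubset_iff_of_subset ?_).2 ⟨l, ?_, ?_⟩
      · exact Finset.monotone_filter_right _ fun t _ ht => ht.trans h
      · exact Finset.mem_filter.2 ⟨hlT, hlp⟩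
      · exact fun hm => (Finset.mem_filter.1 hm).2.not_gt hpl
    · obtain ⟨r, hr, h1, h2⟩ := hR' p hpF h
      have hrT : r ∈ T' := hLT (Finset.mem_union_right _ hr)
      have hrp : p₀ < r := lt_of_le_of_ne h1 fun h => hp₀F (h ▸ hR hr)
      have hpr : r < p := lt_of_le_of_ne h2 fun h => hp (h ▸ hrT)
      refine absurd hidx (Finset.card_lt_card ?_).ne'
      refine (Finset.ssubset_iff_of_subset ?_).2 ⟨r, ?_, ?_⟩
      · exact Finset.monotone_filter_right _ fun t _ ht => ht.trans h
      · exact Finset.mem_filter.2 ⟨hrT, hpr⟩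
      · exact fun hm => (Finset.mem_filter.1 hm).2.not_gt hrp
  simp only [F, mem_ofPred_eq, not_forall] at hpF
  obtain ⟨d, hd, hdp⟩ := hpF
  exact ⟨d, fun t ht => hT'F t ht d hd, hdp⟩

variable {m : ℕ}

/-- Conjugation by an element carrying one set onto the other preserves the order, hence the index
of a gap. -/
theorem movesGap_of_transitive (hmono : ∀ g : Γ, StrictMono fun t : ℝ => g • t)
    (hT : ∀ x y : Fin m → ℝ, StrictMono x → StrictMono y → ∃ g : Γ, g • x = y)
    {T : Finset ℝ} (hTm : T.card = m) {p₀ : ℝ}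
    (hmove : ∀ p ∉ T, (T.filter (· < p)).card = (T.filter (· < p₀)).card →
      ∃ d : Γ, (∀ t ∈ T, d • t = t) ∧ d • p ≠ p) :
    MovesGap Γ m (T.filter (· < p₀)).card := by
  intro S hS p hp hidx
  obtain ⟨g, hg⟩ := hT (S.orderEmbOfFin hS) (T.orderEmbOfFin hTm) (OrderEmbedding.strictMono _)
    (OrderEmbedding.strictMono _)
  have himg : S.image (fun t => g • t) = T := by
    rw [← Finset.image_orderEmbOfFin_univ S hS, ← Finset.image_orderEmbOfFin_univ T hTm,
      Finset.image_image]
    exact Finset.image_congr fun i _ => congrFun hg i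
  have hfilter : (T.filter (· < g • p)).card = (S.filter (· < p)).card := by
    rw [← himg, Finset.filter_image, Finset.card_image_of_injective _ (hmono g).injective]
    simp only [(hmono g).lt_iff_lt]
  obtain ⟨d, hd, hdp⟩ := hmove (g • p) (by
    rw [← himg, Finset.mem_image]
    rintro ⟨s, hs, hsp⟩
    rw [(hmono g).injective hsp] at hs
    exact hp hs) (hfilter.trans hidx)
  refine ⟨g⁻¹ * d * g, fun s hs => ?_, fun h => hdp ?_⟩
  · rw [mul_smul, mul_smul, hd _ (himg ▸ Finset.mem_image_of_mem (fun t => g • t) hs), inv_smul_smul]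
  · rwa [mul_smul, mul_smul, inv_smul_eq_iff] at h

/-- Conjugation by `t ↦ -1 / t` shifts the gaps. -/
theorem MovesGap.succ
    (haff : ∀ a > 0, ∀ b : ℝ, ∃ g : Γ, ∀ t : ℝ, g • t = a * t + b)
    (hinv : ∀ g : Γ, g • (0 : ℝ) = 0 →
      ∃ g' : Γ, g' • (0 : ℝ) = 0 ∧ ∀ t : ℝ, t ≠ 0 → g' • (-t⁻¹) = -(g • t)⁻¹)
    {j : ℕ} (h : MovesGap Γ m j) : MovesGap Γ m (j + 1) := by
  intro S hS p hp hidx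
  have hSne : S.Nonempty := by
    rw [Finset.nonempty_iff_ne_empty]
    rintro rfl
    simp at hidx
  set μ := S.min' hSne with hμ
  have hμS : μ ∈ S := S.min'_mem hSne
  have hμy : ∀ y ∈ S.erase μ, 0 < y - μ := fun y hy =>
    sub_pos.2 (S.min'_lt_of_mem_erase_min' hSne hy)
  have hμp : μ < p := by
    obtain ⟨y, hy⟩ := Finset.card_pos.1 (by rw [hidx]; exact Nat.succ_pos j)
    obtain ⟨hyS, hyp⟩ := Finset.mem_filter.1 hy
    exact (S.min'_le y hyS).trans_lt hyp
  have hinj : Function.Injective fun y : ℝ => -(y - μ)⁻¹ := fun x y hxy => by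
    simpa using hxy
  have hneg : ∀ y : ℝ, 0 < y - μ → -(y - μ)⁻¹ < 0 := fun y hy => neg_lt_zero.2 (inv_pos.2 hy)
  have h0 : (0 : ℝ) ∉ (S.erase μ).image fun y => -(y - μ)⁻¹ := by
    intro h
    obtain ⟨y, hy, hy0⟩ := Finset.mem_image.1 h
    exact (hneg y (hμy y hy)).ne hy0
  have hpP := hneg p (sub_pos.2 hμp)
  -- The map `y ↦ -1/(y - μ)` sends the smallest point `μ` to infinity and infinity to `0`. The set
  -- keeps its size, and `p` loses exactly one point on its left.
  obtain ⟨d, hd, hdp⟩ := h (insert 0 ((S.erase μ).image fun y => -(y - μ)⁻¹)) (by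
      rw [Finset.card_insert_of_notMem h0, Finset.card_image_of_injective _ hinj,
        Finset.card_erase_add_one hμS, hS]) (-(p - μ)⁻¹) (by
      rw [Finset.mem_insert, not_or]
      refine ⟨hpP.ne, fun hm => ?_⟩
      obtain ⟨y, hy, hyp⟩ := Finset.mem_image.1 hm
      exact hp (hinj hyp ▸ Finset.mem_of_mem_erase hy)) (by
      rw [Finset.filter_insert, if_neg hpP.not_gt, Finset.filter_image,
        Finset.card_image_of_injective _ hinj]
      have : (S.erase μ).filter (fun y => -(y - μ)⁻¹ < -(p - μ)⁻¹) =
          (S.filter (· < p)).erase μ := by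
        ext y
        rw [Finset.mem_filter, Finset.mem_erase, Finset.mem_erase, Finset.mem_filter, and_assoc]
        refine and_congr_right fun h1 => and_congr_right fun h2 => ?_
        rw [neg_lt_neg_iff, inv_lt_inv₀ (sub_pos.2 hμp) (hμy y (Finset.mem_erase.2 ⟨h1, h2⟩)),
          sub_lt_sub_iff_right]
      rw [this, Finset.card_erase_of_mem (Finset.mem_filter.2 ⟨hμS, hμp⟩), hidx]
      rfl)
  obtain ⟨g, hg0, hg⟩ := hinv d (hd 0 (Finset.mem_insert_self _ _))
  obtain ⟨τ, hτ⟩ := haff 1 one_pos μ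
  have hτ' : ∀ t : ℝ, τ⁻¹ • t = t - μ := fun t => by
    rw [inv_smul_eq_iff, hτ]
    ring
  have hgt : ∀ y, 0 < y - μ → g • (y - μ) = -(d • (-(y - μ)⁻¹))⁻¹ := fun y hy => by
    have := hg (-(y - μ)⁻¹) (hneg y hy).ne
    rwa [inv_neg, inv_inv, neg_neg] at this
  refine ⟨τ * g * τ⁻¹, fun y hy => ?_, fun h => hdp ?_⟩
  · rw [mul_smul, mul_smul, hτ']
    by_cases hyμ : y = μ
    · rw [hyμ, sub_self, hg0, hτ]
      ring
    · have hy' : y ∈ S.erase μ := Finset.mem_erase.2 ⟨hyμ, hy⟩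
      rw [hgt y (hμy y hy'), hd _ (Finset.mem_insert_of_mem (Finset.mem_image_of_mem _ hy')),
        inv_neg, inv_inv, neg_neg, hτ]
      ring
  · rw [mul_smul, mul_smul, hτ', hgt p (sub_pos.2 hμp), hτ] at h
    have : (d • (-(p - μ)⁻¹))⁻¹ = -(p - μ) := by linarith
    rw [← inv_inv (d • (-(p - μ)⁻¹)), this, inv_neg]

theorem transitive_finset (hT : ∀ x y : Fin m → ℝ, StrictMono x → StrictMono y → ∃ g : Γ, g • x = y)
    (S : Finset ℝ) (hS : S.card = m) (f : ℝ → ℝ) (hf : StrictMonoOn f S) :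
    ∃ g : Γ, ∀ s ∈ S, g • s = f s := by
  obtain ⟨g, hg⟩ := hT (S.orderEmbOfFin hS) (fun i => f (S.orderEmbOfFin hS i))
    (OrderEmbedding.strictMono _) fun i j hij => hf (S.orderEmbOfFin_mem hS i)
      (S.orderEmbOfFin_mem hS j) ((S.orderEmbOfFin hS).strictMono hij)
  refine ⟨g, fun s hs => ?_⟩
  have : s ∈ range (S.orderEmbOfFin hS) := by rwa [Finset.range_orderEmbOfFin]
  obtain ⟨i, rfl⟩ := this
  exact congrFun hg i

/-- The stabilizer of an increasing tuple has no fixed point to the right of the tuple. -/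
theorem exists_stabilizer_smul_ne [ContinuousConstSMul Γ ℝ]
    (hmono : ∀ g : Γ, StrictMono fun t : ℝ => g • t)
    (haff : ∀ a > 0, ∀ b : ℝ, ∃ g : Γ, ∀ t : ℝ, g • t = a * t + b)
    (hinv : ∀ g : Γ, g • (0 : ℝ) = 0 →
      ∃ g' : Γ, g' • (0 : ℝ) = 0 ∧ ∀ t : ℝ, t ≠ 0 → g' • (-t⁻¹) = -(g • t)⁻¹)
    (hnon : ∃ g : Γ, g • (0 : ℝ) = 0 ∧ g • (1 : ℝ) = 1 ∧ ∃ t : ℝ, g • t ≠ t)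
    (hT : ∀ x y : Fin m → ℝ, StrictMono x → StrictMono y → ∃ g : Γ, g • x = y)
    {w : Fin m → ℝ} (hw : StrictMono w) {z : ℝ} (hz : ∀ i, w i < z) :
    ∃ d ∈ stabilizer Γ w, d • z ≠ z := by
  -- With at most one point, a dilation centred there, or left of `z` if there is none, moves `z`.
  by_cases hm : m < 2
  · obtain ⟨c, hc, hcw⟩ : ∃ c, c < z ∧ ∀ i, w i = c := by
      interval_cases m
      · exact ⟨z - 1, by linarith, fun i => i.elim0⟩
      · exact ⟨w 0, hz 0, fun i => by rw [Subsingleton.elim i 0]⟩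
    obtain ⟨d, hd⟩ := haff 2 two_pos (-c)
    refine ⟨d, funext fun i => ?_, ?_⟩
    · rw [Pi.smul_apply, hcw, hd]
      ring
    · rw [hd]
      intro h
      linarith
  obtain ⟨n, rfl⟩ : ∃ n, m = n + 2 := ⟨m - 2, by omega⟩
  obtain ⟨S, hS, g, hg, p₀, hp₀⟩ : ∃ S : Finset ℝ, S.card = n + 2 ∧
      ∃ g : Γ, (∀ s ∈ S, g • s = s) ∧ ∃ p : ℝ, g • p ≠ p := by
    rcases Nat.eq_zero_or_pos n with rfl | hn
    · obtain ⟨g, h0, h1, h⟩ := hnon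
      exact ⟨{0, 1}, by simp, g, by simp [h0, h1], h⟩
    · exact exists_fixing_of_card hmono hn (transitive_finset hT)
  obtain ⟨T, hTS, hmove⟩ := exists_finset_moves_gap (by omega) hg hp₀
  have h0 := movesGap_of_transitive hmono hT (hTS.trans hS) hmove
  have hle : (T.filter (· < p₀)).card ≤ n + 2 := by
    rw [← hS, ← hTS]
    exact Finset.card_filter_le _ _
  -- Shift from the gap found to the unbounded one on the right, whose index is the number of
  -- points.
  have hfree : MovesGap Γ (n + 2) (n + 2) :=
    Nat.le_induction (m := (T.filter (· < p₀)).card) (P := fun k _ => MovesGap Γ (n + 2) k) h0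
      (fun k _ hk => hk.succ haff hinv) (n + 2) hle
  have hcard : (Finset.univ.image w).card = n + 2 := by
    rw [Finset.card_image_of_injective _ hw.injective, Finset.card_univ, Fintype.card_fin]
  obtain ⟨d, hd, hdz⟩ := hfree (Finset.univ.image w) hcard z (by
    rw [Finset.mem_image]
    rintro ⟨i, -, hi⟩
    exact (hz i).ne hi) (by
    rw [Finset.filter_true_of_mem, hcard]
    intro x hx
    obtain ⟨i, -, rfl⟩ := Finset.mem_image.1 hx
    exact hz i)
  exact ⟨d, funext fun i => hd _ (Finset.mem_image_of_mem _ (Finset.mem_univ i)), hdz⟩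

end FixedPoints

/-- A path-connected group of increasing homeomorphisms of the line which properly contains the
affine group, and whose stabilizer of `0` is normalized by `t ↦ -1 / t`, is transitive on increasing
tuples of every length. -/
theorem exists_smul_eq_of_strictMono {Γ : Type*} [Group Γ] [TopologicalSpace Γ]
    [IsTopologicalGroup Γ] [PathConnectedSpace Γ] [MulAction Γ ℝ] [ContinuousSMul Γ ℝ]
    (hmono : ∀ g : Γ, StrictMono fun t : ℝ => g • t)
    (haff : ∀ a > 0, ∀ b : ℝ, ∃ g : Γ, ∀ t : ℝ, g • t = a * t + b)
    (hinv : ∀ g : Γ, g • (0 : ℝ) = 0 →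
      ∃ g' : Γ, g' • (0 : ℝ) = 0 ∧ ∀ t : ℝ, t ≠ 0 → g' • (-t⁻¹) = -(g • t)⁻¹)
    (hnon : ∃ g : Γ, g • (0 : ℝ) = 0 ∧ g • (1 : ℝ) = 1 ∧ ∃ t : ℝ, g • t ≠ t)
    {m : ℕ} {x y : Fin m → ℝ} (hx : StrictMono x) (hy : StrictMono y) : ∃ g : Γ, g • x = y :=
  exists_smul_eq_of_no_fixed_point hmono
    (fun _ hT _ hw _ hz => exists_stabilizer_smul_ne hmono haff hinv hnon hT hw hz) m hx hy

end

/-! ### Möbius maps and rotations in the Cayley coordinate -/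

section

open Set Topology
open scoped MatrixGroups

/-- The inverse Cayley transform `t ↦ (t - i) / (t + i)`. -/
noncomputable def lineToCircle (t : ℝ) : Circle :=
  Circle.ofConjDivSelf ((t : ℂ) + Complex.I) (ofReal_add_I_ne_zero t)

/-- The Cayley transform `z ↦ i (1 + z) / (1 - z)`, with real values on the circle. -/
noncomputable def circleToLine (z : Circle) : ℝ := (Complex.I * (1 + z) / (1 - z)).re

theorem cayley_symm_coe (t : ℝ) : cayley.symm (t : OnePoint ℝ) = lineToCircle t := rfl

theorem cayley_symm_infty : cayley.symm OnePoint.infty = 1 := rfl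

theorem cayley_lineToCircle (t : ℝ) : cayley (lineToCircle t) = (t : OnePoint ℝ) := by
  rw [← cayley_symm_coe, Equiv.apply_symm_apply]

theorem cayley_one : cayley 1 = OnePoint.infty := by
  rw [← cayley_symm_infty, Equiv.apply_symm_apply]

theorem lineToCircle_injective : Function.Injective lineToCircle := fun s t h => by
  have := congrArg cayley h
  rwa [cayley_lineToCircle, cayley_lineToCircle, OnePoint.coe_eq_coe] at this

theorem lineToCircle_ne_one (t : ℝ) : lineToCircle t ≠ 1 := fun h => by
  have := congrArg cayley h
  rw [cayley_lineToCircle, cayley_one] at this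
  exact OnePoint.coe_ne_infty t this

theorem cayley_of_ne_one {z : Circle} (hz : z ≠ 1) : cayley z = (circleToLine z : OnePoint ℝ) :=
  if_neg hz

theorem lineToCircle_circleToLine {z : Circle} (hz : z ≠ 1) : lineToCircle (circleToLine z) = z := by
  rw [← cayley_symm_coe, ← cayley_of_ne_one hz, Equiv.symm_apply_apply]

theorem circleToLine_lineToCircle (t : ℝ) : circleToLine (lineToCircle t) = t :=
  lineToCircle_injective (lineToCircle_circleToLine (lineToCircle_ne_one t))

theorem coe_lineToCircle (t : ℝ) :
    (lineToCircle t : ℂ) = (t - Complex.I) / (t + Complex.I) := by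
  simp [lineToCircle, Circle.ofConjDivSelf_coe, sub_eq_add_neg]

theorem continuousOn_circleToLine : ContinuousOn circleToLine {1}ᶜ := by
  refine Complex.continuous_re.comp_continuousOn (ContinuousOn.div ?_ ?_ fun z hz h => hz ?_)
  · fun_prop
  · fun_prop
  · exact Circle.ext (by simpa using (sub_eq_zero.1 h).symm)

theorem lineToCircle_eq_exp (t : ℝ) :
    lineToCircle t = Circle.exp (Real.pi + 2 * Real.arctan t) := by
  apply Circle.ext
  rw [coe_lineToCircle, Circle.coe_exp, Complex.exp_mul_I, div_eq_iff (ofReal_add_I_ne_zero t)]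
  have hc : Real.cos (Real.pi + 2 * Real.arctan t) = (t ^ 2 - 1) / (1 + t ^ 2) := by
    rw [add_comm, Real.cos_add_pi, Real.cos_two_mul, Real.cos_sq_arctan]
    have : (1 + t ^ 2) ≠ 0 := by positivity
    field_simp
    ring
  have hs : Real.sin (Real.pi + 2 * Real.arctan t) = -(2 * t) / (1 + t ^ 2) := by
    rw [add_comm, Real.sin_add_pi, Real.sin_two_mul]
    have h1 : Real.sin (Real.arctan t) = t * Real.cos (Real.arctan t) := by
      rw [Real.sin_arctan, Real.cos_arctan]
      ring
    have h2 := Real.cos_sq_arctan t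
    rw [h1]
    have : -(2 * (t * Real.cos (Real.arctan t)) * Real.cos (Real.arctan t)) =
        -(2 * t) * Real.cos (Real.arctan t) ^ 2 := by ring
    rw [this, h2]
    ring
  rw [← Complex.ofReal_cos, ← Complex.ofReal_sin, hc, hs]
  have h0 : (1 + (t : ℂ) ^ 2) ≠ 0 := by
    have : (1 + t ^ 2) ≠ 0 := by positivity
    exact_mod_cast this
  push_cast
  field_simp
  linear_combination (2 * (t : ℂ)) * Complex.I_sq

theorem continuous_lineToCircle : Continuous lineToCircle := by
  have : lineToCircle = fun t => Circle.exp (Real.pi + 2 * Real.arctan t) :=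
    funext lineToCircle_eq_exp
  rw [this]
  exact Circle.exp.continuous.comp
    (continuous_const.add (continuous_const.mul Real.continuous_arctan))

theorem lineToCircle_neg_inv {t : ℝ} (ht : t ≠ 0) : lineToCircle (-t⁻¹) = -lineToCircle t := by
  apply Circle.ext
  have h1 := ofReal_add_I_ne_zero t
  have h2 := ofReal_add_I_ne_zero (-t⁻¹)
  have ht' : (t : ℂ) ≠ 0 := Complex.ofReal_ne_zero.2 ht
  have hneg : ((-lineToCircle t : Circle) : ℂ) = -(lineToCircle t : ℂ) := rfl
  rw [hneg, coe_lineToCircle, coe_lineToCircle, ← neg_div, div_eq_div_iff h2 h1]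
  push_cast
  field_simp
  linear_combination (-2 * (t : ℂ)) * Complex.I_sq

theorem SpecialLinearGroup.smul_coe_eq_ite (A : SL(2, ℝ)) (t : ℝ) :
    (A : GL (Fin 2) ℝ) • (t : OnePoint ℝ) =
      if A 1 0 * t + A 1 1 = 0 then OnePoint.infty
      else (((A 0 0 * t + A 0 1) / (A 1 0 * t + A 1 1) : ℝ) : OnePoint ℝ) := by
  have h := OnePoint.smul_some_eq_ite (g := (A : GL (Fin 2) ℝ)) (k := t)
  convert h <;> rfl

theorem SpecialLinearGroup.smul_infty_eq_ite (A : SL(2, ℝ)) :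
    (A : GL (Fin 2) ℝ) • (OnePoint.infty : OnePoint ℝ) =
      if A 1 0 = 0 then OnePoint.infty else ((A 0 0 / A 1 0 : ℝ) : OnePoint ℝ) := by
  have h := OnePoint.smul_infty_eq_ite (A : GL (Fin 2) ℝ)
  convert h <;> rfl

theorem SpecialLinearGroup.det_eq (A : SL(2, ℝ)) : A 0 0 * A 1 1 - A 0 1 * A 1 0 = 1 := by
  rw [← Matrix.det_fin_two]
  exact A.2

/-- The point of the circle with homogeneous coordinate `[x : y]`. -/
theorem coe_lineToCircle_div {x y : ℝ} (hy : y ≠ 0) :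
    (lineToCircle (x / y) : ℂ) = (x - Complex.I * y) / (x + Complex.I * y) := by
  have hy' : (y : ℂ) ≠ 0 := Complex.ofReal_ne_zero.2 hy
  have h1 := ofReal_add_I_ne_zero (x / y)
  rw [coe_lineToCircle]
  push_cast at h1 ⊢
  have h2 : (x : ℂ) + Complex.I * y ≠ 0 := by
    intro h
    apply h1
    field_simp
    linear_combination h
  rw [div_eq_div_iff h1 h2]
  field_simp

/-- Homogeneous coordinates absorb the case of image `∞`: if `A 1 0 * t + A 1 1 = 0`, the quotient
is `1`. -/
theorem coe_cayley_symm_smul (A : SL(2, ℝ)) (t : ℝ) :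
    (cayley.symm ((A : GL (Fin 2) ℝ) • (t : OnePoint ℝ)) : ℂ) =
      ((A 0 0 * t + A 0 1) - Complex.I * (A 1 0 * t + A 1 1)) /
        ((A 0 0 * t + A 0 1) + Complex.I * (A 1 0 * t + A 1 1)) := by
  rw [SpecialLinearGroup.smul_coe_eq_ite]
  split_ifs with h
  · have h' : ((A 1 0 : ℂ) * t + A 1 1) = 0 := by exact_mod_cast h
    have h2 : (A 0 0 : ℂ) * t + A 0 1 ≠ 0 := by
      intro h3
      have h3' : A 0 0 * t + A 0 1 = 0 := by exact_mod_cast h3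
      have h4 : A 0 0 * t = -A 0 1 := by linarith
      have h5 : A 1 0 * t = -A 1 1 := by linarith
      have h6 := SpecialLinearGroup.det_eq A
      have h7 : (A 0 0 * A 1 1 - A 0 1 * A 1 0) * t = 0 := by
        linear_combination A 1 1 * h4 - A 0 1 * h5
      rw [h6, one_mul] at h7
      rw [h7, mul_zero] at h4 h5
      have h8 : A 0 1 = 0 := by linarith
      have h9 : A 1 1 = 0 := by linarith
      rw [h8, h9] at h6
      norm_num at h6
    rw [h', mul_zero, sub_zero, add_zero, div_self h2, cayley_symm_infty, Circle.coe_one]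
  · rw [cayley_symm_coe, coe_lineToCircle_div h]
    push_cast
    rfl

theorem coe_cayley_symm_smul_infty (A : SL(2, ℝ)) :
    (cayley.symm ((A : GL (Fin 2) ℝ) • (OnePoint.infty : OnePoint ℝ)) : ℂ) =
      (A 0 0 - Complex.I * A 1 0) / (A 0 0 + Complex.I * A 1 0) := by
  rw [SpecialLinearGroup.smul_infty_eq_ite]
  split_ifs with h
  · have h2 : (A 0 0 : ℂ) ≠ 0 := by
      intro h3
      have h3' : A 0 0 = 0 := by exact_mod_cast h3
      have h6 := SpecialLinearGroup.det_eq A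
      rw [h, h3'] at h6
      norm_num at h6
    rw [h, Complex.ofReal_zero, mul_zero, sub_zero, add_zero, div_self h2, cayley_symm_infty,
      Circle.coe_one]
  · rw [cayley_symm_coe, coe_lineToCircle_div h]

/-- Rotations of the circle. -/
noncomputable def rotationHomeo (w : Circle) : HomeoPlus :=
  ⟨Homeomorph.mulLeft w, ⟨OrderIso.addLeft (Complex.arg w), fun t => by
    change w * Circle.exp t = Circle.exp (Complex.arg w + t)
    rw [Circle.exp_add, Circle.exp_arg]⟩⟩

theorem rotationHomeo_apply (w z : Circle) : (rotationHomeo w : Circle ≃ₜ Circle) z = w * z := rfl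

theorem rotationHomeo_mem (w : Circle) : rotationHomeo w ∈ PSL2R := by
  -- The rotation of the circle by an angle acts on the projective line as the rotation matrix by
  -- half of it, up to sign.
  set α : ℝ := -(Complex.arg w) / 2 with hα
  have hw : (w : ℂ) * (Complex.cos α + Complex.I * Complex.sin α) =
      Complex.cos α - Complex.I * Complex.sin α := by
    have h1 : (w : ℂ) = Complex.exp (-(α : ℂ) * Complex.I) * Complex.exp (-(α : ℂ) * Complex.I) := by
      rw [← Complex.exp_add]
      nth_rw 1 [← Circle.exp_arg w]
      rw [Circle.coe_exp]
      congr 1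
      have h : (α : ℂ) = -(Complex.arg w : ℂ) / 2 := by
        rw [hα]
        push_cast
        rfl
      linear_combination (2 * Complex.I) * h
    have h2 : Complex.cos α + Complex.I * Complex.sin α = Complex.exp (α * Complex.I) := by
      rw [Complex.exp_mul_I]
      ring
    have h3 : Complex.cos α - Complex.I * Complex.sin α = Complex.exp (-(α : ℂ) * Complex.I) := by
      rw [Complex.exp_mul_I, Complex.cos_neg, Complex.sin_neg]
      ring
    rw [h1, h2, h3, mul_assoc, ← Complex.exp_add, neg_mul, neg_add_cancel, Complex.exp_zero,
      mul_one]
  let A : SL(2, ℝ) := ⟨!![Real.cos α, -Real.sin α; Real.sin α, Real.cos α], by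
    rw [Matrix.det_fin_two_of]
    linear_combination Real.cos_sq_add_sin_sq α⟩
  have e00 : A 0 0 = Real.cos α := rfl
  have e01 : A 0 1 = -Real.sin α := rfl
  have e10 : A 1 0 = Real.sin α := rfl
  have e11 : A 1 1 = Real.cos α := rfl
  have hne : Complex.cos α + Complex.I * Complex.sin α ≠ 0 := by
    intro h
    have h2 : Complex.cos α - Complex.I * Complex.sin α = 0 := by rw [← hw, h, mul_zero]
    have h3 := Complex.cos_sq_add_sin_sq α
    have : (Complex.cos α + Complex.I * Complex.sin α) *
        (Complex.cos α - Complex.I * Complex.sin α) = 1 := by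
      linear_combination h3 - Complex.sin α ^ 2 * Complex.I_sq
    rw [h, zero_mul] at this
    exact zero_ne_one this
  refine ⟨A, fun z => ?_⟩
  apply cayley.symm.injective
  rw [Equiv.symm_apply_apply, rotationHomeo_apply]
  obtain ⟨x, rfl⟩ := cayley.symm.surjective z
  rw [Equiv.apply_symm_apply]
  apply Circle.ext
  rw [Circle.coe_mul]
  induction x using OnePoint.rec with
  | infty =>
    rw [coe_cayley_symm_smul_infty, e00, e10, cayley_symm_infty, Circle.coe_one, mul_one]
    push_cast
    rw [eq_div_iff hne, hw]
  | coe t =>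
    rw [coe_cayley_symm_smul, e00, e01, e10, e11, cayley_symm_coe, coe_lineToCircle]
    push_cast
    have h1 := ofReal_add_I_ne_zero t
    have h4 : Complex.cos α * t + -Complex.sin α + Complex.I * (Complex.sin α * t + Complex.cos α) =
        (Complex.cos α + Complex.I * Complex.sin α) * (t + Complex.I) := by
      linear_combination -Complex.sin α * Complex.I_sq
    have h5 : Complex.cos α * t + -Complex.sin α - Complex.I * (Complex.sin α * t + Complex.cos α) =
        (Complex.cos α - Complex.I * Complex.sin α) * (t - Complex.I) := by
      linear_combination -Complex.sin α * Complex.I_sq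
    rw [h4, h5, ← hw]
    field_simp

end

/-! ### The topological group `HomeoPlus` and the action of `fixOne` on the line -/

section

open Set Topology

instance : IsTopologicalGroup (Circle ≃ₜ Circle) := by
  have hind : Topology.IsInducing fun f : Circle ≃ₜ Circle =>
      ((f : C(Circle, Circle)), (f.symm : C(Circle, Circle))) := ⟨rfl⟩
  have h1 : Continuous fun f : Circle ≃ₜ Circle => (f : C(Circle, Circle)) :=
    continuous_fst.comp hind.continuous
  have h2 : Continuous fun f : Circle ≃ₜ Circle => (f.symm : C(Circle, Circle)) :=
    continuous_snd.comp hind.continuous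
  refine { continuous_mul := ?_, continuous_inv := ?_ }
  · refine hind.continuous_iff.2 (Continuous.prodMk ?_ ?_)
    · exact (h1.comp continuous_fst).compCM (h1.comp continuous_snd)
    · exact (h2.comp continuous_snd).compCM (h2.comp continuous_fst)
  · exact hind.continuous_iff.2 (h2.prodMk h1)

theorem continuous_homeoPlus_eval :
    Continuous fun p : HomeoPlus × Circle => (p.1 : Circle ≃ₜ Circle) p.2 := by
  have h1 : Continuous fun f : HomeoPlus => ((f : Circle ≃ₜ Circle) : C(Circle, Circle)) :=
    (continuous_fst.comp (continuous_induced_dom (f := fun f : Circle ≃ₜ Circle =>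
      ((f : C(Circle, Circle)), (f.symm : C(Circle, Circle)))))).comp continuous_subtype_val
  exact (h1.comp continuous_fst).eval continuous_snd

theorem continuous_homeoPlus_of_uncurry {X : Type*} [TopologicalSpace X] {f : X → HomeoPlus}
    (h : Continuous fun p : X × Circle => (f p.1 : Circle ≃ₜ Circle) p.2)
    (h' : Continuous fun p : X × Circle => (f p.1 : Circle ≃ₜ Circle).symm p.2) :
    Continuous f := by
  refine Continuous.subtype_mk (f := fun x => (f x : Circle ≃ₜ Circle)) ?_ _
  refine continuous_induced_rng.2 (Continuous.prodMk ?_ ?_)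
  · exact ContinuousMap.continuous_of_continuous_uncurry _ h
  · exact ContinuousMap.continuous_of_continuous_uncurry _ h'

theorem continuous_rotationHomeo : Continuous rotationHomeo := by
  refine continuous_homeoPlus_of_uncurry ?_ ?_
  · exact continuous_fst.mul continuous_snd
  · exact continuous_fst.inv.mul continuous_snd

section Lift

open Real

/-- A homeomorphism fixing `1` has a lift fixing `0` and `2π`. -/
theorem exists_lift (g : HomeoPlus) (hg : (g : Circle ≃ₜ Circle) 1 = 1) :
    ∃ F : ℝ ≃o ℝ, (∀ t, (g : Circle ≃ₜ Circle) (Circle.exp t) = Circle.exp (F t)) ∧ F 0 = 0 ∧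
      F (2 * π) = 2 * π := by
  obtain ⟨F, hF⟩ := g.2
  obtain ⟨k, hk⟩ := Circle.exp_eq_one.1 (by rw [← hF, Circle.exp_zero, hg] : Circle.exp (F 0) = 1)
  let F' : ℝ ≃o ℝ := F.trans (OrderIso.addRight (-F 0))
  have hF' : ∀ t, F' t = F t - F 0 := fun t => (sub_eq_add_neg _ _).symm
  have hexp : ∀ t, (g : Circle ≃ₜ Circle) (Circle.exp t) = Circle.exp (F' t) := fun t => by
    rw [hF, hF', Circle.exp_sub, hk, Circle.exp_int_mul_two_pi, div_one]
  have h0 : F' 0 = 0 := by rw [hF', sub_self]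
  refine ⟨F', hexp, h0, ?_⟩
  obtain ⟨n, hn⟩ := Circle.exp_eq_one.1
    (by rw [← hexp, Circle.exp_two_pi, hg] : Circle.exp (F' (2 * π)) = 1)
  have hpos : 0 < F' (2 * π) := by
    have := F'.strictMono two_pi_pos
    rwa [h0] at this
  -- Otherwise the lift reaches `2π` at an interior point, and a second point of the circle is sent
  -- to `1`.
  have hle : F' (2 * π) ≤ 2 * π := by
    by_contra! hlt
    have h1 : F'.symm (2 * π) < 2 * π := by rwa [OrderIso.symm_apply_lt]
    have h2 : 0 < F'.symm (2 * π) := by rw [OrderIso.lt_symm_apply, h0]; exact two_pi_pos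
    have h3 : (g : Circle ≃ₜ Circle) (Circle.exp (F'.symm (2 * π))) =
        (g : Circle ≃ₜ Circle) (Circle.exp 0) := by
      rw [hexp, OrderIso.apply_symm_apply, Circle.exp_two_pi, Circle.exp_zero, hg]
    obtain ⟨l, hl⟩ := Circle.exp_eq_exp.1 ((g : Circle ≃ₜ Circle).injective h3)
    rw [hl, zero_add] at h1 h2
    have h4 : (0 : ℝ) < l := (mul_pos_iff_of_pos_right two_pi_pos).1 h2
    have h5 : (l : ℝ) < 1 := by nlinarith [two_pi_pos]
    have h4' : 0 < l := by exact_mod_cast h4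
    have h5' : l < 1 := by exact_mod_cast h5
    omega
  rw [hn] at hpos hle ⊢
  have h4 : (0 : ℝ) < n := (mul_pos_iff_of_pos_right two_pi_pos).1 hpos
  have h5 : (n : ℝ) ≤ 1 := by nlinarith [two_pi_pos]
  have h4' : 0 < n := by exact_mod_cast h4
  have h5' : n ≤ 1 := by exact_mod_cast h5
  have : n = 1 := by omega
  rw [this, Int.cast_one, one_mul]

/-- The angle of the point of the circle with Cayley coordinate `t`. -/
noncomputable def lineAngle (t : ℝ) : ℝ := π + 2 * arctan t

theorem exp_lineAngle (t : ℝ) : Circle.exp (lineAngle t) = lineToCircle t :=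
  (lineToCircle_eq_exp t).symm

theorem lineAngle_strictMono : StrictMono lineAngle := fun s t h => by
  have := arctan_strictMono h
  rw [lineAngle, lineAngle]
  linarith

theorem lineAngle_mem (t : ℝ) : lineAngle t ∈ Ioo 0 (2 * π) := by
  have h1 := neg_pi_div_two_lt_arctan t
  have h2 := arctan_lt_pi_div_two t
  rw [lineAngle]
  constructor <;> linarith

theorem exists_lineAngle_eq {x : ℝ} (hx : x ∈ Ioo 0 (2 * π)) : ∃ t, lineAngle t = x := by
  refine ⟨tan ((x - π) / 2), ?_⟩
  rw [lineAngle, arctan_tan (by linarith [hx.1]) (by linarith [hx.2])]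
  ring

theorem lineAngle_circleToLine_exp {x : ℝ} (hx : x ∈ Ioo 0 (2 * π)) :
    lineAngle (circleToLine (Circle.exp x)) = x := by
  obtain ⟨t, rfl⟩ := exists_lineAngle_eq hx
  rw [exp_lineAngle, circleToLine_lineToCircle]

end Lift

/-- The homeomorphisms of the circle which fix `1`. -/
def fixOne : Subgroup HomeoPlus where
  carrier := {g | (g : Circle ≃ₜ Circle) 1 = 1}
  one_mem' := rfl
  mul_mem' := fun {f g} hf hg => by
    change (f : Circle ≃ₜ Circle) ((g : Circle ≃ₜ Circle) 1) = 1
    rw [hg, hf]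
  inv_mem' := fun {f} hf => by
    change (f : Circle ≃ₜ Circle).symm 1 = 1
    rw [Homeomorph.symm_apply_eq]
    exact hf.symm

theorem apply_lineToCircle_ne_one {g : HomeoPlus} (hg : g ∈ fixOne) (t : ℝ) :
    (g : Circle ≃ₜ Circle) (lineToCircle t) ≠ 1 := fun h =>
  lineToCircle_ne_one t ((g : Circle ≃ₜ Circle).injective (h.trans (Eq.symm hg)))

noncomputable instance : SMul fixOne ℝ :=
  ⟨fun g t => circleToLine (((g : HomeoPlus) : Circle ≃ₜ Circle) (lineToCircle t))⟩

theorem lineToCircle_smul (g : fixOne) (t : ℝ) :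
    lineToCircle (g • t) = ((g : HomeoPlus) : Circle ≃ₜ Circle) (lineToCircle t) :=
  lineToCircle_circleToLine (apply_lineToCircle_ne_one g.2 t)

noncomputable instance : MulAction fixOne ℝ where
  one_smul t := lineToCircle_injective (lineToCircle_smul 1 t)
  mul_smul g h t := lineToCircle_injective (by
    rw [lineToCircle_smul, lineToCircle_smul, lineToCircle_smul]
    rfl)

instance : ContinuousSMul fixOne ℝ := by
  refine ⟨continuousOn_circleToLine.comp_continuous (f := fun p : fixOne × ℝ =>
    ((p.1 : HomeoPlus) : Circle ≃ₜ Circle) (lineToCircle p.2)) ?_ fun p =>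
      apply_lineToCircle_ne_one p.1.2 p.2⟩
  exact continuous_homeoPlus_eval.comp ((continuous_subtype_val.comp continuous_fst).prodMk
    (continuous_lineToCircle.comp continuous_snd))

theorem lineAngle_smul (g : fixOne) {F : ℝ ≃o ℝ}
    (hF : ∀ t, ((g : HomeoPlus) : Circle ≃ₜ Circle) (Circle.exp t) = Circle.exp (F t))
    (h0 : F 0 = 0) (h1 : F (2 * Real.pi) = 2 * Real.pi) (t : ℝ) :
    lineAngle (g • t) = F (lineAngle t) := by
  have hmem : F (lineAngle t) ∈ Ioo 0 (2 * Real.pi) :=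
    ⟨h0 ▸ F.strictMono (lineAngle_mem t).1, h1 ▸ F.strictMono (lineAngle_mem t).2⟩
  rw [← lineAngle_circleToLine_exp hmem, ← hF, exp_lineAngle]
  rfl

theorem smul_strictMono (g : fixOne) : StrictMono fun t : ℝ => g • t := by
  obtain ⟨F, hF, h0, h1⟩ := exists_lift g g.2
  intro s t hst
  rw [← lineAngle_strictMono.lt_iff_lt, lineAngle_smul g hF h0 h1, lineAngle_smul g hF h0 h1]
  exact F.strictMono (lineAngle_strictMono hst)

theorem fixOne_ext {g h : fixOne} (hgh : ∀ t : ℝ, g • t = h • t) : g = h := by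
  apply Subtype.ext
  apply Subtype.ext
  apply Homeomorph.ext
  intro z
  by_cases hz : z = 1
  · rw [hz]
    exact g.2.trans (Eq.symm h.2)
  · rw [← lineToCircle_circleToLine hz, ← lineToCircle_smul, ← lineToCircle_smul, hgh]

end

/-! ### Extending line homeomorphisms; `PSL2R` is closed and proper -/

section

open Set Topology
open scoped MatrixGroups

/-- An increasing bijection of `[0, p)` extends to an increasing bijection of the line commuting with
the translation by `p`. -/
theorem exists_periodic_orderIso {p : ℝ} (hp : 0 < p) {h : ℝ → ℝ} (hmono : StrictMonoOn h (Ico 0 p))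
    (hmaps : MapsTo h (Ico 0 p) (Ico 0 p)) (hsurj : SurjOn h (Ico 0 p) (Ico 0 p)) :
    ∃ F : ℝ ≃o ℝ, ∀ x, ∃ n : ℤ, ∃ y ∈ Ico 0 p, x = y + n * p ∧ F x = h y + n * p := by
  have hfr : ∀ x : ℝ, x - ⌊x / p⌋ * p ∈ Ico 0 p := by
    intro x
    have h1 := Int.floor_le (x / p)
    have h2 := Int.lt_floor_add_one (x / p)
    rw [le_div_iff₀ hp] at h1
    rw [div_lt_iff₀ hp] at h2
    constructor <;> linarith
  let f : ℝ → ℝ := fun x => h (x - ⌊x / p⌋ * p) + ⌊x / p⌋ * p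
  have hf : StrictMono f := by
    intro x x' hx
    have h1 := hfr x
    have h2 := hfr x'
    have hle : ⌊x / p⌋ ≤ ⌊x' / p⌋ := Int.floor_mono (by gcongr)
    change h _ + _ < h _ + _
    rcases hle.eq_or_lt with he | hlt
    · rw [he] at h1 ⊢
      have := hmono h1 h2 (by linarith)
      linarith
    · have h3 := (hmaps h1).2
      have h4 := (hmaps h2).1
      have h5 : (⌊x / p⌋ : ℝ) + 1 ≤ ⌊x' / p⌋ := by exact_mod_cast hlt
      nlinarith
  have hs : Function.Surjective f := by
    intro v
    obtain ⟨y, hy, hyv⟩ := hsurj (hfr v)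
    refine ⟨y + ⌊v / p⌋ * p, ?_⟩
    have hfl : ⌊(y + ⌊v / p⌋ * p) / p⌋ = ⌊v / p⌋ := by
      rw [add_div, mul_div_cancel_right₀ _ hp.ne', Int.floor_add_intCast,
        Int.floor_eq_zero_iff.2 ⟨div_nonneg hy.1 hp.le, (div_lt_one hp).2 hy.2⟩, zero_add]
    change h _ + _ = v
    rw [hfl, add_sub_cancel_right, hyv, sub_add_cancel]
  exact ⟨hf.orderIsoOfSurjective f hs, fun x => ⟨⌊x / p⌋, _, hfr x, by ring, rfl⟩⟩

section Extension

open Real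

theorem exists_angle_orderIso (ρ : ℝ ≃o ℝ) : ∃ F : ℝ ≃o ℝ, ∀ x, ∃ n : ℤ, ∃ y ∈ Ico 0 (2 * π),
    x = y + n * (2 * π) ∧
      F x = (if y = 0 then 0 else lineAngle (ρ (circleToLine (Circle.exp y)))) + n * (2 * π) := by
  have hIoo : ∀ {y : ℝ}, y ∈ Ico 0 (2 * π) → y ≠ 0 → y ∈ Ioo 0 (2 * π) := fun hy h0 =>
    ⟨lt_of_le_of_ne hy.1 (Ne.symm h0), hy.2⟩
  refine exists_periodic_orderIso two_pi_pos
    (h := fun y => if y = 0 then 0 else lineAngle (ρ (circleToLine (Circle.exp y)))) ?_ ?_ ?_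
  · intro x hx y hy hxy
    have hy0 : y ≠ 0 := (hx.1.trans_lt hxy).ne'
    simp only [if_neg hy0]
    split_ifs with hx0
    · exact (lineAngle_mem _).1
    · refine lineAngle_strictMono (ρ.strictMono ?_)
      rwa [← lineAngle_strictMono.lt_iff_lt, lineAngle_circleToLine_exp (hIoo hx hx0),
        lineAngle_circleToLine_exp (hIoo hy hy0)]
  · intro x hx
    simp only
    split_ifs with hx0
    · exact ⟨le_rfl, two_pi_pos⟩
    · exact ⟨(lineAngle_mem _).1.le, (lineAngle_mem _).2⟩
  · intro y hy
    by_cases hy0 : y = 0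
    · exact ⟨0, ⟨le_rfl, two_pi_pos⟩, by simp [hy0]⟩
    obtain ⟨t, ht⟩ := exists_lineAngle_eq (hIoo hy hy0)
    have hm := lineAngle_mem (ρ.symm t)
    refine ⟨lineAngle (ρ.symm t), ⟨hm.1.le, hm.2⟩, ?_⟩
    simp only [if_neg hm.1.ne']
    rw [exp_lineAngle, circleToLine_lineToCircle, OrderIso.apply_symm_apply, ht]

open Classical in
/-- The extension of a map of the line to the circle. -/
noncomputable def extendToCircle (ρ : ℝ → ℝ) (z : Circle) : Circle :=
  if z = 1 then 1 else lineToCircle (ρ (circleToLine z))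

theorem extendToCircle_one (ρ : ℝ → ℝ) : extendToCircle ρ 1 = 1 := if_pos rfl

theorem extendToCircle_lineToCircle (ρ : ℝ → ℝ) (t : ℝ) :
    extendToCircle ρ (lineToCircle t) = lineToCircle (ρ t) := by
  rw [extendToCircle, if_neg (lineToCircle_ne_one t), circleToLine_lineToCircle]

theorem circle_cases {P : Circle → Prop} (h1 : P 1) (h : ∀ t, P (lineToCircle t)) (z : Circle) :
    P z := by
  by_cases hz : z = 1
  · rwa [hz]
  · rw [← lineToCircle_circleToLine hz]
    exact h _

theorem exists_extendToCircle_lift (ρ : ℝ ≃o ℝ) :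
    ∃ F : ℝ ≃o ℝ, ∀ x, extendToCircle ρ (Circle.exp x) = Circle.exp (F x) := by
  obtain ⟨F, hF⟩ := exists_angle_orderIso ρ
  refine ⟨F, fun x => ?_⟩
  obtain ⟨n, y, hy, hx, hFx⟩ := hF x
  have hper : ∀ (y : ℝ) (n : ℤ), Circle.exp (y + n * (2 * π)) = Circle.exp y := fun y n => by
    rw [Circle.exp_add, Circle.exp_int_mul_two_pi, mul_one]
  rw [hFx, hx, hper, hper]
  split_ifs with h0
  · rw [h0, Circle.exp_zero, extendToCircle_one]
  · obtain ⟨t, rfl⟩ := exists_lineAngle_eq ⟨lt_of_le_of_ne hy.1 (Ne.symm h0), hy.2⟩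
    rw [exp_lineAngle, extendToCircle_lineToCircle, circleToLine_lineToCircle, exp_lineAngle]

/-- The lift is an order isomorphism, hence continuous, and continuity descends through the quotient
map `Circle.exp`; no separate check at `1` is needed. -/
theorem continuous_extendToCircle (ρ : ℝ ≃o ℝ) : Continuous (extendToCircle ρ) := by
  obtain ⟨F, hF⟩ := exists_extendToCircle_lift ρ
  have hq : IsQuotientMap Circle.exp := isLocalHomeomorph_circleExp.isOpenMap.isQuotientMap
    Circle.exp.continuous Circle.exp_surjective
  rw [hq.continuous_iff]
  have : extendToCircle ρ ∘ Circle.exp = Circle.exp ∘ F := funext hF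
  rw [this]
  exact Circle.exp.continuous.comp F.continuous

/-- Every increasing homeomorphism of the line extends to the circle. -/
noncomputable def extendHomeo (ρ : ℝ ≃o ℝ) : fixOne :=
  ⟨⟨{ toFun := extendToCircle ρ
      invFun := extendToCircle ρ.symm
      left_inv := circle_cases (by simp [extendToCircle_one])
        (by simp [extendToCircle_lineToCircle])
      right_inv := circle_cases (by simp [extendToCircle_one])
        (by simp [extendToCircle_lineToCircle])
      continuous_toFun := continuous_extendToCircle ρ
      continuous_invFun := continuous_extendToCircle ρ.symm }, exists_extendToCircle_lift ρ⟩,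
    extendToCircle_one ρ⟩

theorem extendHomeo_smul (ρ : ℝ ≃o ℝ) (t : ℝ) : extendHomeo ρ • t = ρ t :=
  lineToCircle_injective ((lineToCircle_smul _ _).trans (extendToCircle_lineToCircle ρ t))

end Extension

/-- The affine map `t ↦ a t + b`. -/
noncomputable def affineOrderIso (a b : ℝ) (ha : 0 < a) : ℝ ≃o ℝ :=
  (OrderIso.mulLeft₀ a ha).trans (OrderIso.addRight b)

theorem affineOrderIso_apply (a b : ℝ) (ha : 0 < a) (t : ℝ) : affineOrderIso a b ha t = a * t + b :=
  rfl

theorem mem_PSL2R_of_affine {g : fixOne} {a b : ℝ} (ha : 0 < a) (h : ∀ t : ℝ, g • t = a * t + b) :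
    (g : HomeoPlus) ∈ PSL2R := by
  have hs : Real.sqrt a ≠ 0 := (Real.sqrt_pos.2 ha).ne'
  let A : SL(2, ℝ) := ⟨!![Real.sqrt a, b / Real.sqrt a; 0, (Real.sqrt a)⁻¹], by
    rw [Matrix.det_fin_two_of]
    field_simp
    ring⟩
  have e00 : A 0 0 = Real.sqrt a := rfl
  have e01 : A 0 1 = b / Real.sqrt a := rfl
  have e10 : A 1 0 = 0 := rfl
  have e11 : A 1 1 = (Real.sqrt a)⁻¹ := rfl
  refine ⟨A, circle_cases ?_ fun t => ?_⟩
  · rw [show ((g : HomeoPlus) : Circle ≃ₜ Circle) 1 = 1 from g.2, cayley_one,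
      SpecialLinearGroup.smul_infty_eq_ite, if_pos e10]
  · rw [← lineToCircle_smul, cayley_lineToCircle, cayley_lineToCircle, h,
      SpecialLinearGroup.smul_coe_eq_ite, e00, e01, e10, e11, if_neg (by simpa using hs)]
    congr 1
    have := Real.sq_sqrt ha.le
    field_simp
    rw [mul_zero, zero_add, mul_one, this]
    ring

theorem exists_affine_of_mem_PSL2R {g : fixOne} (hg : (g : HomeoPlus) ∈ PSL2R) :
    ∃ a b : ℝ, ∀ t : ℝ, g • t = a * t + b := by
  obtain ⟨A, hA⟩ := hg
  have h1 := hA 1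
  rw [show ((g : HomeoPlus) : Circle ≃ₜ Circle) 1 = 1 from g.2, cayley_one,
    SpecialLinearGroup.smul_infty_eq_ite] at h1
  have h10 : A 1 0 = 0 := by
    by_contra h
    rw [if_neg h] at h1
    exact OnePoint.infty_ne_coe _ h1
  have h11 : A 1 1 ≠ 0 := fun h => by
    have := SpecialLinearGroup.det_eq A
    rw [h10, h] at this
    norm_num at this
  refine ⟨A 0 0 / A 1 1, A 0 1 / A 1 1, fun t => ?_⟩
  have ht := hA (lineToCircle t)
  rw [← lineToCircle_smul, cayley_lineToCircle, cayley_lineToCircle,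
    SpecialLinearGroup.smul_coe_eq_ite, h10, if_neg (by simpa using h11),
    OnePoint.coe_eq_coe] at ht
  rw [ht]
  ring

/-- The coefficients are written as values of `g` itself, so membership becomes a family of closed
conditions. -/
theorem mem_PSL2R_iff_affine (g : fixOne) :
    (g : HomeoPlus) ∈ PSL2R ↔ ∀ t : ℝ, g • t = (g • (1 : ℝ) - g • (0 : ℝ)) * t + g • (0 : ℝ) := by
  constructor
  · intro h
    obtain ⟨a, b, hab⟩ := exists_affine_of_mem_PSL2R h
    intro t
    rw [hab, hab, hab]
    ring
  · exact fun h => mem_PSL2R_of_affine (sub_pos.2 (smul_strictMono g zero_lt_one)) h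

/-- The composition of a homeomorphism with the rotation which makes it fix `1`. -/
noncomputable def rotateToFixOne (g : HomeoPlus) : fixOne :=
  ⟨rotationHomeo ((g : Circle ≃ₜ Circle) 1)⁻¹ * g, inv_mul_cancel ((g : Circle ≃ₜ Circle) 1)⟩

theorem coe_rotateToFixOne (g : HomeoPlus) :
    (rotateToFixOne g : HomeoPlus) = rotationHomeo ((g : Circle ≃ₜ Circle) 1)⁻¹ * g := rfl

theorem continuous_rotateToFixOne : Continuous rotateToFixOne := by
  refine Continuous.subtype_mk ((continuous_rotationHomeo.comp (Continuous.inv ?_)).mul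
    continuous_id) _
  exact continuous_homeoPlus_eval.comp (continuous_id.prodMk continuous_const)

theorem rotateToFixOne_mem_iff {G : Subgroup HomeoPlus} (hG : PSL2R ≤ G) (g : HomeoPlus) :
    (rotateToFixOne g : HomeoPlus) ∈ G ↔ g ∈ G := by
  rw [coe_rotateToFixOne]
  exact Subgroup.mul_mem_cancel_left G (hG (rotationHomeo_mem _))

theorem isClosed_PSL2R : IsClosed (PSL2R : Set HomeoPlus) := by
  have : (PSL2R : Set HomeoPlus) = ⋂ t : ℝ, {g | rotateToFixOne g • t =
      (rotateToFixOne g • (1 : ℝ) - rotateToFixOne g • (0 : ℝ)) * t + rotateToFixOne g • (0 : ℝ)} := by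
    ext g
    rw [SetLike.mem_coe, ← rotateToFixOne_mem_iff le_rfl, mem_PSL2R_iff_affine]
    simp
  have hc : ∀ t : ℝ, Continuous fun g => rotateToFixOne g • t := fun t =>
    continuous_rotateToFixOne.smul continuous_const
  rw [this]
  exact isClosed_iInter fun t =>
    isClosed_eq (hc t) ((((hc 1).sub (hc 0)).mul continuous_const).add (hc 0))

theorem PSL2R_ne_top : PSL2R ≠ ⊤ := by
  intro h
  have hodd : Odd 3 := by decide
  -- The cube fixes `0` and `1` but sends `2` to `8`, so it is not affine.
  let ρ : ℝ ≃o ℝ := (hodd.strictMono_pow (R := ℝ)).orderIsoOfSurjective (fun t : ℝ => t ^ 3) (by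
    refine Continuous.surjective (by fun_prop) ?_ ?_
    · exact Filter.tendsto_pow_atTop (by norm_num)
    · have := Filter.tendsto_neg_atTop_atBot.comp ((Filter.tendsto_pow_atTop (α := ℝ)
        (n := 3) (by norm_num)).comp Filter.tendsto_neg_atBot_atTop)
      refine this.congr fun t => ?_
      simp only [Function.comp_apply]
      ring)
  have hρ : ∀ t, ρ t = t ^ 3 := fun t => rfl
  have := (mem_PSL2R_iff_affine (extendHomeo ρ)).1 (h ▸ Subgroup.mem_top _) 2
  simp only [extendHomeo_smul, hρ] at this
  norm_num at this

end

/-! ### The path component of the stabilizer of `1` -/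

section

open Set Topology

section Affine

/-- A single fraction valid also at `z = 1`, which gives continuity jointly in the coefficients and
the point. -/
theorem coe_extendToCircle_affine {a b : ℝ} (ha : 0 < a) (z : Circle) :
    Complex.I * a * (1 + z) + (b + Complex.I) * (1 - z) ≠ 0 ∧
    (extendToCircle (fun t => a * t + b) z : ℂ) =
      (Complex.I * a * (1 + z) + (b - Complex.I) * (1 - z)) /
        (Complex.I * a * (1 + z) + (b + Complex.I) * (1 - z)) := by
  refine circle_cases (P := fun z : Circle =>
    Complex.I * a * (1 + z) + (b + Complex.I) * (1 - z) ≠ 0 ∧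
    (extendToCircle (fun t => a * t + b) z : ℂ) =
      (Complex.I * a * (1 + z) + (b - Complex.I) * (1 - z)) /
        (Complex.I * a * (1 + z) + (b + Complex.I) * (1 - z))) ?_ (fun t => ?_) z
  · have hne : Complex.I * a * (1 + 1) ≠ 0 :=
      mul_ne_zero (mul_ne_zero Complex.I_ne_zero (Complex.ofReal_ne_zero.2 ha.ne')) (by norm_num)
    rw [extendToCircle_one, Circle.coe_one, sub_self, mul_zero, mul_zero, add_zero, div_self hne]
    exact ⟨hne, rfl⟩
  · have h1 := ofReal_add_I_ne_zero t
    have h2 := ofReal_add_I_ne_zero (a * t + b)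
    have e1 : Complex.I * a * (1 + (t - Complex.I) / (t + Complex.I)) +
        (b + Complex.I) * (1 - (t - Complex.I) / (t + Complex.I)) =
        ((a * t + b : ℝ) + Complex.I) * (2 * Complex.I / (t + Complex.I)) := by
      push_cast
      field_simp
      ring
    have e2 : Complex.I * a * (1 + (t - Complex.I) / (t + Complex.I)) +
        (b - Complex.I) * (1 - (t - Complex.I) / (t + Complex.I)) =
        ((a * t + b : ℝ) - Complex.I) * (2 * Complex.I / (t + Complex.I)) := by
      push_cast
      field_simp
      ring
    have h3 : 2 * Complex.I / (t + Complex.I) ≠ 0 :=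
      div_ne_zero (mul_ne_zero two_ne_zero Complex.I_ne_zero) h1
    rw [extendToCircle_lineToCircle, coe_lineToCircle, coe_lineToCircle, e1, e2]
    exact ⟨mul_ne_zero h2 h3, (mul_div_mul_right _ _ h3).symm⟩

theorem continuous_extendToCircle_affine {X : Type*} [TopologicalSpace X] {a b : X → ℝ}
    (ha : Continuous a) (hb : Continuous b) (hpos : ∀ x, 0 < a x) :
    Continuous fun p : X × Circle => extendToCircle (fun t => a p.1 * t + b p.1) p.2 := by
  refine continuous_induced_rng.2 ?_
  have : ((↑) : Circle → ℂ) ∘ (fun p : X × Circle => extendToCircle (fun t => a p.1 * t + b p.1) p.2)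
      = fun p => (Complex.I * a p.1 * (1 + p.2) + (b p.1 - Complex.I) * (1 - p.2)) /
        (Complex.I * a p.1 * (1 + p.2) + (b p.1 + Complex.I) * (1 - p.2)) :=
    funext fun p => (coe_extendToCircle_affine (hpos p.1) p.2).2
  change Continuous (((↑) : Circle → ℂ) ∘ _)
  rw [this]
  exact Continuous.div (by fun_prop) (by fun_prop)
    fun p => (coe_extendToCircle_affine (hpos p.1) p.2).1

/-- The affine map `t ↦ a t + b` of the line, extended to the circle. -/
noncomputable def affineHomeo (a b : ℝ) (ha : 0 < a) : fixOne :=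
  extendHomeo (affineOrderIso a b ha)

theorem affineHomeo_smul (a b : ℝ) (ha : 0 < a) (t : ℝ) : affineHomeo a b ha • t = a * t + b :=
  extendHomeo_smul _ _

theorem continuous_affineHomeo {X : Type*} [TopologicalSpace X] {a b : X → ℝ}
    (ha : Continuous a) (hb : Continuous b) (hpos : ∀ x, 0 < a x) :
    Continuous fun x => affineHomeo (a x) (b x) (hpos x) := by
  refine Continuous.subtype_mk (f := fun x => (affineHomeo (a x) (b x) (hpos x) : HomeoPlus)) ?_ _
  refine continuous_homeoPlus_of_uncurry ?_ ?_
  · exact continuous_extendToCircle_affine ha hb hpos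
  · have := continuous_extendToCircle_affine (ha.inv₀ fun x => (hpos x).ne')
      ((hb.div₀ ha fun x => (hpos x).ne').neg) fun x => inv_pos.2 (hpos x)
    refine this.congr fun p => ?_
    change _ = extendToCircle (affineOrderIso (a p.1) (b p.1) (hpos p.1)).symm p.2
    congr 1
    funext t
    rw [OrderIso.eq_symm_apply, affineOrderIso_apply]
    have := (hpos p.1).ne'
    simp only [Pi.neg_apply, Pi.inv_apply]
    field_simp
    ring

end Affine

/-- The elements joined to `1` inside the stabilizer of `1` in a group of homeomorphisms of the
circle. -/
def pathGroup (G : Subgroup HomeoPlus) : Subgroup fixOne where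
  carrier := pathComponentIn {h : fixOne | (h : HomeoPlus) ∈ G} 1
  one_mem' := JoinedIn.refl (one_mem G)
  mul_mem' := fun {f g} hf hg => by
    have := JoinedIn.mul hf hg
    rw [one_mul] at this
    refine this.mono ?_
    rintro _ ⟨a, ha, b, hb, rfl⟩
    exact G.mul_mem ha hb
  inv_mem' := fun {f} hf => by
    have := JoinedIn.inv hf
    rw [inv_one] at this
    refine this.mono fun a ha => ?_
    have ha' : ((a⁻¹ : fixOne) : HomeoPlus) ∈ G := ha
    simpa using inv_mem ha'

variable {G : Subgroup HomeoPlus}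

theorem coe_mem_of_mem_pathGroup {g : fixOne} (hg : g ∈ pathGroup G) : (g : HomeoPlus) ∈ G :=
  JoinedIn.target_mem (F := {h : fixOne | (h : HomeoPlus) ∈ G}) (x := 1) hg

instance : PathConnectedSpace (pathGroup G) :=
  isPathConnected_iff_pathConnectedSpace.1
    (isPathConnected_pathComponentIn (F := {h : fixOne | (h : HomeoPlus) ∈ G}) (one_mem G))

theorem map_mem_pathGroup {N : fixOne → fixOne} (hN : Continuous N) (h1 : N 1 = 1)
    (hG : ∀ g : fixOne, (g : HomeoPlus) ∈ G → (N g : HomeoPlus) ∈ G) {g : fixOne}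
    (hg : g ∈ pathGroup G) : N g ∈ pathGroup G := by
  have := JoinedIn.map hg hN
  rw [h1] at this
  exact this.mono (image_subset_iff.2 hG)

theorem affineHomeo_mem_pathGroup (hG : PSL2R ≤ G) (a b : ℝ) (ha : 0 < a) :
    affineHomeo a b ha ∈ pathGroup G := by
  have hc : Continuous fun s : ℝ =>
      affineHomeo (Real.exp (s * Real.log a)) (s * b) (Real.exp_pos _) :=
    continuous_affineHomeo (by fun_prop) (by fun_prop) _
  refine JoinedIn.ofLine hc.continuousOn (fixOne_ext fun t => ?_) (fixOne_ext fun t => ?_) ?_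
  · simp [affineHomeo_smul]
  · simp [affineHomeo_smul, Real.exp_log ha]
  · rintro _ ⟨s, -, rfl⟩
    exact hG (mem_PSL2R_of_affine (Real.exp_pos _) (affineHomeo_smul _ _ _))

/-- Conjugation by `z ↦ -z`, followed by a rotation which restores the fixed point `1`. -/
theorem exists_conj_neg_inv (hG : PSL2R ≤ G) {g : fixOne} (hg : g ∈ pathGroup G)
    (h0 : g • (0 : ℝ) = 0) :
    ∃ g' ∈ pathGroup G, g' • (0 : ℝ) = 0 ∧ ∀ t : ℝ, t ≠ 0 → g' • (-t⁻¹) = -(g • t)⁻¹ := by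
  have hz0 : lineToCircle 0 = -1 := by
    apply Circle.ext
    rw [coe_lineToCircle]
    have : ((-1 : Circle) : ℂ) = -1 := rfl
    rw [this]
    simp
  let J : HomeoPlus := rotationHomeo (-1)
  have hJ : J ∈ G := hG (rotationHomeo_mem _)
  have hJz : ∀ z, (J : Circle ≃ₜ Circle) z = -z := fun z => neg_one_mul z
  -- Elements on the path from `1` to `g` need not fix `0`, so their conjugates need not fix `1`;
  -- the rotation corrects this continuously and is trivial when `0` is fixed.
  let N : fixOne → fixOne := fun g => rotateToFixOne (J * g * J)
  have hN : Continuous N := continuous_rotateToFixOne.comp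
    ((continuous_const.mul continuous_subtype_val).mul continuous_const)
  have happ : ∀ (h : fixOne) (z : Circle), ((J * h * J : HomeoPlus) : Circle ≃ₜ Circle) z =
      -((h : HomeoPlus) : Circle ≃ₜ Circle) (-z) := fun h z => by
    change (J : Circle ≃ₜ Circle) (((h : HomeoPlus) : Circle ≃ₜ Circle) ((J : Circle ≃ₜ Circle) z)) = _
    rw [hJz, hJz]
  have hNapp : ∀ h : fixOne, h • (0 : ℝ) = 0 → ∀ z, ((N h : HomeoPlus) : Circle ≃ₜ Circle) z =
      -((h : HomeoPlus) : Circle ≃ₜ Circle) (-z) := fun h h0 z => by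
    change (((J * h * J : HomeoPlus) : Circle ≃ₜ Circle) 1)⁻¹ *
      ((J * h * J : HomeoPlus) : Circle ≃ₜ Circle) z = _
    rw [happ, happ, ← hz0, ← lineToCircle_smul, h0, hz0, neg_neg, inv_one, one_mul]
  have hN1 : N 1 = 1 := by
    apply Subtype.ext
    apply Subtype.ext
    apply Homeomorph.ext
    intro z
    rw [hNapp 1 (one_smul _ _)]
    exact neg_neg z
  refine ⟨N g, map_mem_pathGroup hN hN1 (fun h hh => ?_) hg, ?_, fun t ht => ?_⟩
  · exact (rotateToFixOne_mem_iff hG _).2 (mul_mem (mul_mem hJ hh) hJ)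
  · apply lineToCircle_injective
    rw [lineToCircle_smul, hNapp g h0, hz0, neg_neg,
      show ((g : HomeoPlus) : Circle ≃ₜ Circle) 1 = 1 from g.2]
  · apply lineToCircle_injective
    have hgt : g • t ≠ 0 := fun h => ht ((smul_strictMono g).injective (h.trans h0.symm))
    rw [lineToCircle_smul, hNapp g h0, lineToCircle_neg_inv ht, neg_neg, ← lineToCircle_smul,
      lineToCircle_neg_inv hgt]

/-- For `s ≠ 0` the conjugate has no fixed point, so its slope is `1`. Then `f - f 0` is additive
and continuous, hence linear. -/
theorem affine_of_conj_translation {f : fixOne}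
    (h : ∀ s : ℝ, ∃ p q : ℝ, ∀ t : ℝ, (f * affineHomeo 1 s one_pos * f⁻¹) • t = p * t + q) :
    (f : HomeoPlus) ∈ PSL2R := by
  have hadd : ∀ t s : ℝ, f • (t + s) - f • (0 : ℝ) =
      (f • t - f • (0 : ℝ)) + (f • s - f • (0 : ℝ)) := by
    intro t s
    obtain ⟨p, q, hpq⟩ := h s
    have hf : ∀ t : ℝ, f • (t + s) = p * f • t + q := fun t => by
      rw [← hpq, mul_smul, mul_smul, inv_smul_smul, affineHomeo_smul, one_mul]
    have hp : p = 1 ∨ s = 0 := by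
      by_contra! hne
      have h1 : 1 - p ≠ 0 := sub_ne_zero.2 hne.1.symm
      have h2 := hf (f⁻¹ • (q / (1 - p)))
      rw [smul_inv_smul] at h2
      have h3 : p * (q / (1 - p)) + q = f • f⁻¹ • (q / (1 - p)) := by
        rw [smul_inv_smul]
        field_simp
        ring
      rw [h3] at h2
      have := (smul_strictMono f).injective h2
      exact hne.2 (by linarith)
    rcases hp with rfl | rfl
    · have h0 := hf 0
      rw [zero_add] at h0
      rw [hf, h0]
      ring
    · rw [add_zero]
      ring
  let φ : ℝ →+ ℝ := ⟨⟨fun t => f • t - f • (0 : ℝ), sub_self _⟩, hadd⟩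
  have hφ : Continuous φ := (continuous_const_smul f).sub continuous_const
  rw [mem_PSL2R_iff_affine]
  intro t
  have h1 : f • (t * 1) - f • (0 : ℝ) = t * (f • (1 : ℝ) - f • (0 : ℝ)) := map_real_smul φ hφ t 1
  rw [mul_one] at h1
  linarith

/-- The non-affine element `f` of `G` need not be joined to `1`, but conjugation by it preserves
`pathGroup G`. Were that group affine, `f` would conjugate translations to affine maps and be affine
itself. -/
theorem exists_nonaffine (hG : PSL2R ≤ G) (hne : G ≠ PSL2R) :
    ∃ g ∈ pathGroup G, g • (0 : ℝ) = 0 ∧ g • (1 : ℝ) = 1 ∧ ∃ t : ℝ, g • t ≠ t := by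
  obtain ⟨f, hfG, hf⟩ : ∃ f : fixOne, (f : HomeoPlus) ∈ G ∧ (f : HomeoPlus) ∉ PSL2R := by
    by_contra! h
    refine hne (le_antisymm (fun g hg => ?_) hG)
    rw [← rotateToFixOne_mem_iff le_rfl]
    exact h _ ((rotateToFixOne_mem_iff hG g).2 hg)
  by_contra! htriv
  refine hf (affine_of_conj_translation fun s => ?_)
  have hmem : f * affineHomeo 1 s one_pos * f⁻¹ ∈ pathGroup G :=
    map_mem_pathGroup (N := fun g => f * g * f⁻¹) (by fun_prop) (by simp)
      (fun g hg => mul_mem (mul_mem hfG hg) (inv_mem hfG)) (affineHomeo_mem_pathGroup hG 1 s one_pos)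
  set g := f * affineHomeo 1 s one_pos * f⁻¹
  have hpos : 0 < g • (1 : ℝ) - g • (0 : ℝ) := sub_pos.2 (smul_strictMono g zero_lt_one)
  refine ⟨g • (1 : ℝ) - g • (0 : ℝ), g • (0 : ℝ), fun t => ?_⟩
  have h1 := htriv ((affineHomeo _ (g • (0 : ℝ)) hpos)⁻¹ * g)
    (mul_mem (inv_mem (affineHomeo_mem_pathGroup hG _ _ hpos)) hmem)
    (by rw [mul_smul, inv_smul_eq_iff, affineHomeo_smul]; ring)
    (by rw [mul_smul, inv_smul_eq_iff, affineHomeo_smul]; ring) t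
  rwa [mul_smul, inv_smul_eq_iff, affineHomeo_smul] at h1

/-- The group `pathGroup G` is transitive on increasing tuples. -/
theorem exists_pathGroup_smul_eq (hG : PSL2R ≤ G) (hne : G ≠ PSL2R) {m : ℕ} {x y : Fin m → ℝ}
    (hx : StrictMono x) (hy : StrictMono y) : ∃ g ∈ pathGroup G, ∀ i, g • x i = y i := by
  obtain ⟨g, hg⟩ := exists_smul_eq_of_strictMono (Γ := pathGroup G)
    (fun g => smul_strictMono (g : fixOne))
    (fun a ha b => ⟨⟨affineHomeo a b ha, affineHomeo_mem_pathGroup hG a b ha⟩,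
      affineHomeo_smul a b ha⟩)
    (fun g h0 => by
      obtain ⟨g', hg', h⟩ := exists_conj_neg_inv hG g.2 h0
      exact ⟨⟨g', hg'⟩, h⟩)
    (by
      obtain ⟨g, hg, h⟩ := exists_nonaffine hG hne
      exact ⟨⟨g, hg⟩, h⟩) hx hy
  exact ⟨g, g.2, congrFun hg⟩

end

/-! ### Density from interpolation on grids -/

section

open Set Topology

section Density

open Real

theorem Circle.dist_exp_exp_le (x y : ℝ) : dist (Circle.exp x) (Circle.exp y) ≤ |x - y| := by
  have h : dist (Circle.exp x) (Circle.exp y) = ‖(Circle.exp x : ℂ) - Circle.exp y‖ := by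
    rw [← dist_eq_norm]
    rfl
  have h2 : (Circle.exp x : ℂ) - Circle.exp y =
      Circle.exp y * (Complex.exp (Complex.I * ((x - y : ℝ) : ℂ)) - 1) := by
    rw [Circle.coe_exp, Circle.coe_exp, mul_sub, ← Complex.exp_add, mul_one]
    congr 2
    push_cast
    ring
  rw [h, h2, norm_mul, Circle.norm_coe, one_mul]
  exact Real.norm_exp_I_mul_ofReal_sub_one_le

theorem exists_exp_eq (z : Circle) : ∃ x ∈ Ico 0 (2 * π), Circle.exp x = z := by
  refine circle_cases (P := fun z => ∃ x ∈ Ico 0 (2 * π), Circle.exp x = z)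
    ⟨0, ⟨le_rfl, two_pi_pos⟩, Circle.exp_zero⟩ (fun t => ?_) z
  exact ⟨lineAngle t, ⟨(lineAngle_mem t).1.le, (lineAngle_mem t).2⟩, exp_lineAngle t⟩

/-- Two lifts which agree on a fine grid are close, together with their inverses. -/
theorem dist_le_of_eq_on_grid {f g : HomeoPlus} {F K : ℝ ≃o ℝ}
    (hF : ∀ t, (f : Circle ≃ₜ Circle) (Circle.exp t) = Circle.exp (F t))
    (hK : ∀ t, (g : Circle ≃ₜ Circle) (Circle.exp t) = Circle.exp (K t))
    (hF0 : F 0 = 0) (hF1 : F (2 * π) = 2 * π) {N : ℕ} {x : ℕ → ℝ} (hx0 : x 0 = 0)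
    (hxN : x N = 2 * π) (hFK : ∀ i ≤ N, F (x i) = K (x i)) {ε : ℝ}
    (hxε : ∀ i < N, x (i + 1) - x i ≤ ε) (hFε : ∀ i < N, F (x (i + 1)) - F (x i) ≤ ε) :
    dist f g ≤ ε := by
  have hgrid : ∀ y ∈ Ico 0 (2 * π), ∃ i < N, x i ≤ y ∧ y ≤ x (i + 1) := by
    intro y hy
    by_contra! h
    have : ∀ i ≤ N, x i ≤ y := by
      intro i
      induction i with
      | zero => exact fun _ => hx0 ▸ hy.1
      | succ i ih => exact fun hi => (h i hi (ih (Nat.le_of_succ_le hi))).le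
    exact (hxN ▸ this N le_rfl).not_gt hy.2
  have hinv : ∀ {h : HomeoPlus} {H : ℝ ≃o ℝ},
      (∀ t, (h : Circle ≃ₜ Circle) (Circle.exp t) = Circle.exp (H t)) →
      ∀ t, (h : Circle ≃ₜ Circle)⁻¹ (Circle.exp t) = Circle.exp (H.symm t) := fun {h H} hH t => by
    change (h : Circle ≃ₜ Circle).symm (Circle.exp t) = _
    rw [Homeomorph.symm_apply_eq, hH, OrderIso.apply_symm_apply]
  change dist (f : Circle ≃ₜ Circle) g ≤ ε
  rw [dist_homeo_eq]
  refine ciSup_le fun z => max_le ?_ ?_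
  · obtain ⟨y, hy, rfl⟩ := exists_exp_eq z
    obtain ⟨i, hi, h1, h2⟩ := hgrid y hy
    rw [hF, hK]
    refine (Circle.dist_exp_exp_le _ _).trans (le_trans ?_ (hFε i hi))
    have e1 := F.monotone h1
    have e2 := F.monotone h2
    have e3 := K.monotone h1
    have e4 := K.monotone h2
    rw [← hFK i hi.le] at e3
    rw [← hFK (i + 1) hi] at e4
    rw [abs_le]
    constructor <;> linarith
  · obtain ⟨v, hv, rfl⟩ := exists_exp_eq z
    obtain ⟨i, hi, h1, h2⟩ := hgrid (F.symm v) ⟨by rw [OrderIso.le_symm_apply, hF0]; exact hv.1,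
      by rw [OrderIso.symm_apply_lt, hF1]; exact hv.2⟩
    rw [hinv hF, hinv hK]
    refine (Circle.dist_exp_exp_le _ _).trans (le_trans ?_ (hxε i hi))
    have e3 : x i ≤ K.symm v := by
      rw [OrderIso.le_symm_apply, ← hFK i hi.le, ← OrderIso.le_symm_apply]
      exact h1
    have e4 : K.symm v ≤ x (i + 1) := by
      rw [OrderIso.symm_apply_le, ← hFK (i + 1) hi, ← OrderIso.symm_apply_le]
      exact h2
    rw [abs_le]
    constructor <;> linarith

theorem exists_dist_le {G : Subgroup HomeoPlus} (hG : PSL2R ≤ G) (hne : G ≠ PSL2R) (f : fixOne)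
    {ε : ℝ} (hε : 0 < ε) : ∃ g ∈ G, dist (f : HomeoPlus) g ≤ ε := by
  obtain ⟨F, hF, hF0, hF1⟩ := exists_lift f f.2
  obtain ⟨δ, hδ, hFδ⟩ := Metric.uniformContinuousOn_iff.1
    ((isCompact_Icc (a := (0 : ℝ)) (b := 2 * π)).uniformContinuousOn_of_continuous
      F.continuous.continuousOn) ε hε
  obtain ⟨n, hn⟩ := exists_nat_gt (2 * π / min δ ε)
  rw [div_lt_iff₀ (lt_min hδ hε)] at hn
  have hstep0 : 0 < 2 * π / (n + 1) := by positivity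
  have hstep : 2 * π / (n + 1) < min δ ε := by
    rw [div_lt_iff₀ (by positivity)]
    nlinarith [lt_min hδ hε]
  let x : ℕ → ℝ := fun i => i * (2 * π / (n + 1))
  have hx0 : x 0 = 0 := by simp [x]
  have hxN : x (n + 1) = 2 * π := by
    simp only [x]
    push_cast
    field_simp
  have hxs : ∀ i, x (i + 1) - x i = 2 * π / (n + 1) := fun i => by
    simp only [x]
    push_cast
    ring
  have hxm : StrictMono x := strictMono_nat_of_lt_succ fun i => by
    have := hxs i
    linarith
  have hmem : ∀ i ≤ n + 1, x i ∈ Icc 0 (2 * π) := fun i hi =>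
    ⟨hx0 ▸ hxm.monotone (Nat.zero_le i), hxN ▸ hxm.monotone hi⟩
  -- Only the `n` interior grid angles need interpolating; the lifts already agree at `0` and `2π`.
  choose t ht using fun i : Fin n => exists_lineAngle_eq (x := x (i + 1))
    ⟨hx0 ▸ hxm (Nat.succ_pos i), hxN ▸ hxm (Nat.succ_lt_succ i.2)⟩
  have htm : StrictMono t := fun i j hij => by
    rw [← lineAngle_strictMono.lt_iff_lt, ht, ht]
    exact hxm (Nat.succ_lt_succ hij)
  obtain ⟨g, hg, hgt⟩ := exists_pathGroup_smul_eq hG hne htm (y := fun i => f • t i)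
    fun i j hij => smul_strictMono f (htm hij)
  obtain ⟨K, hK, hK0, hK1⟩ := exists_lift g g.2
  refine ⟨g, coe_mem_of_mem_pathGroup hg, dist_le_of_eq_on_grid hF hK hF0 hF1 hx0 hxN ?_ ?_ ?_⟩
  · intro i hi
    rcases Nat.eq_zero_or_pos i with rfl | h0
    · rw [hx0, hF0, hK0]
    rcases hi.eq_or_lt with rfl | hlt
    · rw [hxN, hF1, hK1]
    obtain ⟨j, rfl⟩ : ∃ j, i = j + 1 := ⟨i - 1, by omega⟩
    have hj : j < n := by omega
    have := ht ⟨j, hj⟩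
    simp only at this
    rw [← this, ← lineAngle_smul f hF hF0 hF1, ← lineAngle_smul g hK hK0 hK1, hgt]
  · intro i _
    rw [hxs]
    exact (hstep.trans_le (min_le_right _ _)).le
  · intro i hi
    have := hFδ (x (i + 1)) (hmem _ hi) (x i) (hmem _ hi.le) (by
      rw [Real.dist_eq, hxs, abs_of_pos hstep0]
      exact hstep.trans_le (min_le_left _ _))
    rw [Real.dist_eq] at this
    exact (le_abs_self _).trans this.le

end Density

end

/-- `PSL(2, ℝ)` is a maximal closed subgroup of `Homeo⁺(S¹)`: it is a closed proper subgroup, and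
the only closed subgroups which contain it are itself and the whole group. -/
theorem mainTheorem3 :
    IsClosed (PSL2R : Set HomeoPlus) ∧ PSL2R ≠ ⊤ ∧
      ∀ G : Subgroup HomeoPlus, IsClosed (G : Set HomeoPlus) → PSL2R ≤ G →
        G = PSL2R ∨ G = ⊤ := by
  refine ⟨isClosed_PSL2R, PSL2R_ne_top, fun G hGc hG => or_iff_not_imp_left.2 fun hne => ?_⟩
  rw [eq_top_iff]
  intro f _
  -- Rotating `f` to fix `1` does not affect membership in `G`, so approximating maps that fix `1`
  -- suffices.
  rw [← rotateToFixOne_mem_iff hG, ← SetLike.mem_coe, ← hGc.closure_eq, Metric.mem_closure_iff]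
  intro ε hε
  obtain ⟨g, hg, hd⟩ := exists_dist_le hG hne (rotateToFixOne f) (half_pos hε)
  exact ⟨g, hg, hd.trans_lt (half_lt_self hε)⟩
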